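/- Setting. Let $d\ge 0$, $n,m\ge 1$, and let $P(x)=\frac1n\sum_{\tau=1}^n f^{(\tau)}(x)+\psi(x)$ on $\mathbb R^d$ with $f^{(\tau)}=\frac1m\sum_{i=1}^m f_i^{(\tau)}$. Assume that each $f_i^{(\tau)}$ is convex and $L$-smooth, each $f^{(\tau)}$ is $\bar L$-smooth, $\frac1n\sum_\tau f^{(\tau)}$ is $L_f$-smooth, and $\psi$ is $\lambda$-strongly convex ($\lambda>0$) and $L_\psi$-smooth. Let $Q,Q_1$ be randomized maps of $\mathbb R^d$ and $\delta,\delta_1\in(0,1]$ with, for all $x$, $\mathbb E\|x-Q(x)\|^2\le(1-\delta)\|x\|^2$, $\mathbb E\|x-Q_1(x)\|^2\le(1-\delta_1)\|x\|^2$, $\mathbb E[Q(x)]=\delta x$ and $\mathbb E[Q_1(x)]=\delta_1x$. Let $\kappa\ge0$, $q=\lambda/(\lambda+\kappa)$, $0\le\rho_0<\sqrt q$, $x^0\in\mathbb R^d$, $P^*=\min P$ and $\epsilon_k=\frac29(P(x^0)-P^*)(1-\rho_0)^k$. Outer method (Catalyst). Put $y^0=x^0$, $\alpha_0=\sqrt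 q$. For $k=1,2,\dots$ let $G_k(x)=P(x)+\frac\kappa2\|x-y^{k-1}\|^2$, $G_k^*=\min G_k$, let $x^k$ be the output of the inner method below, let $\alpha_k>0$ solve $\alpha_k^2=(1-\alpha_k)\alpha_{k-1}^2+q\alpha_k$, and put $y^k=x^k+\frac{\alpha_{k-1}(1-\alpha_{k-1})}{\alpha_{k-1}^2+\alpha_k}(x^k-x^{k-1})$. Inner method (EC-LSVRG on $G_k$, stepsize $\eta$, probability $p\in(0,1]$). Let $F_i^{(\tau)}=f_i^{(\tau)}+\psi+\frac\kappa2\|\cdot-y^{k-1}\|^2$ and $F^{(\tau)}=\frac1m\sum_iF_i^{(\tau)}$. Start from $x_{(k)}^0=w_{(k)}^0=x^{k-1}$, $e_\tau^0=0$, $h_\tau^0=\nabla f^{(\tau)}(x^{k-1})+\nabla\psi(x^{k-1})+\kappa(x^{k-1}-y^{k-1})$. In iteration $K=0,1,\dots$, draw indices $i_\tau$ uniform on $\{1,\dots,m\}$, a coin $u\in\{0,1\}$ with $\Pr(u=1)=p$, and the randomness of $Q$ and $Q_1$ on every node, all independent of each other and of the past. With $g_\tau=\nabla F_{i_\tau}^{(\tau)}(x^K)-\nabla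 F_{i_\tau}^{(\tau)}(w^K)+\nabla F^{(\tau)}(w^K)-h_\tau^K$, $y_\tau=Q(\eta g_\tau+e_\tau^K)$ and $z_\tau=Q_1(\nabla F^{(\tau)}(w^K)-h_\tau^K)$, put $$x^{K+1}=x^K-\tfrac1n\sum_\tau y_\tau-\tfrac\eta n\sum_\tau h_\tau^K,\quad e_\tau^{K+1}=e_\tau^K+\eta g_\tau-y_\tau,\quad h_\tau^{K+1}=h_\tau^K+z_\tau,$$ and $w^{K+1}=x^K$ if $u=1$, $w^{K+1}=w^K$ otherwise. With $\tilde\theta=\min\{\frac{(\lambda+\kappa)\eta}2,\frac\delta4,\frac{\delta_1}4,\frac p4\}$, let $\bar x_{(k)}^K$ be the average of $x_{(k)}^0,\dots,x_{(k)}^K$ with weights proportional to $(1-\tilde\theta)^{-j}$. The inner method stops after $T_k=\inf\{K\ge1:\ G_k(\bar x_{(k)}^K)-G_k^*\le\epsilon_k\}$ iterations and outputs $x^k=\bar x_{(k)}^{T_k}$. Claim. For all $0<c_1\le c_2$ there are constants $a,C>0$, depending only on $c_1,c_2$, such that, whenever $c_1\delta_1\le p\le c_2\delta_1$ and $$\eta=a\Big/\Big(L_f+L_\psi+\kappa+\tfrac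 Ln+\tfrac{\sqrt{1-\delta}\,(L_f+L_\psi+\kappa)}{\delta}\Big),$$ for every $k\ge1$ the time $T_k$ is measurable and $$\mathbb E[T_k]\le C\Big(1+\log\tfrac1{\sqrt q-\rho_0}\Big)\left(\frac1\delta+\frac1{\delta_1}+\frac{L_f+L_\psi}{\lambda+\kappa}+\frac L{n(\lambda+\kappa)}+\frac{\sqrt{1-\delta}\,(L_f+L_\psi+\kappa)}{\delta(\lambda+\kappa)}\right).$$ -/

import Mathlib

open MeasureTheory ProbabilityTheory
open scoped ENNReal

noncomputable section

namespace ECLSVRG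

/-- The Euclidean space `ℝ^d`. -/
abbrev Vec (d : ℕ) := EuclideanSpace ℝ (Fin d)

/-- `f` is `L`-smooth: differentiable with `L`-Lipschitz gradient. -/
def SmoothWith {d : ℕ} (L : ℝ) (f : Vec d → ℝ) : Prop :=
  0 ≤ L ∧ Differentiable ℝ f ∧ ∀ x y, ‖gradient f x - gradient f y‖ ≤ L * ‖x - y‖

/-- The local loss `f^(τ) = (1/m) ∑_i f_i^(τ)` of node `τ`. -/
def nodeAvg {d n m : ℕ} (f : Fin n → Fin m → Vec d → ℝ) (τ : Fin n) (x : Vec d) : ℝ :=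
  (1 / (m : ℝ)) * ∑ i, f τ i x

/-- The global loss `(1/n) ∑_τ f^(τ)`. -/
def globalAvg {d n m : ℕ} (f : Fin n → Fin m → Vec d → ℝ) (x : Vec d) : ℝ :=
  (1 / (n : ℝ)) * ∑ τ, nodeAvg f τ x

/-- The standing assumptions on the problem `P = (1/n) ∑_τ f^(τ) + ψ` in the smooth case: every
`f_i^(τ)` is convex and `L`-smooth, every `f^(τ)` is `Lbar`-smooth, the global loss is
`Lf`-smooth, and `ψ` is `lam`-strongly convex and `Lψ`-smooth. -/
structure ProblemAssumptions {d n m : ℕ} (f : Fin n → Fin m → Vec d → ℝ) (ψ : Vec d → ℝ)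
    (Lf Lbar L Lψ lam : ℝ) : Prop where
  convex : ∀ τ i, ConvexOn ℝ Set.univ (f τ i)
  smooth_global : SmoothWith Lf (globalAvg f)
  smooth_node : ∀ τ, SmoothWith Lbar (nodeAvg f τ)
  smooth_component : ∀ τ i, SmoothWith L (f τ i)
  lam_pos : 0 < lam
  strongConvex : StrongConvexOn Set.univ lam ψ
  smooth_reg : SmoothWith Lψ ψ

/-- A randomized map of `ℝ^d` is given by a law `ν` of seeds `s` and a jointly measurable
`Q : S → ℝ^d → ℝ^d`. It is a contraction compressor with parameter `δ ∈ (0, 1]` if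
`E ‖x - Q(x)‖² ≤ (1 - δ) ‖x‖²` for all `x`. -/
structure IsContractionCompressor {d : ℕ} {S : Type*} [MeasurableSpace S] (ν : Measure S)
    (Q : S → Vec d → Vec d) (δ : ℝ) : Prop where
  measurable : Measurable (Function.uncurry Q)
  pos : 0 < δ
  le_one : δ ≤ 1
  integrable : ∀ x, Integrable (fun s => ‖x - Q s x‖ ^ 2) ν
  contraction : ∀ x, ∫ s, ‖x - Q s x‖ ^ 2 ∂ν ≤ (1 - δ) * ‖x‖ ^ 2

/-- `E[Q(x)] = δ x` for all `x`. -/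
def MeanScaled {d : ℕ} {S : Type*} [MeasurableSpace S] (ν : Measure S)
    (Q : S → Vec d → Vec d) (δ : ℝ) : Prop :=
  ∀ x, Integrable (fun s => Q s x) ν ∧ ∫ s, Q s x ∂ν = δ • x

/-- The randomness used by one iteration of EC-LSVRG: on each node a sampled index, a seed for `Q`
and a seed for `Q₁`; and one coin that decides on the update of the check point. -/
abbrev Noise (n m : ℕ) (S S₁ : Type*) := (Fin n → Fin m × S × S₁) × Bool

/-- The law of the randomness of one iteration: the indices are uniform, the coin shows `true` with
probability `p`, and everything is independent. -/
def noiseLaw (n m : ℕ) {S S₁ : Type*} [MeasurableSpace S] [MeasurableSpace S₁]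
    (ν : Measure S) (ν₁ : Measure S₁) (p : ℝ) : Measure (Noise n m S S₁) :=
  (Measure.pi fun _ : Fin n =>
      (uniformOn (Set.univ : Set (Fin m))).prod (ν.prod ν₁)).prod
    (ENNReal.ofReal p • Measure.dirac true + ENNReal.ofReal (1 - p) • Measure.dirac false)

/-- The variables `x^k`, `w^k`, `e_τ^k`, `h_τ^k` of EC-LSVRG. -/
structure State (d n : ℕ) where
  x : Vec d
  w : Vec d
  e : Fin n → Vec d
  h : Fin n → Vec d

section Algorithm

variable {d n m : ℕ} {S S₁ : Type*}

/-- `g_τ^k`, computed with the sampled index `i`. -/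
def localGrad (F : Fin n → Fin m → Vec d → ℝ) (s : State d n) (τ : Fin n) (i : Fin m) : Vec d :=
  gradient (F τ i) s.x - gradient (F τ i) s.w + gradient (nodeAvg F τ) s.w - s.h τ

/-- `y_τ^k = Q(η g_τ^k + e_τ^k)`. -/
def msgY (F : Fin n → Fin m → Vec d → ℝ) (η : ℝ) (Q : S → Vec d → Vec d)
    (s : State d n) (ξ : Noise n m S S₁) (τ : Fin n) : Vec d :=
  Q (ξ.1 τ).2.1 (η • localGrad F s τ (ξ.1 τ).1 + s.e τ)

/-- `z_τ^k = Q₁(∇f^(τ)(w^k) - h_τ^k)`. -/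
def msgZ (F : Fin n → Fin m → Vec d → ℝ) (Q₁ : S₁ → Vec d → Vec d)
    (s : State d n) (ξ : Noise n m S S₁) (τ : Fin n) : Vec d :=
  Q₁ (ξ.1 τ).2.2 (gradient (nodeAvg F τ) s.w - s.h τ)

/-- One iteration of EC-LSVRG on `(1/n) ∑_τ (1/m) ∑_i F τ i` without regularizer (so that the
proximal step is the identity). The variable `h^k` of the algorithm, which starts at the average of
the `h_τ^0` and is updated by the average of the `z_τ^k`, is the average of the `h_τ^k`. -/
def step (F : Fin n → Fin m → Vec d → ℝ) (η : ℝ) (Q : S → Vec d → Vec d)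
    (Q₁ : S₁ → Vec d → Vec d) (ξ : Noise n m S S₁) (s : State d n) : State d n where
  x := s.x - ((1 / (n : ℝ)) • ∑ τ, msgY F η Q s ξ τ + η • ((1 / (n : ℝ)) • ∑ τ, s.h τ))
  w := if ξ.2 = true then s.x else s.w
  e := fun τ => s.e τ + η • localGrad F s τ (ξ.1 τ).1 - msgY F η Q s ξ τ
  h := fun τ => s.h τ + msgZ F Q₁ s ξ τ

/-- The iterates of EC-LSVRG from the state `s₀`, driven by the noise sequence `ξ`. -/
def run (F : Fin n → Fin m → Vec d → ℝ) (η : ℝ) (Q : S → Vec d → Vec d)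
    (Q₁ : S₁ → Vec d → Vec d) (s₀ : State d n) (ξ : ℕ → Noise n m S S₁) : ℕ → State d n
  | 0 => s₀
  | K + 1 => step F η Q Q₁ (ξ K) (run F η Q Q₁ s₀ ξ K)

end Algorithm

/-- The output `x̄^K` of EC-LSVRG: the average of `x^0, …, x^K` with weights proportional to
`(1 - θ)^(-j)`. -/
def weightedAvg {d : ℕ} (θ : ℝ) (x : ℕ → Vec d) (K : ℕ) : Vec d :=
  (∑ j ∈ Finset.range (K + 1), ((1 - θ) ^ j)⁻¹)⁻¹ •
    ∑ j ∈ Finset.range (K + 1), ((1 - θ) ^ j)⁻¹ • x j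

/-- The data of Catalyst with EC-LSVRG as inner method. -/
structure Setup (d n m : ℕ) (S S₁ : Type*) where
  /-- the losses `f_i^(τ)` -/
  f : Fin n → Fin m → Vec d → ℝ
  /-- the regularizer -/
  ψ : Vec d → ℝ
  /-- the strong convexity parameter `λ` -/
  lam : ℝ
  /-- the Catalyst parameter `κ` -/
  kap : ℝ
  /-- the Catalyst parameter `ρ₀` -/
  rho : ℝ
  /-- the starting point -/
  x₀ : Vec d
  /-- the stepsize of EC-LSVRG -/
  η : ℝ
  /-- the update probability of EC-LSVRG -/
  p : ℝ
  /-- the parameter of `Q` -/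
  δ : ℝ
  /-- the parameter of `Q₁` -/
  δ₁ : ℝ
  /-- the compressor of the gradients -/
  Q : S → Vec d → Vec d
  /-- the compressor of the shifts -/
  Q₁ : S₁ → Vec d → Vec d

/-- The variables `x^k`, `y^k`, `α_k` of Catalyst. -/
structure Outer (d : ℕ) where
  x : Vec d
  y : Vec d
  α : ℝ

namespace Setup

variable {d n m : ℕ} {S S₁ : Type*} (D : Setup d n m S S₁)

/-- The objective `P`. -/
def P (x : Vec d) : ℝ := globalAvg D.f x + D.ψ x

/-- `P^* = min P`. -/
def Pmin : ℝ := ⨅ x, D.P x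

/-- The objective `P + (κ/2) ‖· - y‖²` of the subproblem with prox-center `y`. -/
def G (y x : Vec d) : ℝ := D.P x + D.kap / 2 * ‖x - y‖ ^ 2

/-- The minimum of the subproblem's objective. -/
def Gmin (y : Vec d) : ℝ := ⨅ x, D.G y x

/-- The losses of the subproblem: `ψ` and the quadratic term are moved into each `f_i^(τ)`. -/
def subLoss (y : Vec d) (τ : Fin n) (i : Fin m) (x : Vec d) : ℝ :=
  D.f τ i x + D.ψ x + D.kap / 2 * ‖x - y‖ ^ 2

/-- `q = λ / (λ + κ)`. -/
def q : ℝ := D.lam / (D.lam + D.kap)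

/-- The accuracies `ε_k = (2/9) (P(x^0) - P^*) (1 - ρ₀)^k`. -/
def ε (k : ℕ) : ℝ := 2 / 9 * (D.P D.x₀ - D.Pmin) * (1 - D.rho) ^ k

/-- The rate `min {(λ + κ) η / 2, δ / 4, δ₁ / 4, p / 4}` that defines the averaging weights. -/
def θ : ℝ := min (min ((D.lam + D.kap) * D.η / 2) (D.δ / 4)) (min (D.δ₁ / 4) (D.p / 4))

/-- The start of EC-LSVRG in an outer iteration, given the previous outer iterate `x` and the
prox-center `y`: `x^0 = w^0 = x`, `e_τ^0 = 0`,
`h_τ^0 = ∇f^(τ)(x) + ∇ψ(x) + κ (x - y)`. -/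
def initState (x y : Vec d) : State d n where
  x := x
  w := x
  e := fun _ => 0
  h := fun τ => gradient (nodeAvg D.f τ) x + gradient D.ψ x + D.kap • (x - y)

/-- The averaged iterates `x̄^K` of EC-LSVRG on the subproblem with prox-center `y`,
started from `x`. -/
def innerAvg (x y : Vec d) (ξ : ℕ → Noise n m S S₁) (K : ℕ) : Vec d :=
  weightedAvg D.θ
    (fun j => (run (D.subLoss y) D.η D.Q D.Q₁ (D.initState x y) ξ j).x) K

/-- The number `inf {K ≥ 1 : G(x̄^K) - G^* ≤ ε_k}` of inner iterations in the `k`-th outer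
iteration, which starts from `x` with prox-center `y`; it is `⊤` if there is no such `K`. -/
def innerTime (k : ℕ) (x y : Vec d) (ξ : ℕ → Noise n m S S₁) : ℕ∞ :=
  sInf {t : ℕ∞ | ∃ K : ℕ, t = (K : ℕ∞) ∧ 1 ≤ K ∧
    D.G y (D.innerAvg x y ξ K) - D.Gmin y ≤ D.ε k}

/-- The solution `α > 0` of `α² = (1 - α) a² + q α`. -/
def nextAlpha (a : ℝ) : ℝ :=
  ((D.q - a ^ 2) + Real.sqrt ((D.q - a ^ 2) ^ 2 + 4 * a ^ 2)) / 2

/-- The `k`-th outer iteration of Catalyst, from the `(k-1)`-st outer variables. Where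
`innerTime` is infinite (a null event in the theorem), `⊤.toNat = 0` gives `x^k = x^{k-1}`. -/
def outerStep (k : ℕ) (ξ : ℕ → Noise n m S S₁) (o : Outer d) : Outer d :=
  let x' := D.innerAvg o.x o.y ξ (D.innerTime k o.x o.y ξ).toNat
  let α' := D.nextAlpha o.α
  { x := x'
    y := x' + (o.α * (1 - o.α) / (o.α ^ 2 + α')) • (x' - o.x)
    α := α' }

/-- Catalyst: `x^0 = y^0 = x₀`, `α_0 = √q`; the noise `ξ k` drives the `k`-th outer iteration. -/
def catalyst (ξ : ℕ → ℕ → Noise n m S S₁) : ℕ → Outer d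
  | 0 => { x := D.x₀, y := D.x₀, α := Real.sqrt D.q }
  | k + 1 => D.outerStep (k + 1) (ξ (k + 1)) (catalyst ξ k)

/-- The number `T_k` of inner iterations in the `k`-th outer iteration (`k ≥ 1`). -/
def T (ξ : ℕ → ℕ → Noise n m S S₁) (k : ℕ) : ℕ∞ :=
  D.innerTime k (D.catalyst ξ (k - 1)).x (D.catalyst ξ (k - 1)).y (ξ k)

end Setup

end ECLSVRG

end

noncomputable section

namespace ECLSVRG

/-! ### Bregman divergences -/

section Bregman

variable {d : ℕ}

/-! An outer iteration costs about `log B / θ` inner steps, where `θ` is the contraction rate of the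
inner method and `B` is the ratio of the initial gap of the subproblem to the target `ε k`. The
proof bounds both: `1 / θ` is at most a constant times the complexity factor, and `B` is polynomial
in `1 / (√q - ρ₀)`.

Inner method. On a subproblem the average loss has curvature between `μ = λ + κ` and `M = Lf + Lψ +
κ`. The virtual iterate `x - avg e` takes an uncompressed variance-reduced gradient step
(`step_virtualDist`, `step_x_moments`), with gradients taken at `x`. The price is the size of `avg
e`. Since the compressors have scaled means and the nodes are independent, the second moment of an
averaged compression error splits into its squared mean and a variance of order `n⁻² ∑ ‖v_τ‖²`. Both
quantities are tracked for the errors `e` and for the shift errors `∇f^(τ)(w) - h_τ`. A node loss is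
one of `n` convex summands of the global loss, so it is `nM`-smooth. The factor `n⁻²` absorbs this,
and the bound involves neither `Lbar` nor the heterogeneity of the nodes. A Lyapunov function made
of the virtual distance, the two kinds of errors and the gap at the check point `w` satisfies `E V⁺
≤ (1 - θ) V - (η/2) (F(x) - F(z))`, where `z` minimizes `F` (`lintegral_lyapW_step_le`). At the
start the errors and shift errors vanish, so `V` is at most a multiple of the initial gap. Summation
and Jensen's inequality give `E[F(x̄^K) - F(z)] ≤ 5 (1 - θ)^(K+1) (F(x^0) - F(z))` after a burn-in
period (`lintegral_weightedAvg_gap_le`). Markov's inequality turns this into `P(T > K) ≤ 5 B (1 -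
θ)^K`, and summing the tail gives `E T ≤ (log (5B) + 2) / θ`.

Outer method. Starting from `√q`, the sequence `α` is constant, and Catalyst is an accelerated
proximal point method with the potential `P(x) - P* + (λ/2) ‖v - x*‖²`, where `v` is an extrapolated
point. A step with inexactness `ε` loses a factor `1 - √q`, up to a Young parameter `t`, and adds `ε
(1 + 1/t)` (`accelerated_step_le`). With `g = √q - ρ₀` and `t = g/2` the potential stays below `9
ε_k / g²`, so the next subproblem starts with gap at most `45 ε_(k+1) / g³` (`catalyst_gap_le`).
This bound is pathwise, given that all earlier subproblems reached their accuracies.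

The two parts are joined by independence: the outer state is determined by earlier noise, so the
inner bound applies with that state frozen. Finite expectations make the earlier stopping times
almost surely finite, which in turn supplies the accuracies that the outer argument needs. -/

lemma gradient_add_of_differentiable {f g : Vec d → ℝ} (hf : Differentiable ℝ f)
    (hg : Differentiable ℝ g) (x : Vec d) :
    gradient (fun x => f x + g x) x = gradient f x + gradient g x := by
  simp only [gradient]
  rw [fderiv_fun_add (hf x) (hg x), map_add]

lemma gradient_const_mul_sum {ι : Type*} [Fintype ι] {f : ι → Vec d → ℝ} (c : ℝ)
    (hf : ∀ i, Differentiable ℝ (f i)) (x : Vec d) :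
    gradient (fun x => c * ∑ i, f i x) x = c • ∑ i, gradient (f i) x := by
  simp only [gradient]
  rw [fderiv_const_mul (by fun_prop), fderiv_fun_sum (fun i _ => hf i x)]
  simp [map_sum]

lemma hasGradientAt_prox (c : ℝ) (y x : Vec d) :
    HasGradientAt (fun x : Vec d => c / 2 * ‖x - y‖ ^ 2) (c • (x - y)) x := by
  rw [hasGradientAt_iff_hasFDerivAt]
  have h := ((hasFDerivAt_id x).sub_const y).norm_sq.const_mul (c / 2)
  refine h.congr_fderiv ?_
  ext v
  simp
  ring

/-- The Bregman divergence `f y - f x - ⟨∇f x, y - x⟩`. -/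
def bregman (f : Vec d → ℝ) (y x : Vec d) : ℝ := f y - f x - inner ℝ (gradient f x) (y - x)

/-- `f` is differentiable and its Bregman divergence lies between `μ/2 ‖y - x‖²` and
`M/2 ‖y - x‖²`. -/
def QuadBounds (μ M : ℝ) (f : Vec d → ℝ) : Prop :=
  Differentiable ℝ f ∧
    ∀ y x, μ / 2 * ‖y - x‖ ^ 2 ≤ bregman f y x ∧ bregman f y x ≤ M / 2 * ‖y - x‖ ^ 2

lemma bregman_add {f g : Vec d → ℝ} (hf : Differentiable ℝ f) (hg : Differentiable ℝ g)
    (y x : Vec d) : bregman (fun x => f x + g x) y x = bregman f y x + bregman g y x := by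
  simp only [bregman, gradient_add_of_differentiable hf hg, inner_add_left]
  ring

lemma bregman_const_mul_sum {ι : Type*} [Fintype ι] {f : ι → Vec d → ℝ} (c : ℝ)
    (hf : ∀ i, Differentiable ℝ (f i)) (y x : Vec d) :
    bregman (fun x => c * ∑ i, f i x) y x = c * ∑ i, bregman (f i) y x := by
  simp only [bregman, gradient_const_mul_sum c hf, inner_smul_left, sum_inner,
    Finset.sum_sub_distrib]
  simp
  ring

lemma bregman_prox (c : ℝ) (p y x : Vec d) :
    bregman (fun x : Vec d => c / 2 * ‖x - p‖ ^ 2) y x = c / 2 * ‖y - x‖ ^ 2 := by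
  rw [bregman, (hasGradientAt_prox c p x).gradient, inner_smul_left]
  have h : y - p = (y - x) + (x - p) := by abel
  rw [h, norm_add_sq_real, real_inner_comm]
  simp
  ring

lemma hasDerivAt_line {f : Vec d → ℝ} (hf : Differentiable ℝ f) (x u : Vec d) (t : ℝ) :
    HasDerivAt (fun t : ℝ => f (x + t • u)) (inner ℝ (gradient f (x + t • u)) u) t := by
  have h1 : HasDerivAt (fun t : ℝ => x + t • u) u t := by
    simpa using ((hasDerivAt_id t).smul_const u).const_add x
  have h2 := (hf (x + t • u)).hasFDerivAt.comp_hasDerivAt t h1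
  rw [inner_gradient_left]
  exact h2

/-- Along the segment, `f` minus its linearization minus the quadratic has derivative `⟨∇f(x + t u)
- ∇f(x), u⟩ - L t ‖u‖²`, which the Lipschitz bound makes nonpositive. -/
lemma SmoothWith.bregman_le {L : ℝ} {f : Vec d → ℝ} (hf : SmoothWith L f) (y x : Vec d) :
    bregman f y x ≤ L / 2 * ‖y - x‖ ^ 2 := by
  obtain ⟨hL, hd, hlip⟩ := hf
  set u := y - x with hu
  let φ : ℝ → ℝ := fun t => f (x + t • u) - t * inner ℝ (gradient f x) u - L / 2 * t ^ 2 * ‖u‖ ^ 2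
  have hder : ∀ t, HasDerivAt φ (inner ℝ (gradient f (x + t • u)) u - inner ℝ (gradient f x) u
      - L * t * ‖u‖ ^ 2) t := by
    intro t
    have h1 := (hasDerivAt_line hd x u t).sub ((hasDerivAt_id t).mul_const
      (inner ℝ (gradient f x) u))
    have h2 := h1.sub ((((hasDerivAt_id t).pow 2).const_mul (L / 2)).mul_const (‖u‖ ^ 2))
    refine h2.congr_deriv ?_
    simp only [id, one_mul, Nat.cast_ofNat, mul_one]
    ring
  have hanti : AntitoneOn φ (Set.Icc 0 1) := by
    refine antitoneOn_of_deriv_nonpos (convex_Icc 0 1)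
      (fun t _ => (hder t).continuousAt.continuousWithinAt)
      (fun t _ => (hder t).differentiableAt.differentiableWithinAt) ?_
    intro t ht
    rw [interior_Icc] at ht
    rw [(hder t).deriv, ← inner_sub_left]
    have h1 := real_inner_le_norm (gradient f (x + t • u) - gradient f x) u
    have h2 := hlip (x + t • u) x
    rw [add_sub_cancel_left, norm_smul, Real.norm_of_nonneg ht.1.le] at h2
    nlinarith [mul_le_mul_of_nonneg_right h2 (norm_nonneg u)]
  have h := hanti (Set.left_mem_Icc.2 zero_le_one) (Set.right_mem_Icc.2 zero_le_one) zero_le_one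
  simp only [φ, hu] at h
  simp only [bregman]
  simp only [one_smul, zero_smul, add_zero, add_sub_cancel, one_mul, zero_mul, one_pow, mul_one,
    mul_zero, sub_zero, ne_eq, OfNat.ofNat_ne_zero, not_false_eq_true, zero_pow] at h
  linarith

/-- On the line from `x` to `y`, the slope of a convex function over `[0, 1]` dominates its
derivative at `0`. -/
lemma bregman_nonneg_of_convexOn {f : Vec d → ℝ} (hd : Differentiable ℝ f)
    (hf : ConvexOn ℝ Set.univ f) (y x : Vec d) : 0 ≤ bregman f y x := by
  have h1 : ConvexOn ℝ Set.univ (fun t : ℝ => f (x + t • (y - x))) := by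
    refine ⟨convex_univ, fun s _ t _ a b ha hb hab => ?_⟩
    have := hf.2 (Set.mem_univ (x + s • (y - x))) (Set.mem_univ (x + t • (y - x))) ha hb hab
    refine le_trans (le_of_eq ?_) this
    have e : a • (x + s • (y - x)) + b • (x + t • (y - x))
        = (a + b) • x + (a • s + b • t) • (y - x) := by
      simp only [smul_eq_mul]
      module
    rw [e, hab, one_smul]
  have h2 := h1.le_slope_of_hasDerivAt (Set.mem_univ 0) (Set.mem_univ 1) one_pos
    (hasDerivAt_line hd x (y - x) 0)
  simp only [slope, one_smul, zero_smul, add_zero, add_sub_cancel, sub_zero, inv_one,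
    vsub_eq_sub] at h2
  simp only [bregman]
  linarith

lemma StrongConvexOn.le_bregman {lam : ℝ} {f : Vec d → ℝ} (hd : Differentiable ℝ f)
    (hf : StrongConvexOn Set.univ lam f) (y x : Vec d) :
    lam / 2 * ‖y - x‖ ^ 2 ≤ bregman f y x := by
  rw [strongConvexOn_iff_convex] at hf
  have hq : Differentiable ℝ (fun x : Vec d => (-lam) / 2 * ‖x - 0‖ ^ 2) :=
    fun x => (hasGradientAt_prox (-lam) 0 x).differentiableAt
  have h1 : (fun x : Vec d => f x - lam / (2 : ℝ) * ‖x‖ ^ 2)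
      = fun x => f x + (-lam) / 2 * ‖x - 0‖ ^ 2 := by
    ext x; simp; ring
  rw [h1] at hf
  have h2 := bregman_nonneg_of_convexOn (hd.fun_add hq) hf y x
  rw [bregman_add hd hq, bregman_prox] at h2
  linarith

lemma QuadBounds.add {μ M μ' M' : ℝ} {f g : Vec d → ℝ} (hf : QuadBounds μ M f)
    (hg : QuadBounds μ' M' g) : QuadBounds (μ + μ') (M + M') (fun x => f x + g x) := by
  refine ⟨hf.1.add hg.1, fun y x => ?_⟩
  rw [bregman_add hf.1 hg.1]
  constructor <;> linarith [(hf.2 y x).1, (hf.2 y x).2, (hg.2 y x).1, (hg.2 y x).2]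

lemma quadBounds_prox (c : ℝ) (p : Vec d) :
    QuadBounds c c (fun x : Vec d => c / 2 * ‖x - p‖ ^ 2) :=
  ⟨fun x => (hasGradientAt_prox c p x).differentiableAt, fun y x => by simp [bregman_prox]⟩

lemma gradient_eq_zero_of_isMin {f : Vec d → ℝ} {x : Vec d} (hmin : ∀ y, f x ≤ f y) :
    gradient f x = 0 := by
  have h : IsLocalMin f x := Filter.Eventually.of_forall hmin
  simp [gradient, h.fderiv_eq_zero]

/-- Cocoercivity of the gradient of a convex function with quadratic upper bounds. -/
lemma QuadBounds.norm_gradient_sub_sq_le {M : ℝ} (hM : 0 < M) {f : Vec d → ℝ}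
    (hf : QuadBounds 0 M f) (x y : Vec d) :
    ‖gradient f x - gradient f y‖ ^ 2 ≤ 2 * M * bregman f x y := by
  set v := gradient f x - gradient f y with hv
  -- One gradient step for the tilted function `f - ⟨∇f(y), ·⟩`: the upper bound around `x` and the
  -- lower bound around `y` are compared at this common point.
  set z := x - M⁻¹ • v with hz
  have h1 := (hf.2 z y).1
  have h2 := (hf.2 z x).2
  have e1 : z - y = (x - y) - M⁻¹ • v := by rw [hz]; abel
  have e2 : z - x = - (M⁻¹ • v) := by rw [hz]; abel
  simp only [bregman] at h1 h2 ⊢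
  rw [e1, inner_sub_right, inner_smul_right] at h1
  rw [e2, norm_neg, norm_smul, inner_neg_right, inner_smul_right, Real.norm_of_nonneg
    (inv_nonneg.2 hM.le)] at h2
  have h3 : inner ℝ (gradient f x) v - inner ℝ (gradient f y) v = ‖v‖ ^ 2 := by
    rw [← inner_sub_left, ← hv, real_inner_self_eq_norm_sq]
  have h4 : M⁻¹ * inner ℝ (gradient f x) v - M⁻¹ * inner ℝ (gradient f y) v = M⁻¹ * ‖v‖ ^ 2 := by
    rw [← mul_sub, h3]
  have h5 : M / 2 * (M⁻¹ * ‖v‖) ^ 2 = M⁻¹ * ‖v‖ ^ 2 / 2 := by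
    field_simp
  rw [h5] at h2
  have h6 : M⁻¹ * ‖v‖ ^ 2 / 2 ≤ f x - f y - inner ℝ (gradient f y) (x - y) := by linarith
  have h7 : ‖v‖ ^ 2 = 2 * M * (M⁻¹ * ‖v‖ ^ 2 / 2) := by field_simp
  rw [h7]
  exact mul_le_mul_of_nonneg_left h6 (by positivity)

lemma QuadBounds.norm_gradient_sub_sq_le_add {M : ℝ} (hM : 0 < M) {f : Vec d → ℝ}
    (hf : QuadBounds 0 M f) (x w z : Vec d) :
    ‖gradient f x - gradient f w‖ ^ 2 ≤ 4 * M * (bregman f x z + bregman f w z) := by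
  have h1 := hf.norm_gradient_sub_sq_le hM x z
  have h2 := hf.norm_gradient_sub_sq_le hM w z
  have h3 : gradient f x - gradient f w
      = (gradient f x - gradient f z) - (gradient f w - gradient f z) := by abel
  have h4 := norm_sub_le (gradient f x - gradient f z) (gradient f w - gradient f z)
  rw [← h3] at h4
  nlinarith [norm_nonneg (gradient f x - gradient f w),
    sq_nonneg (‖gradient f x - gradient f z‖ - ‖gradient f w - gradient f z‖)]

lemma QuadBounds.mono_left {μ μ' M : ℝ} {f : Vec d → ℝ} (hf : QuadBounds μ M f) (h : μ' ≤ μ) :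
    QuadBounds μ' M f :=
  ⟨hf.1, fun y x => ⟨(mul_le_mul_of_nonneg_right (by linarith) (sq_nonneg _)).trans (hf.2 y x).1,
    (hf.2 y x).2⟩⟩

/-- A function with a positive quadratic lower bound has a minimizer. -/
lemma QuadBounds.exists_isMin {μ M : ℝ} (hμ : 0 < μ) {f : Vec d → ℝ} (hf : QuadBounds μ M f) :
    ∃ x, ∀ y, f x ≤ f y := by
  refine hf.1.continuous.exists_forall_le ?_
  have h1 : Filter.Tendsto (fun y : Vec d => f 0 + (μ / 2 * ‖y‖ - ‖gradient f 0‖) * ‖y‖)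
      (Filter.cocompact _) Filter.atTop := by
    refine Filter.tendsto_atTop_add_const_left _ _ (Filter.Tendsto.atTop_mul_atTop₀ ?_ ?_)
    · exact Filter.tendsto_atTop_add_const_right _ _
        ((tendsto_norm_cocompact_atTop (E := Vec d)).const_mul_atTop (by positivity))
    · exact tendsto_norm_cocompact_atTop (E := Vec d)
  refine Filter.tendsto_atTop_mono (fun y => ?_) h1
  have h2 := (hf.2 y 0).1
  have h3 := neg_le_of_abs_le (abs_real_inner_le_norm (gradient f 0) y)
  simp only [bregman, sub_zero] at h2
  nlinarith

lemma QuadBounds.le_of_isMin {μ M : ℝ} {f : Vec d → ℝ} (hf : QuadBounds μ M f) {x : Vec d}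
    (hmin : ∀ y, f x ≤ f y) (y : Vec d) : f x + μ / 2 * ‖y - x‖ ^ 2 ≤ f y := by
  have h := (hf.2 y x).1
  simp only [bregman, gradient_eq_zero_of_isMin hmin, inner_zero_left] at h
  linarith

lemma iInf_eq_of_isMin {f : Vec d → ℝ} {x : Vec d} (hmin : ∀ y, f x ≤ f y) : ⨅ y, f y = f x :=
  le_antisymm (ciInf_le ⟨f x, by rintro _ ⟨y, rfl⟩; exact hmin y⟩ x) (le_ciInf hmin)

end Bregman

/-! ### Second moments of sums of independent vectors -/

section Moments

variable {d : ℕ}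

lemma norm_sq_eq_sum_coord (v : Vec d) : ‖v‖ ^ 2 = ∑ j, (v j) ^ 2 := by
  simp [EuclideanSpace.norm_sq_eq]

lemma memLp_coord {A : Type*} [MeasurableSpace A] {ρ : Measure A} {X : A → Vec d}
    (hX : MemLp X 2 ρ) (j : Fin d) : MemLp (fun a => X a j) 2 ρ :=
  hX.continuousLinearMap_comp (EuclideanSpace.proj j : Vec d →L[ℝ] ℝ)

lemma integral_coord {A : Type*} [MeasurableSpace A] {ρ : Measure A} {X : A → Vec d}
    (hX : Integrable X ρ) (j : Fin d) : (∫ a, X a ∂ρ) j = ∫ a, X a j ∂ρ :=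
  ((EuclideanSpace.proj j : Vec d →L[ℝ] ℝ).integral_comp_comm hX).symm

lemma integrable_norm_sq {A : Type*} [MeasurableSpace A] {ρ : Measure A} {X : A → Vec d}
    (hX : MemLp X 2 ρ) : Integrable (fun a => ‖X a‖ ^ 2) ρ :=
  hX.integrable_norm_pow (by norm_num)

lemma memLp_two_of_integrable_norm_sq {A : Type*} [MeasurableSpace A] {ρ : Measure A}
    {X : A → Vec d} (hm : AEStronglyMeasurable X ρ) (hX : Integrable (fun a => ‖X a‖ ^ 2) ρ) :
    MemLp X 2 ρ :=
  (memLp_two_iff_integrable_sq_norm hm).2 hX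

lemma memLp_pi_eval {n : ℕ} {A : Type*} [MeasurableSpace A] {ρ : Measure A}
    [IsProbabilityMeasure ρ] {X : A → Vec d} (hX : MemLp X 2 ρ) (τ : Fin n) :
    MemLp (fun ω : Fin n → A => X (ω τ)) 2 (Measure.pi fun _ => ρ) :=
  hX.comp_measurePreserving (measurePreserving_eval (fun _ : Fin n => ρ) τ)

/-- The second moment of a sum of independent random vectors. -/
lemma integral_norm_sum_sq_pi {n : ℕ} {A : Type*} [MeasurableSpace A] (ρ : Measure A)
    [IsProbabilityMeasure ρ] {X : Fin n → A → Vec d} (hX : ∀ τ, MemLp (X τ) 2 ρ) :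
    ∫ ω, ‖∑ τ, X τ (ω τ)‖ ^ 2 ∂(Measure.pi fun _ : Fin n => ρ)
      = ‖∑ τ, ∫ a, X τ a ∂ρ‖ ^ 2
        + ∑ τ, (∫ a, ‖X τ a‖ ^ 2 ∂ρ - ‖∫ a, X τ a ∂ρ‖ ^ 2) := by
  have hint : ∀ τ, Integrable (X τ) ρ := fun τ => (hX τ).integrable (by norm_num)
  have hsq : ∀ τ, ∫ a, ‖X τ a‖ ^ 2 ∂ρ = ∑ j, ∫ a, (X τ a j) ^ 2 ∂ρ := by
    intro τ
    simp_rw [norm_sq_eq_sum_coord]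
    exact integral_finsetSum _ fun j _ => (memLp_coord (hX τ) j).integrable_sq
  have hm : ∀ j, MemLp (fun ω : Fin n → A => ∑ τ, X τ (ω τ) j) 2 (Measure.pi fun _ => ρ) :=
    fun j => memLp_finsetSum _ fun τ _ => memLp_coord (memLp_pi_eval (hX τ) τ) j
  have hcoord : ∀ j, ∫ ω, (∑ τ, X τ (ω τ) j) ^ 2 ∂(Measure.pi fun _ : Fin n => ρ)
      = (∑ τ, ∫ a, X τ a j ∂ρ) ^ 2
        + ∑ τ, (∫ a, (X τ a j) ^ 2 ∂ρ - (∫ a, X τ a j ∂ρ) ^ 2) := by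
    intro j
    -- Additivity of the variance is a scalar statement, so it is applied coordinate by coordinate.
    have h1 := variance_sum_pi (μ := fun _ : Fin n => ρ) (X := fun τ a => X τ a j)
      fun τ => memLp_coord (hX τ) j
    have h2 : (∑ τ, fun ω : Fin n → A => X τ (ω τ) j) = fun ω => ∑ τ, X τ (ω τ) j := by
      ext ω; simp
    rw [h2, variance_eq_sub (hm j)] at h1
    have h3 : ∀ τ, Var[fun a => X τ a j; ρ]
        = ∫ a, (X τ a j) ^ 2 ∂ρ - (∫ a, X τ a j ∂ρ) ^ 2 := fun τ => by
      rw [variance_eq_sub (memLp_coord (hX τ) j)]; rfl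
    have h4 : ∫ ω, ∑ τ, X τ (ω τ) j ∂(Measure.pi fun _ : Fin n => ρ)
        = ∑ τ, ∫ a, X τ a j ∂ρ := by
      rw [integral_finsetSum _ fun τ _ =>
        (memLp_coord (memLp_pi_eval (hX τ) τ) j).integrable (by norm_num)]
      exact Finset.sum_congr rfl fun τ _ => integral_comp_eval (μ := fun _ : Fin n => ρ)
        (f := fun a => X τ a j) (memLp_coord (hX τ) j).aestronglyMeasurable
    simp only [h3, h4] at h1
    simp only [Pi.pow_apply] at h1
    linarith
  have hL : ∀ ω : Fin n → A, ‖∑ τ, X τ (ω τ)‖ ^ 2 = ∑ j, (∑ τ, X τ (ω τ) j) ^ 2 := by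
    intro ω
    rw [norm_sq_eq_sum_coord]
    simp
  simp_rw [hL]
  rw [integral_finsetSum _ fun j _ => (hm j).integrable_sq]
  simp_rw [hcoord, hsq, norm_sq_eq_sum_coord]
  rw [Finset.sum_add_distrib]
  congr 1
  · simp [integral_coord (hint _)]
  · rw [Finset.sum_comm]
    refine Finset.sum_congr rfl fun τ _ => ?_
    rw [Finset.sum_sub_distrib]
    simp [integral_coord (hint τ)]

lemma isProbabilityMeasure_uniformOn_univ {m : ℕ} (hm : 0 < m) :
    IsProbabilityMeasure (uniformOn (Set.univ : Set (Fin m))) :=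
  isProbabilityMeasure_uniformOn Set.finite_univ ⟨⟨0, hm⟩, trivial⟩

lemma integral_uniformOn_univ {m : ℕ} (hm : 0 < m) {E : Type*} [NormedAddCommGroup E]
    [NormedSpace ℝ E] [CompleteSpace E] (g : Fin m → E) :
    ∫ i, g i ∂(uniformOn (Set.univ : Set (Fin m))) = (1 / (m : ℝ)) • ∑ i, g i := by
  have := isProbabilityMeasure_uniformOn_univ hm
  rw [integral_fintype Integrable.of_finite, Finset.smul_sum]
  refine Finset.sum_congr rfl fun i _ => ?_
  congr 1
  rw [measureReal_def, uniformOn_univ]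
  simp

/-- The law of the randomness on one node. -/
abbrev nodeLaw (m : ℕ) {S S₁ : Type*} [MeasurableSpace S] [MeasurableSpace S₁]
    (ν : Measure S) (ν₁ : Measure S₁) : Measure (Fin m × S × S₁) :=
  (uniformOn (Set.univ : Set (Fin m))).prod (ν.prod ν₁)

variable {m : ℕ} {S S₁ : Type*} [MeasurableSpace S] [MeasurableSpace S₁]
  (ν : Measure S) [IsProbabilityMeasure ν] (ν₁ : Measure S₁) [IsProbabilityMeasure ν₁]

lemma integral_prod_uniformOn (hm : 0 < m) {E : Type*} [NormedAddCommGroup E]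
    [NormedSpace ℝ E] [CompleteSpace E] {φ : Fin m × S → E}
    (hφ : AEStronglyMeasurable φ ((uniformOn (Set.univ : Set (Fin m))).prod ν))
    (hi : ∀ i, Integrable (fun s => φ (i, s)) ν) :
    Integrable φ ((uniformOn (Set.univ : Set (Fin m))).prod ν) ∧
      ∫ a, φ a ∂((uniformOn (Set.univ : Set (Fin m))).prod ν)
        = (1 / (m : ℝ)) • ∑ i, ∫ s, φ (i, s) ∂ν := by
  have := isProbabilityMeasure_uniformOn_univ hm
  have h1 : Integrable φ ((uniformOn (Set.univ : Set (Fin m))).prod ν) :=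
    (integrable_prod_iff hφ).2 ⟨Filter.Eventually.of_forall hi, Integrable.of_finite⟩
  exact ⟨h1, by rw [integral_prod _ h1, integral_uniformOn_univ hm]⟩

lemma measurePreserving_nodeLaw_fst (hm : 0 < m) :
    MeasurePreserving (fun a : Fin m × S × S₁ => (a.1, a.2.1)) (nodeLaw m ν ν₁)
      ((uniformOn (Set.univ : Set (Fin m))).prod ν) := by
  have := isProbabilityMeasure_uniformOn_univ hm
  exact (MeasurePreserving.id _).prod measurePreserving_fst

lemma measurePreserving_nodeLaw_snd (hm : 0 < m) :
    MeasurePreserving (fun a : Fin m × S × S₁ => a.2.2) (nodeLaw m ν ν₁) ν₁ := by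
  have := isProbabilityMeasure_uniformOn_univ hm
  exact measurePreserving_snd.comp measurePreserving_snd

lemma integral_comp_of_measurePreserving {A B E : Type*} [MeasurableSpace A] [MeasurableSpace B]
    [NormedAddCommGroup E] [NormedSpace ℝ E] {α : Measure A} {β : Measure B} {f : A → B}
    (hf : MeasurePreserving f α β) {g : B → E} (hg : AEStronglyMeasurable g β) :
    ∫ a, g (f a) ∂α = ∫ b, g b ∂β := by
  rw [← hf.map_eq] at hg ⊢
  exact (integral_map hf.measurable.aemeasurable hg).symm

/-- The moments of the compression error of a vector that depends on a uniform index. -/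
lemma node_moments_compress (hm : 0 < m) {Q : S → Vec d → Vec d} {δ : ℝ}
    (hQ : IsContractionCompressor ν Q δ) (hs : MeanScaled ν Q δ) (v : Fin m → Vec d) :
    MemLp (fun a : Fin m × S × S₁ => v a.1 - Q a.2.1 (v a.1)) 2 (nodeLaw m ν ν₁) ∧
    ∫ a : Fin m × S × S₁, (v a.1 - Q a.2.1 (v a.1)) ∂(nodeLaw m ν ν₁)
      = (1 - δ) • ((1 / (m : ℝ)) • ∑ i, v i) ∧
    ∫ a : Fin m × S × S₁, ‖v a.1 - Q a.2.1 (v a.1)‖ ^ 2 ∂(nodeLaw m ν ν₁)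
      ≤ (1 - δ) * ((1 / (m : ℝ)) * ∑ i, ‖v i‖ ^ 2) := by
  have := isProbabilityMeasure_uniformOn_univ hm
  have hmeas : Measurable (fun b : Fin m × S => v b.1 - Q b.2 (v b.1)) := by
    have hv : Measurable (fun b : Fin m × S => v b.1) :=
      (measurable_of_countable v).comp measurable_fst
    exact hv.sub (hQ.measurable.comp (measurable_snd.prodMk hv))
  have hmp := measurePreserving_nodeLaw_fst (m := m) ν ν₁ hm
  have hsq := integral_prod_uniformOn (m := m) ν hm
    (φ := fun b => ‖v b.1 - Q b.2 (v b.1)‖ ^ 2)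
    (hmeas.norm.pow_const 2).aestronglyMeasurable (fun i => hQ.integrable (v i))
  have hvec := integral_prod_uniformOn (m := m) ν hm (φ := fun b => v b.1 - Q b.2 (v b.1))
    hmeas.aestronglyMeasurable
    (fun i => Integrable.sub (f := fun _ => v i) (integrable_const _) (hs (v i)).1)
  refine ⟨?_, ?_, ?_⟩
  · exact (memLp_two_of_integrable_norm_sq hmeas.aestronglyMeasurable
      hsq.1).comp_measurePreserving hmp
  · rw [integral_comp_of_measurePreserving hmp (g := fun b => v b.1 - Q b.2 (v b.1))
      hmeas.aestronglyMeasurable, hvec.2, smul_comm, Finset.smul_sum (r := 1 - δ)]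
    congr 1
    refine Finset.sum_congr rfl fun i _ => ?_
    dsimp only
    rw [integral_sub (integrable_const _) (hs (v i)).1, (hs (v i)).2]
    simp [sub_smul]
  · rw [integral_comp_of_measurePreserving hmp (g := fun b => ‖v b.1 - Q b.2 (v b.1)‖ ^ 2)
      (hmeas.norm.pow_const 2).aestronglyMeasurable, hsq.2, smul_eq_mul, mul_left_comm,
      Finset.mul_sum (a := 1 - δ)]
    exact mul_le_mul_of_nonneg_left (Finset.sum_le_sum fun i _ => hQ.contraction (v i))
      (by positivity)

/-- The moments of the compression error of a fixed vector. -/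
lemma node_moments_shift (hm : 0 < m) {Q₁ : S₁ → Vec d → Vec d} {δ₁ : ℝ}
    (hQ : IsContractionCompressor ν₁ Q₁ δ₁) (hs : MeanScaled ν₁ Q₁ δ₁) (u : Vec d) :
    MemLp (fun a : Fin m × S × S₁ => u - Q₁ a.2.2 u) 2 (nodeLaw m ν ν₁) ∧
    ∫ a : Fin m × S × S₁, (u - Q₁ a.2.2 u) ∂(nodeLaw m ν ν₁) = (1 - δ₁) • u ∧
    ∫ a : Fin m × S × S₁, ‖u - Q₁ a.2.2 u‖ ^ 2 ∂(nodeLaw m ν ν₁) ≤ (1 - δ₁) * ‖u‖ ^ 2 := by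
  have hmeas : Measurable (fun b : S₁ => u - Q₁ b u) :=
    measurable_const.sub (hQ.measurable.comp (measurable_id.prodMk measurable_const))
  have hmp := measurePreserving_nodeLaw_snd (m := m) ν ν₁ hm
  refine ⟨?_, ?_, ?_⟩
  · exact (memLp_two_of_integrable_norm_sq hmeas.aestronglyMeasurable
      (hQ.integrable u)).comp_measurePreserving hmp
  · rw [integral_comp_of_measurePreserving hmp (g := fun b => u - Q₁ b u)
      hmeas.aestronglyMeasurable, integral_sub (integrable_const _) (hs u).1, (hs u).2]
    simp [sub_smul]
  · rw [integral_comp_of_measurePreserving hmp (g := fun b => ‖u - Q₁ b u‖ ^ 2)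
      (hmeas.norm.pow_const 2).aestronglyMeasurable]
    exact hQ.contraction u

/-- The moments of a vector that depends on a uniform index. -/
lemma node_moments_index (hm : 0 < m) (v : Fin m → Vec d) :
    MemLp (fun a : Fin m × S × S₁ => v a.1) 2 (nodeLaw m ν ν₁) ∧
    ∫ a : Fin m × S × S₁, v a.1 ∂(nodeLaw m ν ν₁) = (1 / (m : ℝ)) • ∑ i, v i ∧
    ∫ a : Fin m × S × S₁, ‖v a.1‖ ^ 2 ∂(nodeLaw m ν ν₁) = (1 / (m : ℝ)) * ∑ i, ‖v i‖ ^ 2 := by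
  have := isProbabilityMeasure_uniformOn_univ hm
  have hmp : MeasurePreserving (fun a : Fin m × S × S₁ => a.1) (nodeLaw m ν ν₁)
    (uniformOn (Set.univ : Set (Fin m))) := measurePreserving_fst
  refine ⟨?_, ?_, ?_⟩
  · exact (MemLp.of_discrete (f := v)).comp_measurePreserving hmp
  · rw [integral_comp_of_measurePreserving hmp (g := v)
      (measurable_of_countable v).aestronglyMeasurable, integral_uniformOn_univ hm]
  · rw [integral_comp_of_measurePreserving hmp (g := fun i => ‖v i‖ ^ 2)
      (measurable_of_countable _).aestronglyMeasurable, integral_uniformOn_univ hm, smul_eq_mul]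

/-- The second moment of a finite average is the square of its mean plus its variance. -/
lemma avg_norm_sq (hm : 0 < m) (v : Fin m → Vec d) (b : Vec d)
    (hb : (1 / (m : ℝ)) • ∑ i, v i = b) (c : Vec d) :
    (1 / (m : ℝ)) * ∑ i, ‖v i - c‖ ^ 2
      = ‖b - c‖ ^ 2 + (1 / (m : ℝ)) * ∑ i, ‖v i - b‖ ^ 2 := by
  have hm' : (m : ℝ) ≠ 0 := by positivity
  have hsum : ∑ i, (v i - b) = 0 := by
    rw [Finset.sum_sub_distrib, ← hb]
    simp [smul_smul, hm', ← Nat.cast_smul_eq_nsmul ℝ]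
  have h1 : ∀ i, ‖v i - c‖ ^ 2
      = ‖v i - b‖ ^ 2 + (2 * inner ℝ (v i - b) (b - c) + ‖b - c‖ ^ 2) := by
    intro i
    rw [← sub_add_sub_cancel (v i) b c, norm_add_sq_real]
    ring
  simp_rw [h1]
  rw [Finset.sum_add_distrib, Finset.sum_add_distrib, ← Finset.mul_sum, ← sum_inner, hsum]
  simp
  field_simp
  ring

end Moments

/-! ### Averages over the nodes -/

section Averages

variable {d n : ℕ}

/-- The average of node vectors. -/
def avg (v : Fin n → Vec d) : Vec d := (1 / (n : ℝ)) • ∑ τ, v τ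

/-- `(1/n²) ∑_τ ‖v_τ‖²`, the second moment of the average of independent centred vectors. -/
def avgSq (v : Fin n → Vec d) : ℝ := (1 / (n : ℝ)) ^ 2 * ∑ τ, ‖v τ‖ ^ 2

lemma avg_add (u v : Fin n → Vec d) : avg (fun τ => u τ + v τ) = avg u + avg v := by
  simp [avg, Finset.sum_add_distrib]

lemma avg_sub (u v : Fin n → Vec d) : avg (fun τ => u τ - v τ) = avg u - avg v := by
  simp [avg, Finset.sum_sub_distrib, smul_sub]

lemma avg_smul (c : ℝ) (v : Fin n → Vec d) : avg (fun τ => c • v τ) = c • avg v := by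
  simp only [avg, ← Finset.smul_sum]
  rw [smul_comm]

lemma avg_const (hn : 0 < n) (v : Vec d) : avg (fun _ : Fin n => v) = v := by
  have : (n : ℝ) ≠ 0 := by positivity
  simp [avg, ← Nat.cast_smul_eq_nsmul ℝ, smul_smul, this]

lemma avgSq_nonneg (v : Fin n → Vec d) : 0 ≤ avgSq v := by
  unfold avgSq; positivity

lemma norm_add_sq_le_young {E : Type*} [NormedAddCommGroup E] [InnerProductSpace ℝ E] {c : ℝ}
    (hc : 0 < c) (u v : E) : ‖u + v‖ ^ 2 ≤ (1 + c) * ‖u‖ ^ 2 + (1 + 1 / c) * ‖v‖ ^ 2 := by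
  have h1 := norm_add_le u v
  have h2 : ‖u + v‖ ^ 2 ≤ (‖u‖ + ‖v‖) ^ 2 := by gcongr
  have h3 : 2 * (‖u‖ * ‖v‖) ≤ c * ‖u‖ ^ 2 + 1 / c * ‖v‖ ^ 2 := by
    have h4 : c * ‖u‖ ^ 2 + 1 / c * ‖v‖ ^ 2 - 2 * (‖u‖ * ‖v‖) = (c * ‖u‖ - ‖v‖) ^ 2 / c := by
      field_simp
      ring
    have h5 : 0 ≤ (c * ‖u‖ - ‖v‖) ^ 2 / c := by positivity
    linarith
  nlinarith

lemma avgSq_add_le_young {c : ℝ} (hc : 0 < c) (u v : Fin n → Vec d) :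
    avgSq (fun τ => u τ + v τ) ≤ (1 + c) * avgSq u + (1 + 1 / c) * avgSq v := by
  have h : avgSq (fun τ => u τ + v τ) ≤ (1 / (n : ℝ)) ^ 2 *
      ∑ τ, ((1 + c) * ‖u τ‖ ^ 2 + (1 + 1 / c) * ‖v τ‖ ^ 2) :=
    mul_le_mul_of_nonneg_left (Finset.sum_le_sum fun τ _ => norm_add_sq_le_young hc _ _)
      (by positivity)
  refine h.trans (le_of_eq ?_)
  rw [Finset.sum_add_distrib, ← Finset.mul_sum, ← Finset.mul_sum]
  simp only [avgSq]
  ring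

lemma avgSq_smul (c : ℝ) (v : Fin n → Vec d) : avgSq (fun τ => c • v τ) = c ^ 2 * avgSq v := by
  simp only [avgSq, norm_smul, mul_pow, ← Finset.mul_sum]
  simp
  ring

variable {A : Type*} [MeasurableSpace A] (ρ : Measure A) [IsProbabilityMeasure ρ]

lemma integral_norm_avg_sq {X : Fin n → A → Vec d} (hX : ∀ τ, MemLp (X τ) 2 ρ) :
    Integrable (fun ω : Fin n → A => ‖avg fun τ => X τ (ω τ)‖ ^ 2) (Measure.pi fun _ => ρ) ∧
    ∫ ω, ‖avg fun τ => X τ (ω τ)‖ ^ 2 ∂(Measure.pi fun _ : Fin n => ρ)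
      = ‖avg fun τ => ∫ a, X τ a ∂ρ‖ ^ 2
        + (1 / (n : ℝ)) ^ 2 * ∑ τ, (∫ a, ‖X τ a‖ ^ 2 ∂ρ - ‖∫ a, X τ a ∂ρ‖ ^ 2) := by
  have h1 : ∀ ω : Fin n → A, ‖avg fun τ => X τ (ω τ)‖ ^ 2
      = (1 / (n : ℝ)) ^ 2 * ‖∑ τ, X τ (ω τ)‖ ^ 2 := by
    intro ω
    rw [avg, norm_smul, mul_pow, Real.norm_of_nonneg (by positivity)]
  simp_rw [h1]
  refine ⟨(integrable_norm_sq (memLp_finsetSum _ fun τ _ =>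
    memLp_pi_eval (hX τ) τ)).const_mul _, ?_⟩
  rw [integral_const_mul, integral_norm_sum_sq_pi ρ hX, avg, norm_smul, mul_pow,
    Real.norm_of_nonneg (by positivity)]
  ring

lemma integral_avgSq {X : Fin n → A → Vec d} (hX : ∀ τ, MemLp (X τ) 2 ρ) :
    Integrable (fun ω : Fin n → A => avgSq fun τ => X τ (ω τ)) (Measure.pi fun _ => ρ) ∧
    ∫ ω, avgSq (fun τ => X τ (ω τ)) ∂(Measure.pi fun _ : Fin n => ρ)
      = (1 / (n : ℝ)) ^ 2 * ∑ τ, ∫ a, ‖X τ a‖ ^ 2 ∂ρ := by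
  have hi : ∀ τ, Integrable (fun ω : Fin n → A => ‖X τ (ω τ)‖ ^ 2) (Measure.pi fun _ => ρ) :=
    fun τ => integrable_norm_sq (memLp_pi_eval (hX τ) τ)
  refine ⟨(integrable_finsetSum _ fun τ _ => hi τ).const_mul _, ?_⟩
  simp only [avgSq]
  rw [integral_const_mul, integral_finsetSum _ fun τ _ => hi τ]
  congr 1
  exact Finset.sum_congr rfl fun τ _ => integral_comp_eval (μ := fun _ : Fin n => ρ)
    (f := fun a => ‖X τ a‖ ^ 2) (integrable_norm_sq (hX τ)).aestronglyMeasurable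

/-- Second moments of the average of independent vectors with means `c u_τ` and second moments at
most `c (‖u_τ‖² + z_τ)`. -/
lemma avg_contracted_moments {X : Fin n → A → Vec d} (hX : ∀ τ, MemLp (X τ) 2 ρ) {c : ℝ}
    (u : Fin n → Vec d) (z : Fin n → ℝ)
    (h1 : ∀ τ, ∫ a, X τ a ∂ρ = c • u τ) (h2 : ∀ τ, ∫ a, ‖X τ a‖ ^ 2 ∂ρ ≤ c * (‖u τ‖ ^ 2 + z τ)) :
    ∫ ω, ‖avg fun τ => X τ (ω τ)‖ ^ 2 ∂(Measure.pi fun _ : Fin n => ρ)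
      ≤ c ^ 2 * ‖avg u‖ ^ 2 + c * (1 - c) * avgSq u + c * ((1 / (n : ℝ)) ^ 2 * ∑ τ, z τ) ∧
    ∫ ω, avgSq (fun τ => X τ (ω τ)) ∂(Measure.pi fun _ : Fin n => ρ)
      ≤ c * (avgSq u + (1 / (n : ℝ)) ^ 2 * ∑ τ, z τ) := by
  rw [(integral_norm_avg_sq ρ hX).2, (integral_avgSq ρ hX).2]
  simp_rw [h1]
  constructor
  -- The variance of one node is at most `c (‖u‖² + z) - c² ‖u‖²`; subtracting the squared mean is
  -- what leaves the small factor `c (1 - c)`.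
  · have h3 : ∑ τ, (∫ a, ‖X τ a‖ ^ 2 ∂ρ - ‖c • u τ‖ ^ 2)
        ≤ ∑ τ, (c * (1 - c) * ‖u τ‖ ^ 2 + c * z τ) := by
      refine Finset.sum_le_sum fun τ _ => ?_
      rw [norm_smul, mul_pow, Real.norm_eq_abs, sq_abs]
      linarith [h2 τ]
    have h4 := mul_le_mul_of_nonneg_left h3 (sq_nonneg (1 / (n : ℝ)))
    rw [Finset.sum_add_distrib, ← Finset.mul_sum, ← Finset.mul_sum] at h4
    rw [avg_smul, norm_smul, mul_pow, Real.norm_eq_abs, sq_abs]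
    simp only [avgSq]
    linarith
  · have h3 := mul_le_mul_of_nonneg_left (Finset.sum_le_sum fun τ (_ : τ ∈ Finset.univ) => h2 τ)
      (sq_nonneg (1 / (n : ℝ)))
    rw [← Finset.mul_sum, Finset.sum_add_distrib] at h3
    simp only [avgSq]
    linarith

end Averages

/-! ### Finite sums with quadratic bounds -/

section FiniteSum

variable {d n m : ℕ}

/-- The components of `F` are convex with quadratic upper bounds `Mc`; the average of all of them
has quadratic bounds `μ`, `M`. -/
structure FiniteSumBounds (F : Fin n → Fin m → Vec d → ℝ) (μ M Mc : ℝ) : Prop where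
  n_pos : 0 < n
  m_pos : 0 < m
  component : ∀ τ i, QuadBounds 0 Mc (F τ i)
  global : QuadBounds μ M (globalAvg F)

variable {F : Fin n → Fin m → Vec d → ℝ} {μ M Mc : ℝ}

namespace FiniteSumBounds

lemma differentiable_nodeAvg (hF : FiniteSumBounds F μ M Mc) (τ : Fin n) :
    Differentiable ℝ (nodeAvg F τ) := by
  unfold nodeAvg
  exact Differentiable.const_mul (Differentiable.fun_sum fun i _ => (hF.component τ i).1) _

lemma gradient_nodeAvg (hF : FiniteSumBounds F μ M Mc) (τ : Fin n) (x : Vec d) :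
    gradient (nodeAvg F τ) x = (1 / (m : ℝ)) • ∑ i, gradient (F τ i) x :=
  gradient_const_mul_sum _ (fun i => (hF.component τ i).1) x

lemma gradient_globalAvg (hF : FiniteSumBounds F μ M Mc) (x : Vec d) :
    gradient (globalAvg F) x = avg fun τ => gradient (nodeAvg F τ) x :=
  gradient_const_mul_sum _ hF.differentiable_nodeAvg x

lemma bregman_nodeAvg (hF : FiniteSumBounds F μ M Mc) (τ : Fin n) (y x : Vec d) :
    bregman (nodeAvg F τ) y x = (1 / (m : ℝ)) * ∑ i, bregman (F τ i) y x :=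
  bregman_const_mul_sum _ (fun i => (hF.component τ i).1) y x

lemma bregman_globalAvg (hF : FiniteSumBounds F μ M Mc) (y x : Vec d) :
    bregman (globalAvg F) y x = (1 / (n : ℝ)) * ∑ τ, bregman (nodeAvg F τ) y x :=
  bregman_const_mul_sum _ hF.differentiable_nodeAvg y x

lemma bregman_component_nonneg (hF : FiniteSumBounds F μ M Mc) (τ : Fin n) (i : Fin m)
    (y x : Vec d) : 0 ≤ bregman (F τ i) y x := by
  simpa using ((hF.component τ i).2 y x).1

lemma bregman_nodeAvg_nonneg (hF : FiniteSumBounds F μ M Mc) (τ : Fin n) (y x : Vec d) :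
    0 ≤ bregman (nodeAvg F τ) y x := by
  rw [hF.bregman_nodeAvg]
  exact mul_nonneg (by positivity)
    (Finset.sum_nonneg fun i _ => hF.bregman_component_nonneg τ i y x)

/-- All node divergences are nonnegative, so each one is at most their sum, which is `n` times the
global divergence. This replaces the smoothness constant of the individual nodes. -/
lemma quadBounds_nodeAvg (hF : FiniteSumBounds F μ M Mc) (τ : Fin n) :
    QuadBounds 0 (n * M) (nodeAvg F τ) := by
  refine ⟨hF.differentiable_nodeAvg τ, fun y x => ⟨?_, ?_⟩⟩
  · simpa using hF.bregman_nodeAvg_nonneg τ y x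
  · have hn : (0 : ℝ) < n := by exact_mod_cast hF.n_pos
    have h1 := (hF.global.2 y x).2
    rw [hF.bregman_globalAvg] at h1
    have h2 := Finset.single_le_sum (f := fun τ => bregman (nodeAvg F τ) y x)
      (fun τ _ => hF.bregman_nodeAvg_nonneg τ y x) (Finset.mem_univ τ)
    have h3 : ∑ τ, bregman (nodeAvg F τ) y x
        = n * (1 / (n : ℝ) * ∑ τ, bregman (nodeAvg F τ) y x) := by field_simp
    have h4 := mul_le_mul_of_nonneg_left h1 hn.le
    linarith

lemma bregman_eq_of_isMin {x z : Vec d} (hz : ∀ y, globalAvg F z ≤ globalAvg F y) :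
    bregman (globalAvg F) x z = globalAvg F x - globalAvg F z := by
  simp [bregman, gradient_eq_zero_of_isMin hz]

variable {z : Vec d}

lemma norm_gradient_sub_sq_le (hF : FiniteSumBounds F μ M Mc) (hM : 0 < M) (hμ : 0 ≤ μ)
    (hz : ∀ y, globalAvg F z ≤ globalAvg F y) (x w : Vec d) :
    ‖gradient (globalAvg F) x - gradient (globalAvg F) w‖ ^ 2
      ≤ 4 * M * ((globalAvg F x - globalAvg F z) + (globalAvg F w - globalAvg F z)) := by
  have h := (hF.global.mono_left hμ).norm_gradient_sub_sq_le_add hM x w z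
  rwa [bregman_eq_of_isMin hz, bregman_eq_of_isMin hz] at h

lemma norm_gradient_sq_le (hF : FiniteSumBounds F μ M Mc) (hM : 0 < M) (hμ : 0 ≤ μ)
    (hz : ∀ y, globalAvg F z ≤ globalAvg F y) (x : Vec d) :
    ‖gradient (globalAvg F) x‖ ^ 2 ≤ 2 * M * (globalAvg F x - globalAvg F z) := by
  have h := (hF.global.mono_left hμ).norm_gradient_sub_sq_le hM x z
  rwa [bregman_eq_of_isMin hz, gradient_eq_zero_of_isMin hz, sub_zero] at h

/-- The loss of a factor `n` in the smoothness of a node is compensated by the weight `1/n²`: the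
same constant appears as for the global gradient. -/
lemma avgSq_gradient_sub_le (hF : FiniteSumBounds F μ M Mc) (hM : 0 < M)
    (hz : ∀ y, globalAvg F z ≤ globalAvg F y) (x w : Vec d) :
    avgSq (fun τ => gradient (nodeAvg F τ) x - gradient (nodeAvg F τ) w)
      ≤ 4 * M * ((globalAvg F x - globalAvg F z) + (globalAvg F w - globalAvg F z)) := by
  have hn : (0 : ℝ) < n := by exact_mod_cast hF.n_pos
  rw [← bregman_eq_of_isMin hz, ← bregman_eq_of_isMin hz, hF.bregman_globalAvg,
    hF.bregman_globalAvg, avgSq]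
  have h1 : ∑ τ, ‖gradient (nodeAvg F τ) x - gradient (nodeAvg F τ) w‖ ^ 2
      ≤ ∑ τ, 4 * (n * M) * (bregman (nodeAvg F τ) x z + bregman (nodeAvg F τ) w z) :=
    Finset.sum_le_sum fun τ _ =>
      (hF.quadBounds_nodeAvg τ).norm_gradient_sub_sq_le_add (by positivity) x w z
  refine (mul_le_mul_of_nonneg_left h1 (by positivity)).trans (le_of_eq ?_)
  rw [← Finset.mul_sum, Finset.sum_add_distrib]
  field_simp

/-- The variance of the sampled gradients of node `τ`. -/
def sampleVar (F : Fin n → Fin m → Vec d → ℝ) (s : State d n) (τ : Fin n) : ℝ :=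
  (1 / (m : ℝ)) * ∑ i, ‖localGrad F s τ i - (gradient (nodeAvg F τ) s.x - s.h τ)‖ ^ 2

lemma avg_localGrad (hF : FiniteSumBounds F μ M Mc) (s : State d n) (τ : Fin n) :
    (1 / (m : ℝ)) • ∑ i, localGrad F s τ i = gradient (nodeAvg F τ) s.x - s.h τ := by
  have hm : (m : ℝ) ≠ 0 := by exact_mod_cast hF.m_pos.ne'
  simp only [localGrad, Finset.sum_sub_distrib, Finset.sum_add_distrib, smul_sub, smul_add,
    ← hF.gradient_nodeAvg]
  simp [← Nat.cast_smul_eq_nsmul ℝ, smul_smul, hm]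

/-- A variance is at most the second moment about any center. Centering at the shift error leaves
only `∇F_i(x) - ∇F_i(w)`, which cocoercivity bounds; independence of the nodes supplies the division
by `n`. -/
lemma avg_sampleVar_le (hF : FiniteSumBounds F μ M Mc) (hMc : 0 < Mc)
    (hz : ∀ y, globalAvg F z ≤ globalAvg F y) (s : State d n) :
    (1 / (n : ℝ)) ^ 2 * ∑ τ, sampleVar F s τ
      ≤ 4 * (Mc / n) * ((globalAvg F s.x - globalAvg F z) + (globalAvg F s.w - globalAvg F z)) := by
  have hn : (0 : ℝ) < n := by exact_mod_cast hF.n_pos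
  rw [← bregman_eq_of_isMin hz, ← bregman_eq_of_isMin hz, hF.bregman_globalAvg,
    hF.bregman_globalAvg]
  have h1 : ∀ τ, sampleVar F s τ
      ≤ 4 * Mc * (bregman (nodeAvg F τ) s.x z + bregman (nodeAvg F τ) s.w z) := by
    intro τ
    have h2 := avg_norm_sq hF.m_pos (fun i => localGrad F s τ i) _ (hF.avg_localGrad s τ)
      (gradient (nodeAvg F τ) s.w - s.h τ)
    have h3 : sampleVar F s τ ≤ (1 / (m : ℝ)) * ∑ i, ‖localGrad F s τ i -
        (gradient (nodeAvg F τ) s.w - s.h τ)‖ ^ 2 := by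
      rw [h2]
      exact le_add_of_nonneg_left (sq_nonneg _)
    refine h3.trans ?_
    rw [hF.bregman_nodeAvg, hF.bregman_nodeAvg, ← mul_add, ← Finset.sum_add_distrib,
      mul_left_comm, Finset.mul_sum (a := 4 * Mc)]
    refine mul_le_mul_of_nonneg_left (Finset.sum_le_sum fun i _ => ?_) (by positivity)
    have h4 : localGrad F s τ i - (gradient (nodeAvg F τ) s.w - s.h τ)
        = gradient (F τ i) s.x - gradient (F τ i) s.w := by
      simp only [localGrad]; abel
    rw [h4]
    exact (hF.component τ i).norm_gradient_sub_sq_le_add hMc s.x s.w z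
  refine (mul_le_mul_of_nonneg_left (Finset.sum_le_sum fun τ (_ : τ ∈ Finset.univ) => h1 τ)
    (by positivity)).trans (le_of_eq ?_)
  rw [← Finset.mul_sum, Finset.sum_add_distrib]
  field_simp

end FiniteSumBounds

end FiniteSum

/-! ### Moments of one iteration -/

section StepMoments

variable {d n m : ℕ} {S S₁ : Type*}
  {F : Fin n → Fin m → Vec d → ℝ} {μ M Mc : ℝ} {Q : S → Vec d → Vec d} {Q₁ : S₁ → Vec d → Vec d}
  {δ δ₁ η : ℝ}

/-- The mean of the vector that node `τ` compresses, without the step size and the error. -/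
def drift (F : Fin n → Fin m → Vec d → ℝ) (s : State d n) (τ : Fin n) : Vec d :=
  gradient (nodeAvg F τ) s.x - s.h τ

/-- The shift error of node `τ`. -/
def shiftErr (F : Fin n → Fin m → Vec d → ℝ) (s : State d n) (τ : Fin n) : Vec d :=
  gradient (nodeAvg F τ) s.w - s.h τ

/-- The variance of the averaged sampled gradients. -/
def totalVar (F : Fin n → Fin m → Vec d → ℝ) (s : State d n) : ℝ :=
  (1 / (n : ℝ)) ^ 2 * ∑ τ, FiniteSumBounds.sampleVar F s τ

lemma FiniteSumBounds.avg_scaled_localGrad (hF : FiniteSumBounds F μ M Mc) (s : State d n)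
    (τ : Fin n) (η : ℝ) (c : Vec d) :
    (1 / (m : ℝ)) • ∑ i, (η • localGrad F s τ i + c) = η • drift F s τ + c := by
  have hm : (m : ℝ) ≠ 0 := by exact_mod_cast hF.m_pos.ne'
  rw [drift, ← hF.avg_localGrad s τ, Finset.sum_add_distrib, ← Finset.smul_sum, smul_add,
    smul_comm]
  simp [← Nat.cast_smul_eq_nsmul ℝ, smul_smul, hm]

lemma FiniteSumBounds.avg_sq_scaled_localGrad (hF : FiniteSumBounds F μ M Mc) (s : State d n)
    (τ : Fin n) (η : ℝ) (c : Vec d) :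
    (1 / (m : ℝ)) * ∑ i, ‖η • localGrad F s τ i + c‖ ^ 2
      = ‖η • drift F s τ + c‖ ^ 2 + η ^ 2 * FiniteSumBounds.sampleVar F s τ := by
  have h := avg_norm_sq hF.m_pos _ _ (hF.avg_scaled_localGrad s τ η c) 0
  simp only [sub_zero] at h
  rw [h, FiniteSumBounds.sampleVar, mul_left_comm, Finset.mul_sum (a := η ^ 2)]
  congr 2
  refine Finset.sum_congr rfl fun i _ => ?_
  rw [add_sub_add_right_eq_sub, ← smul_sub, norm_smul, mul_pow, Real.norm_eq_abs, sq_abs, drift]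

lemma step_e_eq (s : State d n) (ω : Fin n → Fin m × S × S₁) (u : Bool) :
    (step F η Q Q₁ (ω, u) s).e = fun τ => (η • localGrad F s τ (ω τ).1 + s.e τ)
      - Q (ω τ).2.1 (η • localGrad F s τ (ω τ).1 + s.e τ) := by
  ext1 τ
  simp only [step, msgY]
  rw [add_comm (s.e τ)]

/-- The distance of the error-corrected iterate to `z`. -/
def virtualDist (z : Vec d) (s : State d n) : Vec d := s.x - avg s.e - z

/-- What the messages fail to transmit is stored in `e`, so the compressed messages cancel in `x -
avg e`. -/
lemma step_virtualDist (hn : 0 < n) (z : Vec d) (s : State d n) (ω : Fin n → Fin m × S × S₁)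
    (u : Bool) : virtualDist z (step F η Q Q₁ (ω, u) s)
      = avg fun τ => virtualDist z s - η • (localGrad F s τ (ω τ).1 + s.h τ) := by
  rw [avg_sub, avg_smul, avg_add, avg_const hn]
  simp only [virtualDist]
  have h1 : (step F η Q Q₁ (ω, u) s).x = s.x - (avg (msgY F η Q s (ω, u)) + η • avg s.h) := rfl
  have h2 : (step F η Q Q₁ (ω, u) s).e
      = fun τ => (s.e τ + η • localGrad F s τ (ω τ).1) - msgY F η Q s (ω, u) τ := rfl
  rw [h1, h2, avg_sub, avg_add, avg_smul, smul_add]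
  abel

variable [MeasurableSpace S] [MeasurableSpace S₁]
  (ν : Measure S) [IsProbabilityMeasure ν] (ν₁ : Measure S₁) [IsProbabilityMeasure ν₁]

/-- The law of the randomness on all nodes. -/
abbrev nodesLaw (n m : ℕ) : Measure (Fin n → Fin m × S × S₁) :=
  Measure.pi fun _ : Fin n => nodeLaw m ν ν₁

/-- The new error is the compression error of `η g + e`, with conditional mean `(1 - δ)(η drift +
e)`. Averaging over the nodes contracts the mean part by `(1 - δ)²`; only the fluctuations see the
sum of the individual squares. -/
lemma step_e_moments (hF : FiniteSumBounds F μ M Mc) (hQ : IsContractionCompressor ν Q δ)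
    (hs : MeanScaled ν Q δ) (s : State d n) (u : Bool) :
    Integrable (fun ω => ‖avg (step F η Q Q₁ (ω, u) s).e‖ ^ 2) (nodesLaw ν ν₁ n m) ∧
    Integrable (fun ω => avgSq (step F η Q Q₁ (ω, u) s).e) (nodesLaw ν ν₁ n m) ∧
    ∫ ω, ‖avg (step F η Q Q₁ (ω, u) s).e‖ ^ 2 ∂(nodesLaw ν ν₁ n m)
      ≤ (1 - δ) ^ 2 * ‖η • avg (drift F s) + avg s.e‖ ^ 2
        + (1 - δ) * δ * avgSq (fun τ => η • drift F s τ + s.e τ)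
        + (1 - δ) * (η ^ 2 * totalVar F s) ∧
    ∫ ω, avgSq (step F η Q Q₁ (ω, u) s).e ∂(nodesLaw ν ν₁ n m)
      ≤ (1 - δ) * (avgSq (fun τ => η • drift F s τ + s.e τ) + η ^ 2 * totalVar F s) := by
  have := isProbabilityMeasure_uniformOn_univ hF.m_pos
  have hnode := fun τ => node_moments_compress (m := m) ν ν₁ hF.m_pos hQ hs
    (fun i => η • localGrad F s τ i + s.e τ)
  simp_rw [step_e_eq]
  refine ⟨(integral_norm_avg_sq _ fun τ => (hnode τ).1).1,
    (integral_avgSq _ fun τ => (hnode τ).1).1, ?_⟩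
  have h := avg_contracted_moments (nodeLaw m ν ν₁) (fun τ => (hnode τ).1) (c := 1 - δ)
    (fun τ => η • drift F s τ + s.e τ) (fun τ => η ^ 2 * FiniteSumBounds.sampleVar F s τ)
    (fun τ => by rw [(hnode τ).2.1, hF.avg_scaled_localGrad])
    (fun τ => by rw [← hF.avg_sq_scaled_localGrad]; exact (hnode τ).2.2)
  have e1 : (1 / (n : ℝ)) ^ 2 * ∑ τ, η ^ 2 * FiniteSumBounds.sampleVar F s τ
      = η ^ 2 * totalVar F s := by
    rw [← Finset.mul_sum, totalVar]; ring
  rw [e1, avg_add, avg_smul, sub_sub_cancel] at h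
  exact h

/-- The old check point is kept here, so that this is the effect of the shift compression alone; the
coin toss is treated in `FiniteSumBounds.shiftErr_coin_le`. -/
lemma step_h_moments (hF : FiniteSumBounds F μ M Mc) (hQ : IsContractionCompressor ν₁ Q₁ δ₁)
    (hs : MeanScaled ν₁ Q₁ δ₁) (s : State d n) (u : Bool) :
    Integrable (fun ω => ‖avg fun τ => gradient (nodeAvg F τ) s.w
      - (step F η Q Q₁ (ω, u) s).h τ‖ ^ 2) (nodesLaw ν ν₁ n m) ∧
    Integrable (fun ω => avgSq fun τ => gradient (nodeAvg F τ) s.w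
      - (step F η Q Q₁ (ω, u) s).h τ) (nodesLaw ν ν₁ n m) ∧
    ∫ ω, ‖avg fun τ => gradient (nodeAvg F τ) s.w
        - (step F η Q Q₁ (ω, u) s).h τ‖ ^ 2 ∂(nodesLaw ν ν₁ n m)
      ≤ (1 - δ₁) ^ 2 * ‖avg (shiftErr F s)‖ ^ 2 + (1 - δ₁) * δ₁ * avgSq (shiftErr F s) ∧
    ∫ ω, avgSq (fun τ => gradient (nodeAvg F τ) s.w
        - (step F η Q Q₁ (ω, u) s).h τ) ∂(nodesLaw ν ν₁ n m)
      ≤ (1 - δ₁) * avgSq (shiftErr F s) := by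
  have := isProbabilityMeasure_uniformOn_univ hF.m_pos
  have hnode := fun τ => node_moments_shift (m := m) ν ν₁ hF.m_pos hQ hs (shiftErr F s τ)
  have he : ∀ (ω : Fin n → Fin m × S × S₁) τ, gradient (nodeAvg F τ) s.w
      - (step F η Q Q₁ (ω, u) s).h τ = shiftErr F s τ - Q₁ (ω τ).2.2 (shiftErr F s τ) := by
    intro ω τ
    simp only [step, msgZ, shiftErr]
    abel
  simp_rw [he]
  refine ⟨(integral_norm_avg_sq _ fun τ => (hnode τ).1).1,
    (integral_avgSq _ fun τ => (hnode τ).1).1, ?_⟩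
  have h := avg_contracted_moments (nodeLaw m ν ν₁) (fun τ => (hnode τ).1) (c := 1 - δ₁)
    (shiftErr F s) (fun _ => 0) (fun τ => (hnode τ).2.1)
    (fun τ => by rw [add_zero]; exact (hnode τ).2.2)
  simpa using h

/-- The shifts `h` cancel from the stochastic gradient `localGrad + h`. Its mean is the global
gradient, and sampling is the only source of variance. -/
lemma step_x_moments (hF : FiniteSumBounds F μ M Mc) (z : Vec d) (s : State d n) (u : Bool) :
    Integrable (fun ω => ‖virtualDist z (step F η Q Q₁ (ω, u) s)‖ ^ 2) (nodesLaw ν ν₁ n m) ∧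
    ∫ ω, ‖virtualDist z (step F η Q Q₁ (ω, u) s)‖ ^ 2 ∂(nodesLaw ν ν₁ n m)
      = ‖virtualDist z s - η • gradient (globalAvg F) s.x‖ ^ 2 + η ^ 2 * totalVar F s := by
  have := isProbabilityMeasure_uniformOn_univ hF.m_pos
  have he : ∀ τ i, virtualDist z s - η • (localGrad F s τ i + s.h τ)
      = (-η) • localGrad F s τ i + (virtualDist z s - η • s.h τ) := by
    intro τ i
    rw [smul_add, neg_smul]
    abel
  have hnode := fun τ => node_moments_index (m := m) ν ν₁ hF.m_pos
    (fun i => (-η) • localGrad F s τ i + (virtualDist z s - η • s.h τ))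
  simp_rw [step_virtualDist hF.n_pos, he]
  have h := integral_norm_avg_sq (nodeLaw m ν ν₁) fun τ => (hnode τ).1
  refine ⟨h.1, h.2.trans ?_⟩
  simp_rw [(hnode _).2.1, (hnode _).2.2, hF.avg_scaled_localGrad, hF.avg_sq_scaled_localGrad]
  have e1 : (fun τ => (-η) • drift F s τ + (virtualDist z s - η • s.h τ))
      = fun τ => virtualDist z s - η • gradient (nodeAvg F τ) s.x := by
    ext1 τ
    rw [drift, smul_sub, neg_smul, neg_smul]
    abel
  rw [e1, avg_sub, avg_const hF.n_pos, avg_smul, ← hF.gradient_globalAvg, totalVar]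
  congr 1
  simp only [add_sub_cancel_left, ← Finset.mul_sum]
  ring

end StepMoments

/-! ### The Lyapunov function -/

section Scalars

/-- `E1`, `E2` stand for the squared average error and the node sum, `Bs`, `B2` for the same
quantities of the drift, `Z` for the sampling variance and `I1`, `I2` for the new errors. The weight
`16` lets the decrease of the node sum pay for its leakage `2 (1 - δ) δ` into the squared average,
which fixes the rate `3δ/8`. -/
lemma error_recursion {δ E1 E2 Bs B2 Z η I1 I2 N A1 : ℝ} (h0 : 0 < δ) (h1 : δ ≤ 1)
    (hE1 : 0 ≤ E1) (hE2 : 0 ≤ E2) (hBs : 0 ≤ Bs) (hB2 : 0 ≤ B2)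
    (hN : N ≤ (1 + δ) * E1 + (1 + 1 / δ) * (η ^ 2 * Bs))
    (hA1 : A1 ≤ 2 * E2 + 2 * (η ^ 2 * B2))
    (hA2 : A1 ≤ (1 + δ / 2) * E2 + (1 + 2 / δ) * (η ^ 2 * B2))
    (hI1 : I1 ≤ (1 - δ) ^ 2 * N + (1 - δ) * δ * A1 + (1 - δ) * (η ^ 2 * Z))
    (hI2 : I2 ≤ (1 - δ) * (A1 + η ^ 2 * Z)) :
    I1 + 16 * I2 ≤ (1 - 3 * δ / 8) * (E1 + 16 * E2)
      + (1 - δ) / δ * η ^ 2 * (Bs + 50 * B2) + 17 * (1 - δ) * (η ^ 2 * Z) := by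
  have hd : 0 ≤ 1 - δ := by linarith
  -- `A1` is estimated twice: the crude bound suffices where it is multiplied by `δ`, while the main
  -- term needs the sharp bound `1 + δ/2`.
  have k1 := mul_le_mul_of_nonneg_left hN (sq_nonneg (1 - δ))
  have k2 := mul_le_mul_of_nonneg_left hA1 (mul_nonneg hd h0.le)
  have k3 := mul_le_mul_of_nonneg_left hA2 hd
  have e1 : (1 - δ) ^ 2 * (1 + δ) ≤ 1 - 3 * δ / 8 := by nlinarith [mul_nonneg hd h0.le]
  have e2 : (1 - δ) * δ * 2 + 16 * ((1 - δ) * (1 + δ / 2)) ≤ 16 * (1 - 3 * δ / 8) := by nlinarith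
  have e3 : (1 - δ) ^ 2 * (1 + 1 / δ) ≤ (1 - δ) / δ := by
    have : (1 - δ) / δ - (1 - δ) ^ 2 * (1 + 1 / δ) = (1 - δ) * δ := by field_simp; ring
    linarith [mul_nonneg hd h0.le]
  have e4 : (1 - δ) * δ * 2 + 16 * ((1 - δ) * (1 + 2 / δ)) ≤ (1 - δ) / δ * 50 := by
    have : (1 - δ) / δ * 50 - ((1 - δ) * δ * 2 + 16 * ((1 - δ) * (1 + 2 / δ)))
        = (1 - δ) / δ * ((1 - δ) * (18 + 2 * δ)) := by field_simp; ring
    have : 0 ≤ (1 - δ) / δ * ((1 - δ) * (18 + 2 * δ)) := by positivity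
    linarith
  have f1 := mul_le_mul_of_nonneg_right e1 hE1
  have f2 := mul_le_mul_of_nonneg_right e2 hE2
  have f3 := mul_le_mul_of_nonneg_right e3 (mul_nonneg (sq_nonneg η) hBs)
  have f4 := mul_le_mul_of_nonneg_right e4 (mul_nonneg (sq_nonneg η) hB2)
  linarith

/-- The prefactor `1 + δ₁/2` is the loss caused later by moving the check point. With the weight
`8`, the node sum has the first-order coefficient `8 - 3δ₁`, so a rate `3δ₁/8` remains after this
loss. -/
lemma shift_recursion {δ₁ H1 H2 I1 I2 : ℝ} (h0 : 0 < δ₁) (h1 : δ₁ ≤ 1) (hH1 : 0 ≤ H1)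
    (hH2 : 0 ≤ H2) (hI1 : I1 ≤ (1 - δ₁) ^ 2 * H1 + (1 - δ₁) * δ₁ * H2)
    (hI2 : I2 ≤ (1 - δ₁) * H2) :
    (1 + δ₁ / 2) * (I1 + 8 * I2) ≤ (1 - 3 * δ₁ / 8) * (H1 + 8 * H2) := by
  have hd : 0 ≤ 1 - δ₁ := by linarith
  have k1 : I1 + 8 * I2 ≤ (1 - δ₁) ^ 2 * H1 + (1 - δ₁) * (δ₁ + 8) * H2 := by linarith
  have k2 := mul_le_mul_of_nonneg_left k1 (by linarith : 0 ≤ 1 + δ₁ / 2)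
  have e1 : (1 + δ₁ / 2) * (1 - δ₁) ^ 2 ≤ 1 - 3 * δ₁ / 8 := by
    nlinarith [mul_nonneg hd h0.le, mul_nonneg (mul_nonneg hd h0.le) h0.le]
  have e2 : (1 + δ₁ / 2) * ((1 - δ₁) * (δ₁ + 8)) ≤ 8 * (1 - 3 * δ₁ / 8) := by
    nlinarith [mul_nonneg hd h0.le, mul_nonneg (mul_nonneg hd h0.le) h0.le, pow_pos h0 3]
  have f1 := mul_le_mul_of_nonneg_right e1 hH1
  have f2 := mul_le_mul_of_nonneg_right e2 hH2
  linarith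

/-- The constant in front of the weight of the check point in the Lyapunov function. -/
def ckConst (a c₂ : ℝ) : ℝ := 4 * a + 11424 * a ^ 2 + 86400 * a ^ 2 * (c₂ * (1 + 2 * c₂))

/-- Each error recursion contracts at `3/8` of its compression parameter, but only `1/4` is needed
for `θ`. The surplus `1/8` pays for cross terms: with weight `24ηM/δ` it gives the `3ηM E1` charged
by the virtual step, and with weight `2400ηa²/(Mδ₁)` it gives the `300 (ηa²/M)(H1 + 8 H2)` charged
by the drift. The check point weight collects everything proportional to `X + W`. -/
lemma lyapunov_recursion {μ M ℓ η a c₂ δ δ₁ p θ Y X W E1 E2 H1 H2 Bs B2 Z : ℝ}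
    (hM : 0 < M) (hη : 0 < η) (ha : 0 < a) (hδ0 : 0 < δ) (hδ1 : δ ≤ 1) (hδ₁0 : 0 < δ₁)
    (hp0 : 0 < p) (hpc : p ≤ c₂ * δ₁)
    (hηM : η * M ≤ a) (hηℓ : η * ℓ ≤ a) (hηδ : η * M * Real.sqrt (1 - δ) ≤ a * δ)
    (hsmall : 2 * a + 3 * ckConst a c₂ ≤ 1 / 2)
    (hθ1 : θ ≤ μ * η / 2) (hθ2 : θ ≤ δ / 4) (hθ3 : θ ≤ δ₁ / 4) (hθ4 : θ ≤ p / 4)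
    (hY : 0 ≤ Y) (hX : 0 ≤ X) (hW : 0 ≤ W) (hE1 : 0 ≤ E1) (hE2 : 0 ≤ E2)
    (hH1 : 0 ≤ H1) (hH2 : 0 ≤ H2)
    (hBs : Bs ≤ 8 * M * (X + W) + 2 * H1) (hB2 : B2 ≤ 8 * M * (X + W) + 2 * H2)
    (hZ : Z ≤ 4 * ℓ * (X + W)) :
    ((1 - η * μ / 2) * Y - η * X + 3 * η * M * E1 + 2 * η ^ 2 * M * X + η ^ 2 * Z)
      + 24 * η * M / δ * ((1 - 3 * δ / 8) * (E1 + 16 * E2)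
        + (1 - δ) / δ * η ^ 2 * (Bs + 50 * B2) + 17 * (1 - δ) * (η ^ 2 * Z))
      + 2400 * η * a ^ 2 / (M * δ₁) * ((1 - 3 * δ₁ / 8) * (H1 + 8 * H2)
        + 9 * (p * (1 + 2 * p / δ₁) * (4 * M * (X + W))))
      + 2 * ckConst a c₂ * η / p * (p * X + (1 - p) * W)
    ≤ (1 - θ) * (Y + 24 * η * M / δ * (E1 + 16 * E2)
        + 2400 * η * a ^ 2 / (M * δ₁) * (H1 + 8 * H2) + 2 * ckConst a c₂ * η / p * W)
      - η / 2 * X := by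
  have hd : 0 ≤ 1 - δ := by linarith
  have hXW : 0 ≤ X + W := by linarith
  have hs0 := Real.sqrt_nonneg (1 - δ)
  have hs1 : Real.sqrt (1 - δ) ≤ 1 := Real.sqrt_le_one.2 (by linarith)
  have hsq : Real.sqrt (1 - δ) ^ 2 = 1 - δ := Real.sq_sqrt hd
  set R := ckConst a c₂ with hR
  have hc₂ : 0 ≤ c₂ := by
    by_contra h
    nlinarith only [h, hpc, hp0, hδ₁0]
  have hR0 : 0 ≤ R := by rw [hR, ckConst]; positivity
  -- the gradient noise
  have z1 : η ^ 2 * Z ≤ 4 * a * η * (X + W) := by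
    have h1 := mul_le_mul_of_nonneg_left hZ (sq_nonneg η)
    have h2 := mul_le_mul_of_nonneg_right hηℓ (mul_nonneg hη.le hXW)
    calc η ^ 2 * Z ≤ η ^ 2 * (4 * ℓ * (X + W)) := h1
      _ = 4 * (η * ℓ * (η * (X + W))) := by ring
      _ ≤ 4 * (a * (η * (X + W))) := by linarith only [h2]
      _ = 4 * a * η * (X + W) := by ring
  -- Since `1 - δ ≤ √(1 - δ)`, the step size condition with the square root controls this factor
  -- too.
  have z2 : 24 * η * M / δ * (1 - δ) ≤ 24 * a := by
    rw [div_mul_eq_mul_div, div_le_iff₀ hδ0]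
    have h1 : (1 - δ) ≤ Real.sqrt (1 - δ) := by nlinarith
    have h2 := mul_le_mul_of_nonneg_left h1 (by positivity : 0 ≤ η * M)
    linarith
  have z3 : 24 * η * M / δ * (17 * (1 - δ) * (η ^ 2 * Z)) ≤ 1632 * a ^ 2 * η * (X + W) := by
    have h1 : 0 ≤ 24 * η * M / δ * (1 - δ) := by positivity
    have h2 := mul_le_mul_of_nonneg_left z1 h1
    have h3 := mul_le_mul_of_nonneg_right z2 (by positivity : 0 ≤ 4 * a * η * (X + W))
    linarith
  -- the drift
  have b1 : 24 * η * M / δ * ((1 - δ) / δ * η ^ 2) ≤ 24 * a ^ 2 * η / M := by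
    have h1 : (η * M * Real.sqrt (1 - δ)) ^ 2 ≤ (a * δ) ^ 2 := by gcongr
    have h2 : 24 * η * M / δ * ((1 - δ) / δ * η ^ 2)
        = 24 * η / M * ((η * M * Real.sqrt (1 - δ)) ^ 2 / δ ^ 2) := by
      rw [mul_pow, hsq]; field_simp
    have h3 : (η * M * Real.sqrt (1 - δ)) ^ 2 / δ ^ 2 ≤ a ^ 2 := by
      rw [div_le_iff₀ (by positivity)]; linarith
    rw [h2]
    refine (mul_le_mul_of_nonneg_left h3 (by positivity)).trans (le_of_eq ?_)
    ring
  have b2 : 24 * η * M / δ * ((1 - δ) / δ * η ^ 2 * (Bs + 50 * B2))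
      ≤ 9792 * a ^ 2 * η * (X + W) + 300 * (η * a ^ 2 / M) * (H1 + 8 * H2) := by
    have h1 : Bs + 50 * B2 ≤ 408 * M * (X + W) + 100 * H2 + 2 * H1 := by linarith
    have h0 : 0 ≤ 408 * M * (X + W) + 100 * H2 + 2 * H1 := by positivity
    have h2 := mul_le_mul_of_nonneg_left h1
      (by positivity : 0 ≤ 24 * η * M / δ * ((1 - δ) / δ * η ^ 2))
    have h3 := mul_le_mul_of_nonneg_right b1 h0
    have h4 : 24 * a ^ 2 * η / M * (408 * M * (X + W) + 100 * H2 + 2 * H1)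
        = 9792 * a ^ 2 * η * (X + W) + (η * a ^ 2 / M) * (48 * H1 + 2400 * H2) := by
      field_simp; ring
    have h5 : (η * a ^ 2 / M) * (48 * H1 + 2400 * H2)
        ≤ (η * a ^ 2 / M) * (300 * (H1 + 8 * H2)) :=
      mul_le_mul_of_nonneg_left (by linarith) (by positivity)
    linarith
  -- the shifts
  have c1 : 2400 * η * a ^ 2 / (M * δ₁) * (9 * (p * (1 + 2 * p / δ₁) * (4 * M * (X + W))))
      ≤ 86400 * a ^ 2 * (c₂ * (1 + 2 * c₂)) * η * (X + W) := by
    have h1 : p / δ₁ ≤ c₂ := by rwa [div_le_iff₀ hδ₁0]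
    have h2 : 0 ≤ p / δ₁ := by positivity
    have h3 : p / δ₁ * (1 + 2 * (p / δ₁)) ≤ c₂ * (1 + 2 * c₂) := by gcongr
    have h4 : 2400 * η * a ^ 2 / (M * δ₁) * (9 * (p * (1 + 2 * p / δ₁) * (4 * M * (X + W))))
        = 86400 * a ^ 2 * η * (X + W) * (p / δ₁ * (1 + 2 * (p / δ₁))) := by
      field_simp; ring
    rw [h4]
    refine (mul_le_mul_of_nonneg_left h3 (by positivity)).trans (le_of_eq ?_)
    ring
  have c2 : 2400 * η * a ^ 2 / (M * δ₁) * (δ₁ / 8 * (H1 + 8 * H2))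
      = 300 * (η * a ^ 2 / M) * (H1 + 8 * H2) := by
    field_simp; ring
  have d1 : 24 * η * M / δ * (δ / 8 * E1) = 3 * η * M * E1 := by field_simp; ring
  have w1 : 2 * R * η / p * (p * X + (1 - p) * W)
      = 2 * R * η * X + 2 * R * η / p * W - 2 * R * η * W := by field_simp; ring
  have w2 : 2 * R * η / p * (p / 4 * W) = R * η / 2 * W := by field_simp; ring
  have x1 : 2 * η ^ 2 * M * X ≤ 2 * a * η * X := by
    have h := mul_le_mul_of_nonneg_right hηM (mul_nonneg hη.le hX)
    calc 2 * η ^ 2 * M * X = 2 * (η * M * (η * X)) := by ring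
      _ ≤ 2 * (a * (η * X)) := by linarith only [h]
      _ = 2 * a * η * X := by ring
  -- contraction
  have t1 : θ * Y ≤ η * μ / 2 * Y := mul_le_mul_of_nonneg_right (by linarith) hY
  have t2 : 24 * η * M / δ * (θ * (E1 + 16 * E2)) ≤ 24 * η * M / δ * (δ / 4 * (E1 + 16 * E2)) :=
    mul_le_mul_of_nonneg_left (mul_le_mul_of_nonneg_right hθ2 (by positivity)) (by positivity)
  have t2' : 0 ≤ 24 * η * M / δ * (δ / 8 * (16 * E2)) := by positivity
  have t3 : 2400 * η * a ^ 2 / (M * δ₁) * (θ * (H1 + 8 * H2))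
      ≤ 2400 * η * a ^ 2 / (M * δ₁) * (δ₁ / 4 * (H1 + 8 * H2)) :=
    mul_le_mul_of_nonneg_left (mul_le_mul_of_nonneg_right hθ3 (by positivity)) (by positivity)
  have t4 : 2 * R * η / p * (θ * W) ≤ 2 * R * η / p * (p / 4 * W) :=
    mul_le_mul_of_nonneg_left (mul_le_mul_of_nonneg_right hθ4 hW) (by positivity)
  -- The `X` terms add up to `2a` from the squared gradient, `2R` from the check point update and
  -- `R` from noise. Keeping them below one half preserves `-(η/2) X`.
  have s1 : (2 * a + 3 * R) * (η * X) ≤ 1 / 2 * (η * X) :=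
    mul_le_mul_of_nonneg_right hsmall (by positivity)
  have s2 : 0 ≤ R * η * W := by positivity
  -- This is the origin of `ckConst`: sampling noise in the virtual step, sampling noise in the
  -- errors (`24 · 17 · 4`), drift in the errors (`24 · 408`), and the moved check point (`2400 · 9
  -- · 4`).
  have r1 : (4 * a + 1632 * a ^ 2 + 9792 * a ^ 2 + 86400 * a ^ 2 * (c₂ * (1 + 2 * c₂)))
      * (η * (X + W)) = R * (η * (X + W)) := by rw [hR, ckConst]; ring
  have pE : 24 * η * M / δ * ((1 - 3 * δ / 8) * (E1 + 16 * E2)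
        + (1 - δ) / δ * η ^ 2 * (Bs + 50 * B2) + 17 * (1 - δ) * (η ^ 2 * Z))
      ≤ (1 - θ) * (24 * η * M / δ * (E1 + 16 * E2)) - 3 * η * M * E1
        + 9792 * a ^ 2 * η * (X + W) + 300 * (η * a ^ 2 / M) * (H1 + 8 * H2)
        + 1632 * a ^ 2 * η * (X + W) := by
    clear_value R
    generalize 24 * η * M / δ = A at *
    clear * - t2 t2' b2 z3 d1
    linarith
  have pH : 2400 * η * a ^ 2 / (M * δ₁) * ((1 - 3 * δ₁ / 8) * (H1 + 8 * H2)
        + 9 * (p * (1 + 2 * p / δ₁) * (4 * M * (X + W))))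
      ≤ (1 - θ) * (2400 * η * a ^ 2 / (M * δ₁) * (H1 + 8 * H2))
        - 300 * (η * a ^ 2 / M) * (H1 + 8 * H2)
        + 86400 * a ^ 2 * (c₂ * (1 + 2 * c₂)) * η * (X + W) := by
    generalize 2400 * η * a ^ 2 / (M * δ₁) = A at *
    clear * - t3 c1 c2
    linarith
  have pW : 2 * R * η / p * (p * X + (1 - p) * W)
      ≤ (1 - θ) * (2 * R * η / p * W) + 2 * R * η * X - R * η * W := by
    clear * - w1 w2 t4 s2
    linarith
  have pY : (1 - η * μ / 2) * Y ≤ (1 - θ) * Y := by linarith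
  clear * - pE pH pW pY z1 x1 s1 r1
  linarith

end Scalars

/-! ### Decrease of the Lyapunov function in one iteration -/

section Lyapunov

variable {d n m : ℕ}

/-- The Lyapunov function of EC-LSVRG with weights `cE`, `cH`, `cW`. -/
def lyap (F : Fin n → Fin m → Vec d → ℝ) (z : Vec d) (cE cH cW : ℝ) (s : State d n) : ℝ :=
  ‖virtualDist z s‖ ^ 2 + cE * (‖avg s.e‖ ^ 2 + 16 * avgSq s.e)
    + cH * (‖avg (shiftErr F s)‖ ^ 2 + 8 * avgSq (shiftErr F s))
    + cW * (globalAvg F s.w - globalAvg F z)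

lemma lintegral_coin {p : ℝ} (g : Bool → ℝ≥0∞) :
    ∫⁻ u, g u ∂(ENNReal.ofReal p • Measure.dirac true + ENNReal.ofReal (1 - p) • Measure.dirac false)
      = ENNReal.ofReal p * g true + ENNReal.ofReal (1 - p) * g false := by
  rw [lintegral_add_measure, lintegral_smul_measure, lintegral_smul_measure, lintegral_dirac,
    lintegral_dirac, smul_eq_mul, smul_eq_mul]

variable {F : Fin n → Fin m → Vec d → ℝ} {μ M Mc : ℝ} {z : Vec d}

lemma lyap_nonneg (hz : ∀ y, globalAvg F z ≤ globalAvg F y) {cE cH cW : ℝ} (hE : 0 ≤ cE)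
    (hH : 0 ≤ cH) (hW : 0 ≤ cW) (s : State d n) : 0 ≤ lyap F z cE cH cW s := by
  have h1 := avgSq_nonneg s.e
  have h2 := avgSq_nonneg (shiftErr F s)
  have h3 := sub_nonneg.2 (hz s.w)
  unfold lyap
  positivity

lemma drift_eq_add (s : State d n) : drift F s
    = fun τ => (gradient (nodeAvg F τ) s.x - gradient (nodeAvg F τ) s.w) + shiftErr F s τ := by
  ext1 τ
  simp [drift, shiftErr]

lemma FiniteSumBounds.norm_avg_drift_sq_le (hF : FiniteSumBounds F μ M Mc) (hM : 0 < M)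
    (hμ : 0 ≤ μ) (hz : ∀ y, globalAvg F z ≤ globalAvg F y) (s : State d n) :
    ‖avg (drift F s)‖ ^ 2 ≤ 8 * M * ((globalAvg F s.x - globalAvg F z)
      + (globalAvg F s.w - globalAvg F z)) + 2 * ‖avg (shiftErr F s)‖ ^ 2 := by
  rw [drift_eq_add, avg_add, avg_sub, ← hF.gradient_globalAvg, ← hF.gradient_globalAvg]
  have h1 := norm_add_sq_le_young one_pos
    (gradient (globalAvg F) s.x - gradient (globalAvg F) s.w) (avg (shiftErr F s))
  have h2 := hF.norm_gradient_sub_sq_le hM hμ hz s.x s.w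
  linarith

lemma FiniteSumBounds.avgSq_drift_le (hF : FiniteSumBounds F μ M Mc) (hM : 0 < M)
    (hz : ∀ y, globalAvg F z ≤ globalAvg F y) (s : State d n) :
    avgSq (drift F s) ≤ 8 * M * ((globalAvg F s.x - globalAvg F z)
      + (globalAvg F s.w - globalAvg F z)) + 2 * avgSq (shiftErr F s) := by
  rw [drift_eq_add]
  have h1 := avgSq_add_le_young one_pos
    (fun τ => gradient (nodeAvg F τ) s.x - gradient (nodeAvg F τ) s.w) (shiftErr F s)
  have h2 := hF.avgSq_gradient_sub_le hM hz s.x s.w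
  linarith

/-- A gradient step from the error-corrected iterate, with the gradient at the iterate. -/
lemma FiniteSumBounds.norm_virtualDist_sub_sq_le (hF : FiniteSumBounds F μ M Mc) (hM : 0 < M)
    (hμ : 0 ≤ μ) (hμM : μ ≤ M) (hz : ∀ y, globalAvg F z ≤ globalAvg F y) {η : ℝ} (hη : 0 ≤ η)
    (s : State d n) :
    ‖virtualDist z s - η • gradient (globalAvg F) s.x‖ ^ 2
      ≤ (1 - η * μ / 2) * ‖virtualDist z s‖ ^ 2 - η * (globalAvg F s.x - globalAvg F z)
        + 3 * η * M * ‖avg s.e‖ ^ 2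
        + 2 * η ^ 2 * M * (globalAvg F s.x - globalAvg F z) := by
  set G := gradient (globalAvg F) s.x with hG
  set e := avg s.e with he
  set X := globalAvg F s.x - globalAvg F z with hX
  have hvd : virtualDist z s = (s.x - z) + (-e) := by rw [virtualDist]; abel
  have h1 : ‖G‖ ^ 2 ≤ 2 * M * X := hF.norm_gradient_sq_le hM hμ hz s.x
  have h2 : X + μ / 2 * ‖s.x - z‖ ^ 2 ≤ inner ℝ (s.x - z) G := by
    have h := (hF.global.2 z s.x).1
    rw [bregman, ← neg_sub s.x z, inner_neg_right, norm_neg, real_inner_comm] at h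
    linarith
  -- After multiplication by `2η` this spends half of the descent `2ηX`. Replacing `‖x - z‖²` by the
  -- virtual distance costs another `ημ ‖e‖²`, hence the coefficient `3ηM`.
  have h3 : inner ℝ e G ≤ M * ‖e‖ ^ 2 + X / 2 := by
    have h := real_inner_le_norm e G
    have h' : ‖e‖ * ‖G‖ ≤ M * ‖e‖ ^ 2 + ‖G‖ ^ 2 / (4 * M) := by
      have h4 : M * ‖e‖ ^ 2 + ‖G‖ ^ 2 / (4 * M) - ‖e‖ * ‖G‖
          = (2 * M * ‖e‖ - ‖G‖) ^ 2 / (4 * M) := by field_simp; ring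
      have h5 : 0 ≤ (2 * M * ‖e‖ - ‖G‖) ^ 2 / (4 * M) := by positivity
      linarith
    have h6 : ‖G‖ ^ 2 / (4 * M) ≤ X / 2 := by
      rw [div_le_iff₀ (by positivity)]; linarith
    linarith
  have h4 : ‖virtualDist z s‖ ^ 2 ≤ 2 * ‖s.x - z‖ ^ 2 + 2 * ‖e‖ ^ 2 := by
    have h := norm_add_sq_le_young one_pos (s.x - z) (-e)
    rw [← hvd, norm_neg] at h
    linarith
  have h5 : inner ℝ (virtualDist z s) G = inner ℝ (s.x - z) G - inner ℝ e G := by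
    rw [hvd, inner_add_left, inner_neg_left]; ring
  rw [norm_sub_sq_real, inner_smul_right, norm_smul, mul_pow, Real.norm_eq_abs, sq_abs, h5]
  have k1 := mul_le_mul_of_nonneg_left h1 (sq_nonneg η)
  have k2 := mul_le_mul_of_nonneg_left h2 hη
  have k3 := mul_le_mul_of_nonneg_left h3 hη
  have k4 := mul_le_mul_of_nonneg_left h4 (mul_nonneg hη hμ)
  have k5 := mul_le_mul_of_nonneg_right hμM (mul_nonneg hη (sq_nonneg ‖e‖))
  linarith

/-- The numerical parameters of EC-LSVRG, with bounds on the step size. -/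
structure StepBounds (μ M ℓ η a c₂ δ δ₁ p θ : ℝ) : Prop where
  mu_pos : 0 < μ
  mu_le : μ ≤ M
  eta_pos : 0 < η
  a_pos : 0 < a
  p_pos : 0 < p
  p_le_one : p ≤ 1
  p_le : p ≤ c₂ * δ₁
  eta_M : η * M ≤ a
  eta_l : η * ℓ ≤ a
  eta_delta : η * M * Real.sqrt (1 - δ) ≤ a * δ
  small : 2 * a + 3 * ckConst a c₂ ≤ 1 / 2
  theta_pos : 0 < θ
  theta_le_mu : θ ≤ μ * η / 2
  theta_le_delta : θ ≤ δ / 4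
  theta_le_delta₁ : θ ≤ δ₁ / 4
  theta_le_p : θ ≤ p / 4

/-- The Lyapunov function with the weights of the convergence proof. -/
def lyapW (F : Fin n → Fin m → Vec d → ℝ) (z : Vec d) (M η a c₂ δ δ₁ p : ℝ) (s : State d n) : ℝ :=
  lyap F z (24 * η * M / δ) (2400 * η * a ^ 2 / (M * δ₁)) (2 * ckConst a c₂ * η / p) s

variable {S S₁ : Type*} {Q : S → Vec d → Vec d} {Q₁ : S₁ → Vec d → Vec d} {η a c₂ δ δ₁ p θ : ℝ}

/-- The shift errors after the coin toss. -/
lemma FiniteSumBounds.shiftErr_coin_le (hF : FiniteSumBounds F μ M Mc) (hM : 0 < M) (hμ : 0 ≤ μ)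
    (hz : ∀ y, globalAvg F z ≤ globalAvg F y) (hp : 0 < p) (hδ₁ : 0 < δ₁)
    (s : State d n) (ω : Fin n → Fin m × S × S₁) (H : ℝ)
    (hH : H = ‖avg fun τ => gradient (nodeAvg F τ) s.w - (step F η Q Q₁ (ω, false) s).h τ‖ ^ 2
      + 8 * avgSq fun τ => gradient (nodeAvg F τ) s.w - (step F η Q Q₁ (ω, false) s).h τ) :
    p * (‖avg (shiftErr F (step F η Q Q₁ (ω, true) s))‖ ^ 2
        + 8 * avgSq (shiftErr F (step F η Q Q₁ (ω, true) s)))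
      + (1 - p) * (‖avg (shiftErr F (step F η Q Q₁ (ω, false) s))‖ ^ 2
        + 8 * avgSq (shiftErr F (step F η Q Q₁ (ω, false) s)))
    ≤ (1 + δ₁ / 2) * H + 9 * (p * (1 + 2 * p / δ₁) * (4 * M *
      ((globalAvg F s.x - globalAvg F z) + (globalAvg F s.w - globalAvg F z)))) := by
  have e1 : shiftErr F (step F η Q Q₁ (ω, false) s)
      = fun τ => gradient (nodeAvg F τ) s.w - (step F η Q Q₁ (ω, false) s).h τ := rfl
  have e2 : shiftErr F (step F η Q Q₁ (ω, true) s)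
      = fun τ => (gradient (nodeAvg F τ) s.w - (step F η Q Q₁ (ω, false) s).h τ)
        + (gradient (nodeAvg F τ) s.x - gradient (nodeAvg F τ) s.w) := by
    ext1 τ
    simp [shiftErr, step, msgZ]
  rw [e1, ← hH, e2]
  -- Young's parameter is applied only when the coin shows `true`, so on average it costs `p ·
  -- δ₁/(2p) = δ₁/2`. The factor `9` is the total weight `1 + 8` of the two shift terms.
  have hc : 0 < δ₁ / (2 * p) := by positivity
  have h1 := avgSq_add_le_young hc
    (fun τ => gradient (nodeAvg F τ) s.w - (step F η Q Q₁ (ω, false) s).h τ)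
    (fun τ => gradient (nodeAvg F τ) s.x - gradient (nodeAvg F τ) s.w)
  have h2 := norm_add_sq_le_young hc
    (avg fun τ => gradient (nodeAvg F τ) s.w - (step F η Q Q₁ (ω, false) s).h τ)
    (avg fun τ => gradient (nodeAvg F τ) s.x - gradient (nodeAvg F τ) s.w)
  rw [← avg_add] at h2
  have h3 := hF.norm_gradient_sub_sq_le hM hμ hz s.x s.w
  rw [hF.gradient_globalAvg, hF.gradient_globalAvg, ← avg_sub] at h3
  have h4 := hF.avgSq_gradient_sub_le hM hz s.x s.w
  set B := 4 * M * ((globalAvg F s.x - globalAvg F z) + (globalAvg F s.w - globalAvg F z))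
  have e3 : 1 / (δ₁ / (2 * p)) = 2 * p / δ₁ := by field_simp
  rw [e3] at h1 h2
  have h5 : 0 ≤ p * (1 + 2 * p / δ₁) := by positivity
  have k1 := mul_le_mul_of_nonneg_left h1 hp.le
  have k2 := mul_le_mul_of_nonneg_left h2 hp.le
  have k3 := mul_le_mul_of_nonneg_left h3 h5
  have k4 := mul_le_mul_of_nonneg_left h4 h5
  have e4 : p * (1 + δ₁ / (2 * p)) = p + δ₁ / 2 := by field_simp
  rw [mul_add, ← mul_assoc, e4, ← mul_assoc] at k1 k2
  rw [hH]
  linarith only [k1, k2, k3, k4]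

variable [MeasurableSpace S] [MeasurableSpace S₁]
  (ν : Measure S) [IsProbabilityMeasure ν] (ν₁ : Measure S₁) [IsProbabilityMeasure ν₁]

/-- The Lyapunov function decreases in expectation. -/
theorem lintegral_lyapW_step_le (hF : FiniteSumBounds F μ M Mc) (hMc : 0 < Mc)
    (hz : ∀ y, globalAvg F z ≤ globalAvg F y) (hQ : IsContractionCompressor ν Q δ)
    (hs : MeanScaled ν Q δ) (hQ₁ : IsContractionCompressor ν₁ Q₁ δ₁) (hs₁ : MeanScaled ν₁ Q₁ δ₁)
    (hb : StepBounds μ M (Mc / n) η a c₂ δ δ₁ p θ) (s : State d n) :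
    0 ≤ (1 - θ) * lyapW F z M η a c₂ δ δ₁ p s - η / 2 * (globalAvg F s.x - globalAvg F z) ∧
    ∫⁻ ξ, ENNReal.ofReal (lyapW F z M η a c₂ δ δ₁ p (step F η Q Q₁ ξ s)) ∂(noiseLaw n m ν ν₁ p)
      ≤ ENNReal.ofReal ((1 - θ) * lyapW F z M η a c₂ δ δ₁ p s
        - η / 2 * (globalAvg F s.x - globalAvg F z)) := by
  have := isProbabilityMeasure_uniformOn_univ hF.m_pos
  have hM : 0 < M := hb.mu_pos.trans_le hb.mu_le
  have hη := hb.eta_pos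
  have ha := hb.a_pos
  have hp := hb.p_pos
  have hδ := hQ.pos
  have hδ₁ := hQ₁.pos
  have hc₂ : 0 ≤ c₂ := by
    have := hb.p_le
    by_contra h
    nlinarith only [h, this, hp, hδ₁]
  have hR : 0 ≤ ckConst a c₂ := by unfold ckConst; positivity
  set cE := 24 * η * M / δ with hcE
  set cH := 2400 * η * a ^ 2 / (M * δ₁) with hcH
  set cW := 2 * ckConst a c₂ * η / p with hcW
  have hcE0 : 0 ≤ cE := by positivity
  have hcH0 : 0 ≤ cH := by positivity
  have hcW0 : 0 ≤ cW := by positivity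
  set X := globalAvg F s.x - globalAvg F z with hX
  set W := globalAvg F s.w - globalAvg F z with hW
  have hX0 : 0 ≤ X := sub_nonneg.2 (hz _)
  have hW0 : 0 ≤ W := sub_nonneg.2 (hz _)
  -- The new `x`, `e` and `h` do not depend on the coin, so the outcome `false` represents both.
  let st : (Fin n → Fin m × S × S₁) → State d n := fun ω => step F η Q Q₁ (ω, false) s
  let H1 : (Fin n → Fin m × S × S₁) → ℝ :=
    fun ω => ‖avg fun τ => gradient (nodeAvg F τ) s.w - (st ω).h τ‖ ^ 2
  let H2 : (Fin n → Fin m × S × S₁) → ℝ :=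
    fun ω => avgSq fun τ => gradient (nodeAvg F τ) s.w - (st ω).h τ
  let B : ℝ := 9 * (p * (1 + 2 * p / δ₁) * (4 * M * (X + W)))
  let g : (Fin n → Fin m × S × S₁) → ℝ := fun ω =>
    ‖virtualDist z (st ω)‖ ^ 2 + cE * (‖avg (st ω).e‖ ^ 2 + 16 * avgSq (st ω).e)
      + cH * ((1 + δ₁ / 2) * (H1 ω + 8 * H2 ω) + B) + cW * (p * X + (1 - p) * W)
  have hcoin : ∀ ω, ENNReal.ofReal p * ENNReal.ofReal (lyap F z cE cH cW (step F η Q Q₁ (ω, true) s))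
      + ENNReal.ofReal (1 - p) * ENNReal.ofReal (lyap F z cE cH cW (step F η Q Q₁ (ω, false) s))
      ≤ ENNReal.ofReal (g ω) := by
    intro ω
    have h1p : 0 ≤ 1 - p := by linarith [hb.p_le_one]
    have hL := fun u => lyap_nonneg hz hcE0 hcH0 hcW0 (step F η Q Q₁ (ω, u) s)
    rw [← ENNReal.ofReal_mul hp.le, ← ENNReal.ofReal_mul h1p,
      ← ENNReal.ofReal_add (mul_nonneg hp.le (hL true)) (mul_nonneg h1p (hL false))]
    refine ENNReal.ofReal_le_ofReal ?_
    have h1 := hF.shiftErr_coin_le (η := η) (Q := Q) (Q₁ := Q₁) hM hb.mu_pos.le hz hp hδ₁ s ω _ rfl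
    have h2 := mul_le_mul_of_nonneg_left h1 hcH0
    have e1 : virtualDist z (step F η Q Q₁ (ω, true) s) = virtualDist z (st ω) := rfl
    have e2 : (step F η Q Q₁ (ω, true) s).e = (st ω).e := rfl
    have e3 : (step F η Q Q₁ (ω, true) s).w = s.x := rfl
    have e4 : (step F η Q Q₁ (ω, false) s).w = s.w := rfl
    simp only [lyap, e1, e2, e3, e4, g]
    change p * (_ + _ + _ + cW * X) + (1 - p) * (_ + _ + _ + cW * W) ≤ _
    change cH * _ ≤ cH * ((1 + δ₁ / 2) * (H1 ω + 8 * H2 ω) + B) at h2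
    linarith
  obtain ⟨ix, mx⟩ := step_x_moments (η := η) (Q := Q) (Q₁ := Q₁) ν ν₁ hF z s false
  obtain ⟨ie1, ie2, me1, me2⟩ := step_e_moments (η := η) (Q₁ := Q₁) ν ν₁ hF hQ hs s false
  obtain ⟨ih1, ih2, mh1, mh2⟩ := step_h_moments (η := η) (Q := Q) ν ν₁ hF hQ₁ hs₁ s false
  have iE : Integrable (fun ω => cE * (‖avg (st ω).e‖ ^ 2 + 16 * avgSq (st ω).e))
    (nodesLaw ν ν₁ n m) := (ie1.add (ie2.const_mul 16)).const_mul cE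
  have iH' : Integrable (fun ω => (1 + δ₁ / 2) * (H1 ω + 8 * H2 ω)) (nodesLaw ν ν₁ n m) :=
    (ih1.add (ih2.const_mul 8)).const_mul _
  have iH : Integrable (fun ω => cH * ((1 + δ₁ / 2) * (H1 ω + 8 * H2 ω) + B))
    (nodesLaw ν ν₁ n m) := (iH'.add (integrable_const B)).const_mul cH
  have ixE : Integrable (fun ω => ‖virtualDist z (st ω)‖ ^ 2
      + cE * (‖avg (st ω).e‖ ^ 2 + 16 * avgSq (st ω).e)) (nodesLaw ν ν₁ n m) := ix.add iE
  have ixEH : Integrable (fun ω => ‖virtualDist z (st ω)‖ ^ 2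
      + cE * (‖avg (st ω).e‖ ^ 2 + 16 * avgSq (st ω).e)
      + cH * ((1 + δ₁ / 2) * (H1 ω + 8 * H2 ω) + B)) (nodesLaw ν ν₁ n m) := ixE.add iH
  have ig : Integrable g (nodesLaw ν ν₁ n m) := ixEH.add (integrable_const _)
  have hg0 : ∀ ω, 0 ≤ g ω := by
    intro ω
    have h1 := avgSq_nonneg (st ω).e
    have h2 : 0 ≤ H2 ω := avgSq_nonneg _
    have h3 : 0 ≤ 1 - p := by linarith [hb.p_le_one]
    simp only [g, H1, B]
    positivity
  have hint : ∫ ω, g ω ∂(nodesLaw ν ν₁ n m)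
      = ∫ ω, ‖virtualDist z (st ω)‖ ^ 2 ∂(nodesLaw ν ν₁ n m)
        + cE * (∫ ω, ‖avg (st ω).e‖ ^ 2 ∂(nodesLaw ν ν₁ n m)
          + 16 * ∫ ω, avgSq (st ω).e ∂(nodesLaw ν ν₁ n m))
        + cH * ((1 + δ₁ / 2) * (∫ ω, H1 ω ∂(nodesLaw ν ν₁ n m)
          + 8 * ∫ ω, H2 ω ∂(nodesLaw ν ν₁ n m)) + B) + cW * (p * X + (1 - p) * W) := by
    simp only [g]
    rw [integral_add ixEH (integrable_const _), integral_add ixE iH,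
      integral_add ix iE, integral_const_mul, integral_add ie1 (ie2.const_mul 16),
      integral_const_mul, integral_const_mul, integral_add iH' (integrable_const B),
      integral_const_mul, integral_add ih1 (ih2.const_mul 8), integral_const_mul]
    simp only [integral_const, probReal_univ, smul_eq_mul, one_mul, H1, H2, st]
  have hfinal : ∫ ω, g ω ∂(nodesLaw ν ν₁ n m)
      ≤ (1 - θ) * lyapW F z M η a c₂ δ δ₁ p s - η / 2 * X := by
    have hN := norm_add_sq_le_young hδ (avg s.e) (η • avg (drift F s))
    rw [norm_smul η, mul_pow, Real.norm_eq_abs, sq_abs, add_comm (avg s.e)] at hN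
    have hA1 := avgSq_add_le_young one_pos s.e (fun τ => η • drift F s τ)
    have hA2 := avgSq_add_le_young (half_pos hδ) s.e (fun τ => η • drift F s τ)
    have e5 : (fun τ => s.e τ + η • drift F s τ) = fun τ => η • drift F s τ + s.e τ :=
      funext fun τ => add_comm _ _
    rw [avgSq_smul, e5] at hA1 hA2
    have e6 : 1 / (δ / 2) = 2 / δ := by field_simp
    rw [e6] at hA2
    have hA1' : avgSq (fun τ => η • drift F s τ + s.e τ)
        ≤ 2 * avgSq s.e + 2 * (η ^ 2 * avgSq (drift F s)) := by linarith only [hA1]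
    have hE := error_recursion hδ hQ.le_one (sq_nonneg ‖avg s.e‖) (avgSq_nonneg s.e)
      (sq_nonneg ‖avg (drift F s)‖) (avgSq_nonneg (drift F s)) hN hA1' hA2 me1 me2
    have hH := shift_recursion hδ₁ hQ₁.le_one (sq_nonneg ‖avg (shiftErr F s)‖)
      (avgSq_nonneg (shiftErr F s)) mh1 mh2
    have hE' := mul_le_mul_of_nonneg_left hE hcE0
    have hH' := mul_le_mul_of_nonneg_left (add_le_add_left hH B) hcH0
    have hx := hF.norm_virtualDist_sub_sq_le hM hb.mu_pos.le hb.mu_le hz hη.le s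
    have hrec := lyapunov_recursion (ℓ := Mc / n) hM hη ha hδ hQ.le_one hδ₁ hp hb.p_le hb.eta_M
      hb.eta_l hb.eta_delta hb.small hb.theta_le_mu hb.theta_le_delta hb.theta_le_delta₁
      hb.theta_le_p (sq_nonneg ‖virtualDist z s‖) hX0 hW0 (sq_nonneg ‖avg s.e‖) (avgSq_nonneg s.e)
      (sq_nonneg ‖avg (shiftErr F s)‖) (avgSq_nonneg (shiftErr F s))
      (hF.norm_avg_drift_sq_le hM hb.mu_pos.le hz s) (hF.avgSq_drift_le hM hz s)
      (hF.avg_sampleVar_le hMc hz s)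
    rw [hint, mx]
    refine le_trans ?_ hrec
    refine add_le_add (add_le_add (add_le_add ?_ hE') hH') le_rfl
    exact add_le_add hx le_rfl
  refine ⟨(integral_nonneg hg0).trans hfinal, ?_⟩
  -- The one-sided Tonelli inequality needs no measurability of the integrand; integrability is only
  -- used for the majorant `g`.
  calc ∫⁻ ξ, ENNReal.ofReal (lyap F z cE cH cW (step F η Q Q₁ ξ s)) ∂(noiseLaw n m ν ν₁ p)
      ≤ ∫⁻ ω, ∫⁻ u, ENNReal.ofReal (lyap F z cE cH cW (step F η Q Q₁ (ω, u) s))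
        ∂(ENNReal.ofReal p • Measure.dirac true + ENNReal.ofReal (1 - p) • Measure.dirac false)
        ∂(nodesLaw ν ν₁ n m) := lintegral_prod_le _
    _ ≤ ∫⁻ ω, ENNReal.ofReal (g ω) ∂(nodesLaw ν ν₁ n m) :=
      lintegral_mono fun ω => by rw [lintegral_coin]; exact hcoin ω
    _ = ENNReal.ofReal (∫ ω, g ω ∂(nodesLaw ν ν₁ n m)) :=
      (ofReal_integral_eq_lintegral_ofReal ig (Filter.Eventually.of_forall hg0)).symm
    _ ≤ _ := ENNReal.ofReal_le_ofReal hfinal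

end Lyapunov

/-! ### Measurability and independence -/

section Measurability

variable {d n m : ℕ} {S S₁ : Type*} [MeasurableSpace S] [MeasurableSpace S₁]

lemma measurable_gradient (f : Vec d → ℝ) : Measurable (gradient f) :=
  (InnerProductSpace.toDual ℝ (Vec d)).symm.continuous.measurable.comp (measurable_fderiv ℝ f)

instance instMeasurableSpaceState : MeasurableSpace (State d n) :=
  MeasurableSpace.comap (fun s => (s.x, s.w, s.e, s.h)) inferInstance

lemma measurable_state_iff {A : Type*} [MeasurableSpace A] {f : A → State d n} :
    Measurable f ↔ Measurable (fun a => (f a).x) ∧ Measurable (fun a => (f a).w) ∧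
      (∀ τ, Measurable fun a => (f a).e τ) ∧ ∀ τ, Measurable fun a => (f a).h τ := by
  rw [measurable_comap_iff]
  constructor
  · intro h
    have h1 : Measurable fun a => ((f a).x, (f a).w, (f a).e, (f a).h) := h
    exact ⟨h1.fst, h1.snd.fst, fun τ => (measurable_pi_apply τ).comp h1.snd.snd.fst,
      fun τ => (measurable_pi_apply τ).comp h1.snd.snd.snd⟩
  · rintro ⟨h1, h2, h3, h4⟩
    exact h1.prodMk (h2.prodMk ((measurable_pi_lambda _ h3).prodMk (measurable_pi_lambda _ h4)))

lemma measurable_state_x : Measurable (fun s : State d n => s.x) :=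
  (measurable_state_iff.1 measurable_id).1

lemma measurable_state_w : Measurable (fun s : State d n => s.w) :=
  (measurable_state_iff.1 measurable_id).2.1

lemma measurable_state_e (τ : Fin n) : Measurable (fun s : State d n => s.e τ) :=
  (measurable_state_iff.1 measurable_id).2.2.1 τ

lemma measurable_state_h (τ : Fin n) : Measurable (fun s : State d n => s.h τ) :=
  (measurable_state_iff.1 measurable_id).2.2.2 τ

variable {Par : Type*} [MeasurableSpace Par]

/-- Joint measurability of the gradients of a parametrized family of losses. -/
structure MeasurableGrads (F : Par → Fin n → Fin m → Vec d → ℝ) : Prop where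
  component : ∀ τ i, Measurable fun q : Par × Vec d => gradient (F q.1 τ i) q.2
  node : ∀ τ, Measurable fun q : Par × Vec d => gradient (nodeAvg (F q.1) τ) q.2

lemma measurableGrads_const (F : Fin n → Fin m → Vec d → ℝ) :
    MeasurableGrads fun _ : Par => F :=
  ⟨fun _ _ => (measurable_gradient _).comp measurable_snd,
    fun _ => (measurable_gradient _).comp measurable_snd⟩

variable {F : Par → Fin n → Fin m → Vec d → ℝ} {Q : S → Vec d → Vec d} {Q₁ : S₁ → Vec d → Vec d}
  {η : ℝ}

/-- The parameter is the prox-center, which is random along the outer iterations, so measurability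
has to be joint in center, noise and state. -/
lemma measurable_step (hF : MeasurableGrads F) (hQ : Measurable (Function.uncurry Q))
    (hQ₁ : Measurable (Function.uncurry Q₁)) :
    Measurable fun q : Par × Noise n m S S₁ × State d n => step (F q.1) η Q Q₁ q.2.1 q.2.2 := by
  have hpar : Measurable fun q : Par × Noise n m S S₁ × State d n => q.1 := measurable_fst
  have hξ : Measurable fun q : Par × Noise n m S S₁ × State d n => q.2.1 :=
    measurable_snd.fst
  have hs : Measurable fun q : Par × Noise n m S S₁ × State d n => q.2.2 := measurable_snd.snd
  have hx := measurable_state_x.comp hs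
  have hw := measurable_state_w.comp hs
  have he := fun τ => (measurable_state_e τ).comp hs
  have hh := fun τ => (measurable_state_h τ).comp hs
  have hnode : ∀ τ, Measurable fun q : Par × Noise n m S S₁ × State d n => q.2.1.1 τ :=
    fun τ => (measurable_pi_apply τ).comp hξ.fst
  have hgrad : ∀ (g : Par × Noise n m S S₁ × State d n → Vec d), Measurable g → ∀ τ,
      Measurable fun q => gradient (F q.1 τ (q.2.1.1 τ).1) (g q) := by
    intro g hg τ
    have h1 : Measurable fun r : Fin m × (Par × Vec d) => gradient (F r.2.1 τ r.1) r.2.2 :=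
      measurable_from_prod_countable_right fun i => hF.component τ i
    exact h1.comp ((hnode τ).fst.prodMk (hpar.prodMk hg))
  have hloc : ∀ τ, Measurable fun q : Par × Noise n m S S₁ × State d n =>
      localGrad (F q.1) q.2.2 τ (q.2.1.1 τ).1 := fun τ =>
    (((hgrad _ hx τ).sub (hgrad _ hw τ)).add ((hF.node τ).comp (hpar.prodMk hw))).sub (hh τ)
  have hY : ∀ τ, Measurable fun q : Par × Noise n m S S₁ × State d n =>
      msgY (F q.1) η Q q.2.2 q.2.1 τ := fun τ =>
    hQ.comp ((hnode τ).snd.fst.prodMk (((hloc τ).const_smul η).add (he τ)))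
  have hZ : ∀ τ, Measurable fun q : Par × Noise n m S S₁ × State d n =>
      msgZ (F q.1) Q₁ q.2.2 q.2.1 τ := fun τ =>
    hQ₁.comp ((hnode τ).snd.snd.prodMk (((hF.node τ).comp (hpar.prodMk hw)).sub (hh τ)))
  have hsumY : Measurable fun q : Par × Noise n m S S₁ × State d n =>
      ∑ τ, msgY (F q.1) η Q q.2.2 q.2.1 τ := Finset.measurable_fun_sum _ fun τ _ => hY τ
  have hsumh : Measurable fun q : Par × Noise n m S S₁ × State d n => ∑ τ, q.2.2.h τ :=
    Finset.measurable_fun_sum _ fun τ _ => hh τ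
  have hx' : Measurable fun q : Par × Noise n m S S₁ × State d n =>
      q.2.2.x - ((1 / (n : ℝ)) • ∑ τ, msgY (F q.1) η Q q.2.2 q.2.1 τ
        + η • ((1 / (n : ℝ)) • ∑ τ, q.2.2.h τ)) :=
    hx.sub ((hsumY.const_smul (1 / (n : ℝ))).add ((hsumh.const_smul (1 / (n : ℝ))).const_smul η))
  refine measurable_state_iff.2 ⟨hx', ?_, fun τ => ?_, fun τ => ?_⟩
  · exact Measurable.ite (measurableSet_eq_fun hξ.snd measurable_const) hx hw
  · exact ((he τ).add ((hloc τ).const_smul η)).sub (hY τ)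
  · exact (hh τ).add (hZ τ)

lemma measurable_run {A : Type*} [MeasurableSpace A] (hF : MeasurableGrads F)
    (hQ : Measurable (Function.uncurry Q)) (hQ₁ : Measurable (Function.uncurry Q₁)) {par : A → Par}
    {s : A → State d n} {ξ : A → ℕ → Noise n m S S₁} (hpar : Measurable par) (hs : Measurable s)
    (hξ : Measurable ξ) (K : ℕ) : Measurable fun a => run (F (par a)) η Q Q₁ (s a) (ξ a) K := by
  induction K with
  | zero => exact hs
  | succ K ih =>
    exact (measurable_step hF hQ hQ₁).comp
      (hpar.prodMk (((measurable_pi_apply K).comp hξ).prodMk ih))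

end Measurability

section Independence

variable {Ω : Type*}

lemma measurable_biSup_comap {ι N : Type*} [MeasurableSpace N] {ξ : ι → Ω → N} {I : Set ι}
    {i : ι} (hi : i ∈ I) :
    Measurable[⨆ i ∈ I, MeasurableSpace.comap (ξ i) inferInstance] (ξ i) :=
  Measurable.of_comap_le (le_biSup (fun i => MeasurableSpace.comap (ξ i) inferInstance) hi)

variable [MeasurableSpace Ω] {μ : Measure Ω}

/-- Functions of disjoint subfamilies of an independent family are independent. -/
lemma indepFun_of_disjoint {ι N A B : Type*} [MeasurableSpace N] [MeasurableSpace A]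
    [MeasurableSpace B] {ξ : ι → Ω → N} (hξ : ∀ i, Measurable (ξ i)) (h : iIndepFun ξ μ)
    {I J : Set ι} (hIJ : Disjoint I J) {f : Ω → A} {g : Ω → B}
    (hf : Measurable[⨆ i ∈ I, MeasurableSpace.comap (ξ i) inferInstance] f)
    (hg : Measurable[⨆ i ∈ J, MeasurableSpace.comap (ξ i) inferInstance] g) :
    IndepFun f g μ := by
  have h1 := indep_iSup_of_disjoint (fun i => (hξ i).comap_le) ((iIndepFun_iff_iIndep _ _ _).1 h)
    hIJ
  exact (IndepFun_iff_Indep _ _ _).2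
    (indep_of_indep_of_le_left (indep_of_indep_of_le_right h1 hg.comap_le) hf.comap_le)

/-- The expectation of a function of two independent variables as an iterated expectation. -/
lemma lintegral_indepFun [IsProbabilityMeasure μ] {A B : Type*} [MeasurableSpace A]
    [MeasurableSpace B] {f : Ω → A} {g : Ω → B} (hf : Measurable f) (hg : Measurable g)
    (h : IndepFun f g μ) {Φ : A × B → ℝ≥0∞} (hΦ : Measurable Φ) :
    ∫⁻ ω, Φ (f ω, g ω) ∂μ = ∫⁻ ω, ∫⁻ ω', Φ (f ω, g ω') ∂μ ∂μ := by
  have := Measure.isProbabilityMeasure_map (μ := μ) hf.aemeasurable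
  have := Measure.isProbabilityMeasure_map (μ := μ) hg.aemeasurable
  rw [← lintegral_map hΦ (hf.prodMk hg),
    (indepFun_iff_map_prod_eq_prod_map_map hf.aemeasurable hg.aemeasurable).1 h,
    lintegral_prod _ hΦ.aemeasurable, lintegral_map hΦ.lintegral_prod_right' hf]
  refine lintegral_congr fun ω => ?_
  rw [lintegral_map (f := fun b => Φ (f ω, b)) (hΦ.comp measurable_prodMk_left) hg]

end Independence

/-! ### Convergence of EC-LSVRG from a fixed state -/

section Convergence

variable {d n m : ℕ} {S S₁ Ω : Type*} [MeasurableSpace S] [MeasurableSpace S₁]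
  (ν : Measure S) (ν₁ : Measure S₁) {Q : S → Vec d → Vec d} {Q₁ : S₁ → Vec d → Vec d}
  {F : Fin n → Fin m → Vec d → ℝ} {μ M Mc η a c₂ δ δ₁ p θ : ℝ} {z : Vec d}
  {ζ : ℕ → Ω → Noise n m S S₁}

lemma measurable_step_const (hQ : Measurable (Function.uncurry Q))
    (hQ₁ : Measurable (Function.uncurry Q₁)) :
    Measurable fun q : Noise n m S S₁ × State d n => step F η Q Q₁ q.1 q.2 :=
  (measurable_step (measurableGrads_const (Par := Unit) F) hQ hQ₁).comp
    (measurable_const.prodMk measurable_id : Measurable fun q => ((), q))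

/-- The state before iteration `K` uses only the noise with index below `K`. Recording this
σ-algebra is what gives independence from `ζ K`. -/
lemma measurable_run_past (hQ : Measurable (Function.uncurry Q))
    (hQ₁ : Measurable (Function.uncurry Q₁)) (s₀ : State d n) (K : ℕ) :
    Measurable[⨆ i ∈ Set.Iio K, MeasurableSpace.comap (ζ i) inferInstance]
      fun ω => run F η Q Q₁ s₀ (fun j => ζ j ω) K := by
  induction K with
  | zero => exact @measurable_const _ _ _ (_) _
  | succ K ih =>
    have h1 : Measurable[⨆ i ∈ Set.Iio (K + 1), MeasurableSpace.comap (ζ i) inferInstance]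
        fun ω => run F η Q Q₁ s₀ (fun j => ζ j ω) K :=
      ih.mono (biSup_mono fun i hi => lt_trans hi (Nat.lt_succ_self K)) le_rfl
    have h2 : Measurable[⨆ i ∈ Set.Iio (K + 1), MeasurableSpace.comap (ζ i) inferInstance] (ζ K) :=
      measurable_biSup_comap (Nat.lt_succ_self K)
    exact (measurable_step_const hQ hQ₁).comp (@Measurable.prodMk _ _ _ _ _ (_) _ _ h2 h1)

variable [MeasurableSpace Ω] {P : Measure Ω} [IsProbabilityMeasure P]

lemma measurable_run_fixed (hQ : Measurable (Function.uncurry Q))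
    (hQ₁ : Measurable (Function.uncurry Q₁)) (hζ : ∀ K, Measurable (ζ K)) (s₀ : State d n) (K : ℕ) :
    Measurable fun ω => run F η Q Q₁ s₀ (fun j => ζ j ω) K :=
  (measurable_run_past hQ hQ₁ s₀ K).mono
    (iSup₂_le fun i _ => (hζ i).comap_le) le_rfl

lemma lintegral_run_succ (hQ : Measurable (Function.uncurry Q))
    (hQ₁ : Measurable (Function.uncurry Q₁)) (hζ : ∀ K, Measurable (ζ K))
    (hlaw : ∀ K, P.map (ζ K) = noiseLaw n m ν ν₁ p) (hind : iIndepFun ζ P) (s₀ : State d n)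
    (K : ℕ) {V : State d n → ℝ≥0∞} (hV : Measurable V) :
    ∫⁻ ω, V (run F η Q Q₁ s₀ (fun j => ζ j ω) (K + 1)) ∂P
      = ∫⁻ ω, ∫⁻ ξ, V (step F η Q Q₁ ξ (run F η Q Q₁ s₀ (fun j => ζ j ω) K))
        ∂(noiseLaw n m ν ν₁ p) ∂P := by
  have hstep := measurable_step_const (F := F) (η := η) hQ hQ₁
  have hi : IndepFun (fun ω => run F η Q Q₁ s₀ (fun j => ζ j ω) K) (ζ K) P :=
    indepFun_of_disjoint hζ hind (I := Set.Iio K) (J := {K}) (by simp)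
      (measurable_run_past hQ hQ₁ s₀ K) (measurable_biSup_comap rfl)
  have h := lintegral_indepFun (measurable_run_fixed hQ hQ₁ hζ s₀ K) (hζ K) hi
    (Φ := fun q => V (step F η Q Q₁ q.2 q.1)) (hV.comp (hstep.comp measurable_swap))
  refine h.trans (lintegral_congr fun ω => ?_)
  rw [← hlaw K, lintegral_map
    (f := fun ξ => V (step F η Q Q₁ ξ (run F η Q Q₁ s₀ (fun j => ζ j ω) K)))
    (hV.comp (hstep.comp measurable_prodMk_right)) (hζ K)]

lemma measurable_avg {A : Type*} [MeasurableSpace A] {v : A → Fin n → Vec d}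
    (hv : ∀ τ, Measurable fun a => v a τ) : Measurable fun a => avg (v a) :=
  (Finset.measurable_fun_sum _ fun τ _ => hv τ).const_smul (1 / (n : ℝ))

lemma measurable_avgSq {A : Type*} [MeasurableSpace A] {v : A → Fin n → Vec d}
    (hv : ∀ τ, Measurable fun a => v a τ) : Measurable fun a => avgSq (v a) :=
  (Finset.measurable_fun_sum _ fun τ _ => ((hv τ).norm.pow_const 2)).const_mul _

lemma measurable_lyap (hc : Measurable (globalAvg F)) (cE cH cW : ℝ) :
    Measurable (lyap F z cE cH cW) := by
  have hs : ∀ τ, Measurable fun s : State d n => shiftErr F s τ := fun τ =>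
    ((measurable_gradient _).comp measurable_state_w).sub (measurable_state_h τ)
  have h1 : Measurable fun s : State d n => virtualDist z s :=
    (measurable_state_x.sub (measurable_avg measurable_state_e)).sub_const z
  exact (((h1.norm.pow_const 2).add ((((measurable_avg measurable_state_e).norm.pow_const 2).add
    ((measurable_avgSq measurable_state_e).const_mul 16)).const_mul cE)).add
    ((((measurable_avg hs).norm.pow_const 2).add
    ((measurable_avgSq hs).const_mul 8)).const_mul cH)).add
    (((hc.comp measurable_state_w).sub_const _).const_mul cW)

variable [IsProbabilityMeasure ν] [IsProbabilityMeasure ν₁]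

/-- The weighted sum of the expected function gaps is bounded by the initial Lyapunov value. -/
lemma sum_lintegral_gap_le (hF : FiniteSumBounds F μ M Mc) (hMc : 0 < Mc)
    (hz : ∀ y, globalAvg F z ≤ globalAvg F y) (hQ : IsContractionCompressor ν Q δ)
    (hs : MeanScaled ν Q δ) (hQ₁ : IsContractionCompressor ν₁ Q₁ δ₁) (hs₁ : MeanScaled ν₁ Q₁ δ₁)
    (hb : StepBounds μ M (Mc / n) η a c₂ δ δ₁ p θ) (hζ : ∀ K, Measurable (ζ K))
    (hlaw : ∀ K, P.map (ζ K) = noiseLaw n m ν ν₁ p) (hind : iIndepFun ζ P) (s₀ : State d n)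
    (K : ℕ) :
    ∑ j ∈ Finset.range (K + 1), ENNReal.ofReal ((1 - θ) ^ (K - j)) *
        ∫⁻ ω, ENNReal.ofReal (η / 2 * (globalAvg F (run F η Q Q₁ s₀ (fun j => ζ j ω) j).x
          - globalAvg F z)) ∂P
      + ∫⁻ ω, ENNReal.ofReal (lyapW F z M η a c₂ δ δ₁ p
          (run F η Q Q₁ s₀ (fun j => ζ j ω) (K + 1))) ∂P
      ≤ ENNReal.ofReal ((1 - θ) ^ (K + 1) * lyapW F z M η a c₂ δ δ₁ p s₀) := by
  have hc : Measurable (globalAvg F) := hF.global.1.continuous.measurable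
  have hθ : 0 ≤ 1 - θ := by linarith [hb.theta_le_p, hb.p_le_one]
  have hVm : Measurable fun s => ENNReal.ofReal (lyapW F z M η a c₂ δ δ₁ p s) :=
    (measurable_lyap hc _ _ _).ennreal_ofReal
  have hXm : ∀ j, Measurable fun ω => ENNReal.ofReal (η / 2 *
      (globalAvg F (run F η Q Q₁ s₀ (fun j => ζ j ω) j).x - globalAvg F z)) := fun j =>
    (((hc.comp (measurable_state_x.comp (measurable_run_fixed hQ.measurable hQ₁.measurable hζ
      s₀ j))).sub_const _).const_mul _).ennreal_ofReal
  have hstep : ∀ j, ∫⁻ ω, ENNReal.ofReal (η / 2 *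
        (globalAvg F (run F η Q Q₁ s₀ (fun j => ζ j ω) j).x - globalAvg F z)) ∂P
      + ∫⁻ ω, ENNReal.ofReal (lyapW F z M η a c₂ δ δ₁ p
          (run F η Q Q₁ s₀ (fun j => ζ j ω) (j + 1))) ∂P
      ≤ ENNReal.ofReal (1 - θ) * ∫⁻ ω, ENNReal.ofReal (lyapW F z M η a c₂ δ δ₁ p
          (run F η Q Q₁ s₀ (fun j => ζ j ω) j)) ∂P := by
    intro j
    rw [lintegral_run_succ ν ν₁ hQ.measurable hQ₁.measurable hζ hlaw hind s₀ j hVm,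
      ← lintegral_add_left (hXm j), ← lintegral_const_mul' _ _ ENNReal.ofReal_ne_top]
    refine lintegral_mono fun ω => ?_
    obtain ⟨h0, h1⟩ := lintegral_lyapW_step_le ν ν₁ hF hMc hz hQ hs hQ₁ hs₁ hb
      (run F η Q Q₁ s₀ (fun j => ζ j ω) j)
    refine (add_le_add_right h1 _).trans ?_
    rw [← ENNReal.ofReal_add (mul_nonneg (half_pos hb.eta_pos).le (sub_nonneg.2 (hz _))) h0,
      ← ENNReal.ofReal_mul hθ]
    exact ENNReal.ofReal_le_ofReal (by linarith)
  induction K with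
  | zero =>
    refine le_trans ?_ ((hstep 0).trans (le_of_eq ?_))
    · simp
    · simp [run, ENNReal.ofReal_mul hθ]
  | succ K ih =>
    have h1 := hstep (K + 1)
    have h2 : ∑ j ∈ Finset.range (K + 1), ENNReal.ofReal ((1 - θ) ^ (K + 1 - j)) *
        ∫⁻ ω, ENNReal.ofReal (η / 2 * (globalAvg F (run F η Q Q₁ s₀ (fun j => ζ j ω) j).x
          - globalAvg F z)) ∂P
        = ENNReal.ofReal (1 - θ) * ∑ j ∈ Finset.range (K + 1), ENNReal.ofReal ((1 - θ) ^ (K - j)) *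
        ∫⁻ ω, ENNReal.ofReal (η / 2 * (globalAvg F (run F η Q Q₁ s₀ (fun j => ζ j ω) j).x
          - globalAvg F z)) ∂P := by
      rw [Finset.mul_sum]
      refine Finset.sum_congr rfl fun j hj => ?_
      have hj' : j ≤ K := Nat.lt_succ_iff.1 (Finset.mem_range.1 hj)
      rw [Nat.succ_sub hj', pow_succ', ENNReal.ofReal_mul hθ, mul_assoc]
    rw [Finset.sum_range_succ, h2, Nat.sub_self, pow_zero, ENNReal.ofReal_one, one_mul, add_assoc]
    refine (add_le_add_right h1 _).trans ?_
    rw [← mul_add, pow_succ', mul_assoc, ENNReal.ofReal_mul hθ]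
    exact mul_le_mul_right ih _

/-- Jensen's inequality for the weighted average. -/
lemma weightedAvg_gap_le {f : Vec d → ℝ} (hf : QuadBounds 0 M f) (hθ : θ < 1) (x : ℕ → Vec d)
    (c : ℝ) (K : ℕ) :
    (∑ j ∈ Finset.range (K + 1), (1 - θ) ^ j) * (f (weightedAvg θ x K) - c)
      ≤ ∑ j ∈ Finset.range (K + 1), (1 - θ) ^ (K - j) * (f (x j) - c) := by
  have hq : 0 < 1 - θ := by linarith
  set xb := weightedAvg θ x K with hxb
  set T := ∑ j ∈ Finset.range (K + 1), ((1 - θ) ^ j)⁻¹ with hT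
  have hTpos : 0 < T := Finset.sum_pos (fun j _ => by positivity) ⟨0, by simp⟩
  have hw : ∀ j ∈ Finset.range (K + 1), (1 - θ) ^ (K - j) = (1 - θ) ^ K * ((1 - θ) ^ j)⁻¹ := by
    intro j hj
    rw [pow_sub₀ _ hq.ne' (Nat.lt_succ_iff.1 (Finset.mem_range.1 hj))]
  have hsum : ∑ j ∈ Finset.range (K + 1), (1 - θ) ^ j = (1 - θ) ^ K * T := by
    rw [hT, Finset.mul_sum, ← Finset.sum_range_reflect]
    refine Finset.sum_congr rfl fun j hj => ?_
    rw [← hw j hj]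
    congr 1
  have hmean : ∑ j ∈ Finset.range (K + 1), ((1 - θ) ^ j)⁻¹ • (x j - xb) = 0 := by
    simp_rw [smul_sub, Finset.sum_sub_distrib]
    rw [← Finset.sum_smul, ← hT, hxb, weightedAvg, ← hT, smul_smul, mul_inv_cancel₀ hTpos.ne',
      one_smul, sub_self]
  -- Supporting hyperplane at the average itself: the linear terms cancel in the weighted sum.
  have hlow : ∀ j, f xb + inner ℝ (gradient f xb) (x j - xb) ≤ f (x j) := fun j => by
    have h := (hf.2 (x j) xb).1
    simp only [bregman] at h
    linarith
  have h1 : ∑ j ∈ Finset.range (K + 1), ((1 - θ) ^ j)⁻¹ *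
      (f xb - c + inner ℝ (gradient f xb) (x j - xb))
      ≤ ∑ j ∈ Finset.range (K + 1), ((1 - θ) ^ j)⁻¹ * (f (x j) - c) :=
    Finset.sum_le_sum fun j _ => mul_le_mul_of_nonneg_left (by linarith [hlow j]) (by positivity)
  have h2 : ∑ j ∈ Finset.range (K + 1), ((1 - θ) ^ j)⁻¹ *
      (f xb - c + inner ℝ (gradient f xb) (x j - xb)) = T * (f xb - c) := by
    simp_rw [mul_add]
    rw [Finset.sum_add_distrib, ← Finset.sum_mul]
    simp_rw [← inner_smul_right (𝕜 := ℝ)]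
    rw [← inner_sum, hmean, inner_zero_right, add_zero]
  rw [hsum, Finset.sum_congr rfl fun j hj => by rw [hw j hj]]
  simp_rw [mul_assoc]
  rw [← Finset.mul_sum]
  rw [h2] at h1
  exact mul_le_mul_of_nonneg_left h1 (by positivity)

/-- Linear convergence of the averaged iterates of EC-LSVRG, after a burn-in period. -/
theorem lintegral_weightedAvg_gap_le (hF : FiniteSumBounds F μ M Mc) (hMc : 0 < Mc)
    (hz : ∀ y, globalAvg F z ≤ globalAvg F y) (hQ : IsContractionCompressor ν Q δ)
    (hs : MeanScaled ν Q δ) (hQ₁ : IsContractionCompressor ν₁ Q₁ δ₁) (hs₁ : MeanScaled ν₁ Q₁ δ₁)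
    (hb : StepBounds μ M (Mc / n) η a c₂ δ δ₁ p θ) (hζ : ∀ K, Measurable (ζ K))
    (hlaw : ∀ K, P.map (ζ K) = noiseLaw n m ν ν₁ p) (hind : iIndepFun ζ P) (s₀ : State d n)
    (hw : s₀.w = s₀.x) (he : ∀ τ, s₀.e τ = 0) (hh : ∀ τ, s₀.h τ = gradient (nodeAvg F τ) s₀.x)
    (K : ℕ) (hK : (1 - θ) ^ (K + 1) ≤ 1 / 2) :
    ∫⁻ ω, ENNReal.ofReal (globalAvg F (weightedAvg θ
        (fun j => (run F η Q Q₁ s₀ (fun j => ζ j ω) j).x) K) - globalAvg F z) ∂P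
      ≤ ENNReal.ofReal (5 * (1 - θ) ^ (K + 1) * (globalAvg F s₀.x - globalAvg F z)) := by
  have hθ1 : θ < 1 := by linarith [hb.theta_le_p, hb.p_le_one]
  have hθ0 := hb.theta_pos
  have hq : 0 ≤ 1 - θ := by linarith
  have hη := hb.eta_pos
  have hμ := hb.mu_pos
  have hp := hb.p_pos
  have hX0 : 0 ≤ globalAvg F s₀.x - globalAvg F z := sub_nonneg.2 (hz _)
  have hc : Measurable (globalAvg F) := hF.global.1.continuous.measurable
  have hc₂ : 0 ≤ c₂ := by
    have := hb.p_le
    by_contra h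
    nlinarith only [h, this, hp, hQ₁.pos]
  have hR : 0 ≤ ckConst a c₂ := by
    have := hb.a_pos
    unfold ckConst; positivity
  set D := ∑ j ∈ Finset.range (K + 1), (1 - θ) ^ j with hD
  -- The geometric sum is `(1 - (1 - θ)^(K+1)) / θ`; the burn-in hypothesis makes its numerator at
  -- least one half.
  have hDθ : 1 / (2 * θ) ≤ D := by
    have h1 := geom_sum_mul (1 - θ) (K + 1)
    rw [← hD] at h1
    rw [div_le_iff₀ (by positivity)]
    linarith
  have hV0 : lyapW F z M η a c₂ δ δ₁ p s₀
      ≤ (2 / μ + 2 * ckConst a c₂ * η / p) * (globalAvg F s₀.x - globalAvg F z) := by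
    have e1 : shiftErr F s₀ = fun _ => 0 := by
      ext1 τ; rw [shiftErr, hh, hw, sub_self]
    have e2 : s₀.e = fun _ => 0 := funext he
    have e3 : avg (fun _ : Fin n => (0 : Vec d)) = 0 := avg_const hF.n_pos 0
    have e4 : avgSq (fun _ : Fin n => (0 : Vec d)) = 0 := by simp [avgSq]
    have h1 := hF.global.le_of_isMin hz s₀.x
    rw [lyapW, lyap, virtualDist, e1, e2, e3, e4, hw, add_mul]
    have h2 : ‖s₀.x - z‖ ^ 2 ≤ 2 / μ * (globalAvg F s₀.x - globalAvg F z) := by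
      rw [div_mul_eq_mul_div, le_div_iff₀ hμ]
      linarith
    simp only [norm_zero, sub_zero]
    linarith
  have hmain := sum_lintegral_gap_le ν ν₁ hF hMc hz hQ hs hQ₁ hs₁ hb hζ hlaw hind s₀ K
  have hgap : ∀ j, Measurable fun ω => ENNReal.ofReal (η / 2 *
      (globalAvg F (run F η Q Q₁ s₀ (fun j => ζ j ω) j).x - globalAvg F z)) := fun j =>
    (((hc.comp (measurable_state_x.comp (measurable_run_fixed hQ.measurable hQ₁.measurable hζ
      s₀ j))).sub_const _).const_mul _).ennreal_ofReal
  have hpt : ∀ ω, ENNReal.ofReal (η / (4 * θ)) * ENNReal.ofReal (globalAvg F (weightedAvg θ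
        (fun j => (run F η Q Q₁ s₀ (fun j => ζ j ω) j).x) K) - globalAvg F z)
      ≤ ∑ j ∈ Finset.range (K + 1), ENNReal.ofReal ((1 - θ) ^ (K - j)) * ENNReal.ofReal (η / 2 *
        (globalAvg F (run F η Q Q₁ s₀ (fun j => ζ j ω) j).x - globalAvg F z)) := by
    intro ω
    have h1 := weightedAvg_gap_le (hF.global.mono_left hμ.le) hθ1
      (fun j => (run F η Q Q₁ s₀ (fun j => ζ j ω) j).x) (globalAvg F z) K
    rw [← hD] at h1
    simp_rw [← ENNReal.ofReal_mul (pow_nonneg hq _)]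
    rw [← ENNReal.ofReal_mul (by positivity), ← ENNReal.ofReal_sum_of_nonneg fun j _ =>
      mul_nonneg (pow_nonneg hq _) (mul_nonneg (half_pos hη).le (sub_nonneg.2 (hz _)))]
    refine ENNReal.ofReal_le_ofReal ?_
    have h2 : η / (4 * θ) = η / 2 * (1 / (2 * θ)) := by field_simp; norm_num
    rw [h2, mul_assoc]
    refine (mul_le_mul_of_nonneg_left ((mul_le_mul_of_nonneg_right hDθ
      (sub_nonneg.2 (hz _))).trans h1) (half_pos hη).le).trans (le_of_eq ?_)
    rw [Finset.mul_sum]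
    exact Finset.sum_congr rfl fun j _ => by ring
  have hlin : ENNReal.ofReal (η / (4 * θ)) * ∫⁻ ω, ENNReal.ofReal (globalAvg F (weightedAvg θ
        (fun j => (run F η Q Q₁ s₀ (fun j => ζ j ω) j).x) K) - globalAvg F z) ∂P
      ≤ ENNReal.ofReal ((1 - θ) ^ (K + 1) * lyapW F z M η a c₂ δ δ₁ p s₀) := by
    rw [← lintegral_const_mul' _ _ ENNReal.ofReal_ne_top]
    refine (lintegral_mono hpt).trans ?_
    rw [lintegral_finsetSum _ fun j _ => (hgap j).const_mul _]
    simp_rw [lintegral_const_mul _ (hgap _)]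
    exact le_self_add.trans hmain
  have hpos : 0 < η / (4 * θ) := by positivity
  have hne : ENNReal.ofReal (η / (4 * θ)) ≠ 0 := by simpa using hpos
  refine (ENNReal.mul_le_mul_iff_right hne ENNReal.ofReal_ne_top).1 (hlin.trans ?_)
  rw [← ENNReal.ofReal_mul hpos.le]
  refine ENNReal.ofReal_le_ofReal ?_
  refine (mul_le_mul_of_nonneg_left hV0 (pow_nonneg hq _)).trans ?_
  -- The constant `5` is `4` for the initial distance, by `θ ≤ μη/2`, plus `1` for the initial check
  -- point gap, by `θ ≤ p/4` and `ckConst ≤ 1/6`.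
  have hk : 2 / μ + 2 * ckConst a c₂ * η / p ≤ η / (4 * θ) * 5 := by
    have k1 : 2 / μ ≤ η / (4 * θ) * 4 := by
      rw [div_mul_eq_mul_div, div_le_div_iff₀ hμ (by positivity)]
      linarith [hb.theta_le_mu]
    have hR6 : ckConst a c₂ ≤ 1 / 6 := by linarith [hb.small, hb.a_pos]
    have k2 : 2 * ckConst a c₂ * η / p ≤ η / (4 * θ) := by
      rw [div_le_div_iff₀ hp (by positivity)]
      have h1 : ckConst a c₂ * (8 * θ) ≤ 1 / 6 * (8 * (p / 4)) :=
        mul_le_mul hR6 (by linarith [hb.theta_le_p]) (by positivity) (by norm_num)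
      have h2 := mul_le_mul_of_nonneg_right h1 hη.le
      nlinarith only [h2, mul_pos hη hp]
    linarith
  have hprod := mul_le_mul_of_nonneg_right hk
    (mul_nonneg (pow_nonneg hq (K + 1)) hX0)
  linarith

end Convergence

/-! ### The subproblems of Catalyst -/

section Subproblem

variable {d n m : ℕ} {S S₁ : Type*} {D : Setup d n m S S₁} {Lf Lbar L Lψ : ℝ}

lemma quadBounds_component (hA : ProblemAssumptions D.f D.ψ Lf Lbar L Lψ D.lam) (τ : Fin n)
    (i : Fin m) : QuadBounds 0 L (D.f τ i) :=
  ⟨(hA.smooth_component τ i).2.1, fun y x =>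
    ⟨by simpa using bregman_nonneg_of_convexOn (hA.smooth_component τ i).2.1 (hA.convex τ i) y x,
      (hA.smooth_component τ i).bregman_le y x⟩⟩

lemma quadBounds_reg (hA : ProblemAssumptions D.f D.ψ Lf Lbar L Lψ D.lam) :
    QuadBounds D.lam Lψ D.ψ :=
  ⟨hA.smooth_reg.2.1, fun y x => ⟨StrongConvexOn.le_bregman hA.smooth_reg.2.1 hA.strongConvex y x,
    hA.smooth_reg.bregman_le y x⟩⟩

lemma quadBounds_globalAvg (hA : ProblemAssumptions D.f D.ψ Lf Lbar L Lψ D.lam) :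
    QuadBounds 0 Lf (globalAvg D.f) := by
  refine ⟨hA.smooth_global.2.1, fun y x => ⟨?_, hA.smooth_global.bregman_le y x⟩⟩
  have h1 : bregman (globalAvg D.f) y x = (1 / (n : ℝ)) * ∑ τ, bregman (nodeAvg D.f τ) y x :=
    bregman_const_mul_sum _ (fun τ => (hA.smooth_node τ).2.1) y x
  have h2 : ∀ τ, bregman (nodeAvg D.f τ) y x = (1 / (m : ℝ)) * ∑ i, bregman (D.f τ i) y x :=
    fun τ => bregman_const_mul_sum _ (fun i => (hA.smooth_component τ i).2.1) y x
  have h3 : ∀ τ i, 0 ≤ bregman (D.f τ i) y x := fun τ i => by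
    simpa using ((quadBounds_component hA τ i).2 y x).1
  rw [h1, zero_div, zero_mul]
  refine mul_nonneg (by positivity) (Finset.sum_nonneg fun τ _ => ?_)
  rw [h2]
  exact mul_nonneg (by positivity) (Finset.sum_nonneg fun i _ => h3 τ i)

lemma quadBounds_P (hA : ProblemAssumptions D.f D.ψ Lf Lbar L Lψ D.lam) :
    QuadBounds D.lam (Lf + Lψ) D.P := by
  have h := (quadBounds_globalAvg hA).add (quadBounds_reg hA)
  rwa [zero_add] at h

lemma quadBounds_G (hA : ProblemAssumptions D.f D.ψ Lf Lbar L Lψ D.lam) (y : Vec d) :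
    QuadBounds (D.lam + D.kap) (Lf + Lψ + D.kap) (D.G y) :=
  (quadBounds_P hA).add (quadBounds_prox D.kap y)

lemma avg_add_const {k : ℕ} (hk : 0 < k) (g : Fin k → ℝ) (c : ℝ) :
    (1 / (k : ℝ)) * ∑ i, (g i + c) = (1 / (k : ℝ)) * ∑ i, g i + c := by
  have : (k : ℝ) ≠ 0 := by positivity
  rw [Finset.sum_add_distrib, mul_add]
  simp [this]

lemma globalAvg_subLoss (hn : 0 < n) (hm : 0 < m) (y : Vec d) :
    globalAvg (D.subLoss y) = D.G y := by
  ext x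
  simp only [globalAvg, nodeAvg, Setup.subLoss, Setup.G, Setup.P, add_assoc, avg_add_const hm,
    avg_add_const hn]

lemma finiteSumBounds_subLoss (hn : 0 < n) (hm : 0 < m)
    (hA : ProblemAssumptions D.f D.ψ Lf Lbar L Lψ D.lam) (hκ : 0 ≤ D.kap) (y : Vec d) :
    FiniteSumBounds (D.subLoss y) (D.lam + D.kap) (Lf + Lψ + D.kap) (L + Lψ + D.kap) where
  n_pos := hn
  m_pos := hm
  component τ i := (((quadBounds_component hA τ i).add (quadBounds_reg hA)).add
    (quadBounds_prox D.kap y)).mono_left (by linarith [hA.lam_pos])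
  global := by rw [globalAvg_subLoss hn hm]; exact quadBounds_G hA y

lemma gradient_subLoss (hA : ProblemAssumptions D.f D.ψ Lf Lbar L Lψ D.lam) (y : Vec d)
    (τ : Fin n) (i : Fin m) (x : Vec d) : gradient (D.subLoss y τ i) x
      = gradient (D.f τ i) x + gradient D.ψ x + D.kap • (x - y) := by
  have h1 := (hA.smooth_component τ i).2.1
  have h2 := hA.smooth_reg.2.1
  have h3 : Differentiable ℝ (fun x : Vec d => D.kap / 2 * ‖x - y‖ ^ 2) :=
    (quadBounds_prox D.kap y).1
  have h4 : Differentiable ℝ (fun x => D.f τ i x + D.ψ x) := h1.add h2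
  unfold Setup.subLoss
  rw [gradient_add_of_differentiable h4 h3, gradient_add_of_differentiable h1 h2,
    (hasGradientAt_prox D.kap y x).gradient]

lemma gradient_nodeAvg_subLoss (hn : 0 < n) (hm : 0 < m)
    (hA : ProblemAssumptions D.f D.ψ Lf Lbar L Lψ D.lam) (hκ : 0 ≤ D.kap) (y : Vec d)
    (τ : Fin n) (x : Vec d) : gradient (nodeAvg (D.subLoss y) τ) x
      = gradient (nodeAvg D.f τ) x + gradient D.ψ x + D.kap • (x - y) := by
  have hm' : (m : ℝ) ≠ 0 := by positivity
  have h1 : gradient (nodeAvg D.f τ) x = (1 / (m : ℝ)) • ∑ i, gradient (D.f τ i) x :=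
    gradient_const_mul_sum _ (fun i => (hA.smooth_component τ i).2.1) x
  rw [(finiteSumBounds_subLoss hn hm hA hκ y).gradient_nodeAvg, h1]
  simp_rw [gradient_subLoss hA, add_assoc]
  rw [Finset.sum_add_distrib, smul_add]
  congr 1
  simp [← Nat.cast_smul_eq_nsmul ℝ, smul_smul, hm']

lemma measurableGrads_subLoss (hn : 0 < n) (hm : 0 < m)
    (hA : ProblemAssumptions D.f D.ψ Lf Lbar L Lψ D.lam) (hκ : 0 ≤ D.kap) :
    MeasurableGrads D.subLoss := by
  constructor
  · intro τ i
    simp_rw [gradient_subLoss hA]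
    exact (((measurable_gradient _).comp measurable_snd).add
      ((measurable_gradient _).comp measurable_snd)).add
      ((measurable_snd.sub measurable_fst).const_smul D.kap)
  · intro τ
    simp_rw [gradient_nodeAvg_subLoss hn hm hA hκ]
    exact (((measurable_gradient _).comp measurable_snd).add
      ((measurable_gradient _).comp measurable_snd)).add
      ((measurable_snd.sub measurable_fst).const_smul D.kap)

lemma measurable_weightedAvg {A : Type*} [MeasurableSpace A] {θ : ℝ} {x : A → ℕ → Vec d}
    (hx : ∀ j, Measurable fun a => x a j) (K : ℕ) : Measurable fun a => weightedAvg θ (x a) K := by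
  have h1 : Measurable fun a => ∑ j ∈ Finset.range (K + 1), ((1 - θ) ^ j)⁻¹ • x a j :=
    Finset.measurable_fun_sum _ fun j _ => (hx j).const_smul ((1 - θ) ^ j)⁻¹
  exact h1.const_smul (∑ j ∈ Finset.range (K + 1), ((1 - θ) ^ j)⁻¹)⁻¹

lemma measurable_initState {A : Type*} [MeasurableSpace A] {x y : A → Vec d}
    (hx : Measurable x) (hy : Measurable y) :
    Measurable fun a => D.initState (x a) (y a) := by
  have h : ∀ τ, Measurable fun a =>
      gradient (nodeAvg D.f τ) (x a) + gradient D.ψ (x a) + D.kap • (x a - y a) := fun τ =>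
    (((measurable_gradient _).comp hx).add ((measurable_gradient _).comp hx)).add
      ((hx.sub hy).const_smul D.kap)
  exact measurable_state_iff.2 ⟨hx, hx, fun τ => measurable_const, h⟩

variable [MeasurableSpace S] [MeasurableSpace S₁] {A : Type*} [MeasurableSpace A]
  {x y : A → Vec d} {ξ : A → ℕ → Noise n m S S₁}

lemma measurable_innerAvg (hn : 0 < n) (hm : 0 < m)
    (hA : ProblemAssumptions D.f D.ψ Lf Lbar L Lψ D.lam) (hκ : 0 ≤ D.kap)
    (hQ : Measurable (Function.uncurry D.Q)) (hQ₁ : Measurable (Function.uncurry D.Q₁))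
    (hx : Measurable x) (hy : Measurable y) (hξ : Measurable ξ) (K : ℕ) :
    Measurable fun a => D.innerAvg (x a) (y a) (ξ a) K :=
  measurable_weightedAvg (fun j => (measurable_state_iff.1 (measurable_run (F := D.subLoss)
    (measurableGrads_subLoss hn hm hA hκ) hQ hQ₁ hy (measurable_initState hx hy) hξ j)).1) K

end Subproblem

/-! ### Measurability of the stopping time and of the outer step. -/

section InnerTime

variable {d n m : ℕ} {S S₁ : Type*} {D : Setup d n m S S₁} {Lf Lbar L Lψ : ℝ}

lemma Gmin_eq_of_isMin {y z : Vec d} (hz : ∀ x, D.G y z ≤ D.G y x) : D.Gmin y = D.G y z :=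
  iInf_eq_of_isMin hz

/-- An infimum over uncountably many points is measurable here because an infimum of continuous
functions, bounded below at each center, is upper semicontinuous. -/
lemma measurable_Gmin (hA : ProblemAssumptions D.f D.ψ Lf Lbar L Lψ D.lam) (hκ : 0 ≤ D.kap) :
    Measurable D.Gmin := by
  have h1 : UpperSemicontinuous D.Gmin := by
    refine upperSemicontinuous_ciInf (fun y => ?_) fun x => ?_
    · obtain ⟨z, hz⟩ := (quadBounds_G hA y).exists_isMin (by linarith [hA.lam_pos])
      exact ⟨D.G y z, by rintro _ ⟨x, rfl⟩; exact hz x⟩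
    · refine Continuous.upperSemicontinuous ?_
      unfold Setup.G
      fun_prop
  exact h1.measurable

lemma measurable_G (hA : ProblemAssumptions D.f D.ψ Lf Lbar L Lψ D.lam) :
    Measurable fun q : Vec d × Vec d => D.G q.1 q.2 := by
  have h1 : Continuous D.P := (quadBounds_P hA).1.continuous
  refine Continuous.measurable ?_
  unfold Setup.G
  fun_prop

lemma innerTime_eq_coe_iff (k : ℕ) (x y : Vec d) (ξ : ℕ → Noise n m S S₁) (N : ℕ) :
    D.innerTime k x y ξ = N ↔
      (1 ≤ N ∧ D.G y (D.innerAvg x y ξ N) - D.Gmin y ≤ D.ε k) ∧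
      ∀ j < N, ¬ (1 ≤ j ∧ D.G y (D.innerAvg x y ξ j) - D.Gmin y ≤ D.ε k) := by
  unfold Setup.innerTime
  set A : Set ℕ∞ := {t : ℕ∞ | ∃ K : ℕ, t = (K : ℕ∞) ∧ 1 ≤ K ∧
    D.G y (D.innerAvg x y ξ K) - D.Gmin y ≤ D.ε k}
  constructor
  · intro h
    have hne : A.Nonempty := by
      by_contra hA
      rw [Set.not_nonempty_iff_eq_empty.1 hA, sInf_empty] at h
      exact ENat.top_ne_natCast N h
    obtain ⟨K, hK, hp⟩ := csInf_mem hne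
    rw [h] at hK
    have hK' : N = K := by exact_mod_cast hK
    subst hK'
    refine ⟨hp, fun j hj hpj => ?_⟩
    have h1 : sInf A ≤ (j : ℕ∞) := sInf_le ⟨j, rfl, hpj⟩
    rw [h] at h1
    exact absurd (by exact_mod_cast h1) (not_le.2 hj)
  · rintro ⟨hp, hmin⟩
    refine le_antisymm (sInf_le ⟨N, rfl, hp⟩) (le_sInf ?_)
    rintro _ ⟨K, rfl, hK⟩
    by_contra h
    exact hmin K (by exact_mod_cast not_le.1 h) hK

lemma innerTime_spec {k : ℕ} {x y : Vec d} {ξ : ℕ → Noise n m S S₁}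
    (h : D.innerTime k x y ξ ≠ ⊤) :
    D.G y (D.innerAvg x y ξ (D.innerTime k x y ξ).toNat) - D.Gmin y ≤ D.ε k := by
  obtain ⟨N, hN⟩ := ENat.ne_top_iff_exists.1 h
  rw [← hN, ENat.toNat_natCast]
  exact ((innerTime_eq_coe_iff k x y ξ N).1 hN.symm).1.2

lemma lt_gap_of_lt_innerTime {k : ℕ} {x y : Vec d} {ξ : ℕ → Noise n m S S₁} {K : ℕ} (hK : 1 ≤ K)
    (h : (K : ℕ∞) < D.innerTime k x y ξ) : D.ε k < D.G y (D.innerAvg x y ξ K) - D.Gmin y := by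
  by_contra hc
  exact absurd h (not_lt.2 (sInf_le ⟨K, rfl, hK, not_lt.1 hc⟩))

lemma measurable_comp_nat {A B : Type*} [MeasurableSpace A] [MeasurableSpace B] {f : A → ℕ → B}
    (hf : ∀ K, Measurable fun a => f a K) {N : A → ℕ} (hN : Measurable N) :
    Measurable fun a => f a (N a) := by
  have h : Measurable fun r : ℕ × A => f r.2 r.1 := measurable_from_prod_countable_right hf
  exact h.comp (hN.prodMk measurable_id)

lemma measurable_nextAlpha : Measurable D.nextAlpha := by
  unfold Setup.nextAlpha
  fun_prop

variable [MeasurableSpace S] [MeasurableSpace S₁]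

lemma measurable_innerTime {A : Type*} [MeasurableSpace A] (hn : 0 < n) (hm : 0 < m)
    (hA : ProblemAssumptions D.f D.ψ Lf Lbar L Lψ D.lam) (hκ : 0 ≤ D.kap)
    (hQ : Measurable (Function.uncurry D.Q)) (hQ₁ : Measurable (Function.uncurry D.Q₁)) (k : ℕ)
    {x y : A → Vec d} {ξ : A → ℕ → Noise n m S S₁}
    (hx : Measurable x) (hy : Measurable y) (hξ : Measurable ξ) :
    Measurable fun a => D.innerTime k (x a) (y a) (ξ a) := by
  have hp : ∀ j : ℕ, MeasurableSet {a : A |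
      1 ≤ j ∧ D.G (y a) (D.innerAvg (x a) (y a) (ξ a) j) - D.Gmin (y a) ≤ D.ε k} := fun j =>
    (MeasurableSet.const _).inter (measurableSet_le
      (((measurable_G hA).comp (hy.prodMk
        (measurable_innerAvg hn hm hA hκ hQ hQ₁ hx hy hξ j))).sub
        ((measurable_Gmin hA hκ).comp hy)) measurable_const)
  refine ENat.measurable_iff.2 fun N => ?_
  have he : (fun a => D.innerTime k (x a) (y a) (ξ a)) ⁻¹' {(N : ℕ∞)}
      = {a | 1 ≤ N ∧ D.G (y a) (D.innerAvg (x a) (y a) (ξ a) N) - D.Gmin (y a) ≤ D.ε k} ∩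
        ⋂ j ∈ Set.Iio N, {a | 1 ≤ j ∧
          D.G (y a) (D.innerAvg (x a) (y a) (ξ a) j) - D.Gmin (y a) ≤ D.ε k}ᶜ := by
    ext q
    simp only [Set.mem_preimage, Set.mem_singleton_iff, innerTime_eq_coe_iff, Set.mem_inter_iff,
      Set.mem_iInter, Set.mem_compl_iff, Set.mem_ofPred_eq, Set.mem_Iio]
  rw [he]
  exact (hp N).inter (MeasurableSet.biInter (Set.to_countable _) fun j _ => (hp j).compl)

instance instMeasurableSpaceOuter : MeasurableSpace (Outer d) :=
  MeasurableSpace.comap (fun o => (o.x, o.y, o.α)) inferInstance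

lemma measurable_outer_iff {A : Type*} [MeasurableSpace A] {f : A → Outer d} :
    Measurable f ↔ Measurable (fun a => (f a).x) ∧ Measurable (fun a => (f a).y) ∧
      Measurable fun a => (f a).α := by
  rw [measurable_comap_iff]
  constructor
  · intro h
    have h1 : Measurable fun a => ((f a).x, (f a).y, (f a).α) := h
    exact ⟨h1.fst, h1.snd.fst, h1.snd.snd⟩
  · rintro ⟨h1, h2, h3⟩
    exact h1.prodMk (h2.prodMk h3)

lemma measurable_outerStep {A : Type*} [MeasurableSpace A] (hn : 0 < n) (hm : 0 < m)
    (hA : ProblemAssumptions D.f D.ψ Lf Lbar L Lψ D.lam) (hκ : 0 ≤ D.kap)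
    (hQ : Measurable (Function.uncurry D.Q)) (hQ₁ : Measurable (Function.uncurry D.Q₁)) (k : ℕ)
    {o : A → Outer d} {ξ : A → ℕ → Noise n m S S₁} (ho : Measurable o) (hξ : Measurable ξ) :
    Measurable fun a => D.outerStep k (ξ a) (o a) := by
  obtain ⟨ox, oy, oα⟩ := measurable_outer_iff.1 ho
  have hN : Measurable fun a => (D.innerTime k (o a).x (o a).y (ξ a)).toNat :=
    (measurable_of_countable ENat.toNat).comp (measurable_innerTime hn hm hA hκ hQ hQ₁ k ox oy hξ)
  have hx := measurable_comp_nat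
    (fun K => measurable_innerAvg hn hm hA hκ hQ hQ₁ ox oy hξ K) hN
  have hα : Measurable fun a => D.nextAlpha (o a).α := measurable_nextAlpha.comp oα
  have hβ : Measurable fun a => (o a).α * (1 - (o a).α) / ((o a).α ^ 2 + D.nextAlpha (o a).α) :=
    (oα.mul (measurable_const.sub oα)).div ((oα.pow_const 2).add hα)
  have hy := hx.add (hβ.smul (hx.sub ox))
  refine measurable_outer_iff.2 ⟨hx, ?_, hα⟩
  exact hy

end InnerTime

/-! ### The expected number of inner iterations from a fixed start -/

section Tail

lemma coe_enat_eq_tsum (t : ℕ∞) :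
    (t : ℝ≥0∞) = ∑' K : ℕ, if (K : ℕ∞) < t then (1 : ℝ≥0∞) else 0 := by
  induction t with
  | top => simp
  | coe N =>
    rw [tsum_eq_sum (s := Finset.range N)]
    · rw [Finset.sum_congr rfl (g := fun _ => (1 : ℝ≥0∞))]
      · simp
      · intro K hK
        rw [if_pos]
        exact_mod_cast Finset.mem_range.1 hK
    · intro K hK
      rw [if_neg]
      rw [Finset.mem_range, not_lt] at hK
      exact not_lt.2 (by exact_mod_cast hK)

lemma measurableSet_lt_enat {Ω : Type*} [MeasurableSpace Ω] {T : Ω → ℕ∞} (hT : Measurable T)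
    (K : ℕ) : MeasurableSet {ω | (K : ℕ∞) < T ω} :=
  hT (MeasurableSet.of_discrete (s := Set.Ioi (K : ℕ∞)))

lemma lintegral_enat_eq_tsum {Ω : Type*} [MeasurableSpace Ω] {P : Measure Ω} {T : Ω → ℕ∞}
    (hT : Measurable T) : ∫⁻ ω, (T ω : ℝ≥0∞) ∂P = ∑' K : ℕ, P {ω | (K : ℕ∞) < T ω} := by
  rw [lintegral_congr fun ω => coe_enat_eq_tsum (T ω),
    lintegral_tsum fun K => (Measurable.ite (measurableSet_lt_enat hT K) measurable_const
      measurable_const).aemeasurable]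
  refine tsum_congr fun K => ?_
  rw [← lintegral_indicator_one (measurableSet_lt_enat hT K)]
  refine lintegral_congr fun ω => ?_
  simp [Set.indicator_apply]

lemma mul_pow_ceil_log_le_one {A θ : ℝ} (hA : 1 ≤ A) (hθ0 : 0 < θ) (hθ1 : θ ≤ 1) :
    A * (1 - θ) ^ ⌈Real.log A / θ⌉₊ ≤ 1 := by
  generalize hK : ⌈Real.log A / θ⌉₊ = N
  have h2 : (1 - θ) ^ N ≤ Real.exp (-(θ * N)) := by
    have h3 : 1 - θ ≤ Real.exp (-θ) := by linarith [Real.add_one_le_exp (-θ)]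
    refine (pow_le_pow_left₀ (by linarith) h3 N).trans (le_of_eq ?_)
    rw [← Real.exp_nat_mul]
    ring_nf
  have h4 : Real.log A ≤ θ * N := by
    have := Nat.le_ceil (Real.log A / θ)
    rw [hK, div_le_iff₀ hθ0] at this
    linarith
  have h5 : Real.exp (-(θ * N)) ≤ A⁻¹ := by
    rw [Real.exp_neg]
    refine inv_anti₀ (by linarith) ?_
    rw [← Real.exp_log (by linarith : 0 < A)]
    exact Real.exp_le_exp.2 h4
  have h6 := mul_le_mul_of_nonneg_left (h2.trans h5) (by linarith : 0 ≤ A)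
  rwa [mul_inv_cancel₀ (by linarith)] at h6

lemma tsum_tail_le {u : ℕ → ℝ≥0∞} {A θ : ℝ} {N : ℕ} (hθ0 : 0 < θ) (hθ1 : θ ≤ 1)
    (hN : A * (1 - θ) ^ N ≤ 1) (h : ∀ K, u K ≤ ENNReal.ofReal (A * (1 - θ) ^ K)) :
    ∑' K, u (K + N) ≤ ENNReal.ofReal (1 / θ) := by
  have hq : 0 ≤ 1 - θ := by linarith
  have hgeo : HasSum (fun K : ℕ => (1 - θ) ^ K) (1 / θ) := by
    have := hasSum_geometric_of_lt_one hq (by linarith)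
    rwa [sub_sub_cancel, ← one_div] at this
  rw [← hgeo.tsum_eq, ENNReal.ofReal_tsum_of_nonneg (fun K => pow_nonneg hq K) hgeo.summable]
  refine ENNReal.tsum_le_tsum fun K => (h _).trans (ENNReal.ofReal_le_ofReal ?_)
  rw [pow_add, mul_left_comm]
  exact mul_le_of_le_one_right (pow_nonneg hq K) hN

/-- The trivial bound `1` is used for the first `⌈log A / θ⌉` terms, after which the geometric tail
contributes at most `1/θ`; the other `1/θ` absorbs the rounding. -/
lemma tsum_le_of_tail {u : ℕ → ℝ≥0∞} {A θ : ℝ} (hA : 1 ≤ A) (hθ0 : 0 < θ) (hθ1 : θ ≤ 1)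
    (hu : ∀ K, u K ≤ 1) (h : ∀ K, u K ≤ ENNReal.ofReal (A * (1 - θ) ^ K)) :
    ∑' K, u K ≤ ENNReal.ofReal ((Real.log A + 2) / θ) := by
  have hlog : 0 ≤ Real.log A := Real.log_nonneg hA
  have hN := mul_pow_ceil_log_le_one hA hθ0 hθ1
  have h7 := (Nat.ceil_lt_add_one (div_nonneg hlog hθ0.le)).le
  generalize ⌈Real.log A / θ⌉₊ = N at hN h7
  have hhead : ∑ K ∈ Finset.range N, u K ≤ ENNReal.ofReal N := by
    refine (Finset.sum_le_sum fun K _ => hu K).trans ?_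
    simp
  have h8 : 1 ≤ 1 / θ := by rw [le_div_iff₀ hθ0]; linarith
  have h9 : (Real.log A + 2) / θ = Real.log A / θ + 1 / θ + 1 / θ := by ring
  have h10 : (N : ℝ) + 1 / θ ≤ (Real.log A + 2) / θ := by linarith
  calc ∑' K, u K = ∑ K ∈ Finset.range N, u K + ∑' K, u (K + N) :=
        (Summable.sum_add_tsum_nat_add' ENNReal.summable).symm
    _ ≤ ENNReal.ofReal N + ENNReal.ofReal (1 / θ) :=
        add_le_add hhead (tsum_tail_le hθ0 hθ1 hN h)
    _ = ENNReal.ofReal (N + 1 / θ) :=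
        (ENNReal.ofReal_add (Nat.cast_nonneg N) (zero_le_one.trans h8)).symm
    _ ≤ _ := ENNReal.ofReal_le_ofReal h10

/-- An `ℕ∞`-valued random variable with geometric tails `A (1 - θ)^K` has expectation
`O((1 + log A)/θ)`. -/
lemma lintegral_le_of_tail {Ω : Type*} [MeasurableSpace Ω] {P : Measure Ω} [IsProbabilityMeasure P]
    {T : Ω → ℕ∞} (hT : Measurable T) {A θ : ℝ} (hA : 1 ≤ A) (hθ0 : 0 < θ) (hθ1 : θ ≤ 1)
    (h : ∀ K : ℕ, P {ω | (K : ℕ∞) < T ω} ≤ ENNReal.ofReal (A * (1 - θ) ^ K)) :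
    ∫⁻ ω, (T ω : ℝ≥0∞) ∂P ≤ ENNReal.ofReal ((Real.log A + 2) / θ) :=
  (lintegral_enat_eq_tsum hT).trans_le (tsum_le_of_tail hA hθ0 hθ1 (fun _ => prob_le_one) h)

end Tail

/-! ### Admissible step size and tail of the stopping time. -/

section FixedStart

variable {d n m : ℕ} {S S₁ : Type*} {D : Setup d n m S S₁} {Lf Lbar L Lψ a c₂ B : ℝ}

/-- The step size parameter of EC-LSVRG. -/
def stepConst (c₂ : ℝ) : ℝ := 1 / (2000 * (1 + c₂))

lemma stepConst_pos (hc : 0 < c₂) : 0 < stepConst c₂ := by unfold stepConst; positivity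

lemma stepConst_small (hc : 0 < c₂) :
    2 * stepConst c₂ + 3 * ckConst (stepConst c₂) c₂ ≤ 1 / 2 := by
  have h0 := stepConst_pos hc
  have h1 : stepConst c₂ * (1 + c₂) = 1 / 2000 := by unfold stepConst; field_simp
  have h2 : stepConst c₂ ≤ 1 / 2000 := by nlinarith
  have h3 : stepConst c₂ ^ 2 * (c₂ * (1 + 2 * c₂)) ≤ 2 * (1 / 2000) ^ 2 := by
    have h5 : c₂ * (1 + 2 * c₂) ≤ 2 * (1 + c₂) ^ 2 := by nlinarith
    calc _ ≤ stepConst c₂ ^ 2 * (2 * (1 + c₂) ^ 2) := mul_le_mul_of_nonneg_left h5 (sq_nonneg _)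
      _ = 2 * (stepConst c₂ * (1 + c₂)) ^ 2 := by ring
      _ = _ := by rw [h1]
  have h4 : stepConst c₂ ^ 2 ≤ (1 / 2000) ^ 2 := by gcongr
  unfold ckConst
  linarith

/-- A unit vector compares the two quadratic bounds of `ψ`. In dimension zero there is none, and the
inequality can fail. -/
lemma lam_le_of_pos (hd : 0 < d) (hA : ProblemAssumptions D.f D.ψ Lf Lbar L Lψ D.lam) :
    D.lam ≤ Lψ := by
  let v : Vec d := EuclideanSpace.single ⟨0, hd⟩ 1
  have hv : ‖v‖ = 1 := by simp [v]
  have h := (quadBounds_reg hA).2 v 0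
  rw [sub_zero, hv] at h
  linarith [h.1, h.2]

lemma stepBounds_of_stepsize (hd : 0 < d) (hn : 0 < n) (hm : 0 < m) (hc : 0 < c₂)
    (hA : ProblemAssumptions D.f D.ψ Lf Lbar L Lψ D.lam) (hκ : 0 ≤ D.kap)
    (hδ0 : 0 < D.δ) (hδ₁0 : 0 < D.δ₁) (hp0 : 0 < D.p) (hp1 : D.p ≤ 1)
    (hpc : D.p ≤ c₂ * D.δ₁)
    (hη : D.η = stepConst c₂ / (Lf + Lψ + D.kap + L / n
      + Real.sqrt (1 - D.δ) * (Lf + Lψ + D.kap) / D.δ)) :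
    StepBounds (D.lam + D.kap) (Lf + Lψ + D.kap) ((L + Lψ + D.kap) / n) D.η (stepConst c₂) c₂
      D.δ D.δ₁ D.p D.θ := by
  have hlam := hA.lam_pos
  have hLψ := lam_le_of_pos hd hA
  have hLf : 0 ≤ Lf := hA.smooth_global.1
  have hL : 0 ≤ L := (hA.smooth_component ⟨0, hn⟩ ⟨0, hm⟩).1
  have ha := stepConst_pos hc
  have hn1 : (1 : ℝ) ≤ n := by exact_mod_cast hn
  have hs := Real.sqrt_nonneg (1 - D.δ)
  set M := Lf + Lψ + D.kap with hM
  have hM0 : 0 < M := by linarith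
  set Den := M + L / n + Real.sqrt (1 - D.δ) * M / D.δ with hDen
  have t1 : 0 ≤ L / n := by positivity
  have t2 : 0 ≤ Real.sqrt (1 - D.δ) * M / D.δ := by positivity
  have hDen0 : 0 < Den := by linarith
  have hη0 : 0 < D.η := by rw [hη]; positivity
  have hle : ∀ x, x ≤ Den → D.η * x ≤ stepConst c₂ := by
    intro x hx
    rw [hη, div_mul_eq_mul_div, div_le_iff₀ hDen0]
    exact mul_le_mul_of_nonneg_left hx ha.le
  have hμ : 0 < D.lam + D.kap := by linarith
  refine ⟨hμ, by linarith, hη0, ha, hp0, hp1, hpc, hle _ (by linarith), hle _ ?_, ?_,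
    stepConst_small hc, ?_, ?_, ?_, ?_, ?_⟩
  · have h1 : (L + Lψ + D.kap) / n = L / n + (Lψ + D.kap) / n := by ring
    have h2 : (Lψ + D.kap) / n ≤ Lψ + D.kap := div_le_self (by linarith) hn1
    linarith
  · have h1 := hle (Real.sqrt (1 - D.δ) * M / D.δ) (by linarith)
    rw [mul_div_assoc', div_le_iff₀ hδ0] at h1
    linarith
  · unfold Setup.θ
    refine lt_min (lt_min ?_ ?_) (lt_min ?_ ?_) <;> positivity
  · exact (min_le_left _ _).trans (min_le_left _ _)
  · exact (min_le_left _ _).trans (min_le_right _ _)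
  · exact (min_le_right _ _).trans (min_le_left _ _)
  · exact (min_le_right _ _).trans (min_le_right _ _)

variable [MeasurableSpace S] [MeasurableSpace S₁]
  (ν : Measure S) [IsProbabilityMeasure ν] (ν₁ : Measure S₁) [IsProbabilityMeasure ν₁]
  {Ω : Type*} [MeasurableSpace Ω] {P : Measure Ω} [IsProbabilityMeasure P]
  {ζ : ℕ → Ω → Noise n m S S₁}

/-- Markov's inequality: not having stopped by `K` means that the gap of the average at `K` exceeds
`ε k`, while its expectation is at most `5 B (1 - θ)^K ε k`. -/
lemma measure_lt_innerTime_le (hn : 0 < n) (hm : 0 < m)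
    (hA : ProblemAssumptions D.f D.ψ Lf Lbar L Lψ D.lam) (hκ : 0 ≤ D.kap)
    (hMc : 0 < L + Lψ + D.kap)
    (hQ : IsContractionCompressor ν D.Q D.δ) (hs : MeanScaled ν D.Q D.δ)
    (hQ₁ : IsContractionCompressor ν₁ D.Q₁ D.δ₁) (hs₁ : MeanScaled ν₁ D.Q₁ D.δ₁)
    (hb : StepBounds (D.lam + D.kap) (Lf + Lψ + D.kap) ((L + Lψ + D.kap) / n) D.η a c₂
      D.δ D.δ₁ D.p D.θ)
    (hζ : ∀ K, Measurable (ζ K)) (hlaw : ∀ K, P.map (ζ K) = noiseLaw n m ν ν₁ D.p)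
    (hind : iIndepFun ζ P) (k : ℕ) (x y : Vec d) (hε : 0 ≤ D.ε k) (hB : 1 ≤ B)
    (hgap : D.G y x - D.Gmin y ≤ B * D.ε k) (K : ℕ) :
    P {ω | (K : ℕ∞) < D.innerTime k x y (fun j => ζ j ω)}
      ≤ ENNReal.ofReal (5 * B * (1 - D.θ) ^ K) := by
  have hθ0 := hb.theta_pos
  have hθ1 : D.θ < 1 := by linarith [hb.theta_le_p, hb.p_le_one]
  have hq : 0 ≤ 1 - D.θ := by linarith
  have hpow : (1 - D.θ) ^ (K + 1) ≤ (1 - D.θ) ^ K :=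
    pow_le_pow_of_le_one hq (by linarith) (Nat.le_succ K)
  have hpow0 : 0 ≤ (1 - D.θ) ^ K := pow_nonneg hq K
  have hone : 1 ≤ 5 * B * (1 - D.θ) ^ K →
      P {ω | (K : ℕ∞) < D.innerTime k x y (fun j => ζ j ω)}
        ≤ ENNReal.ofReal (5 * B * (1 - D.θ) ^ K) := fun h =>
    prob_le_one.trans (by rw [← ENNReal.ofReal_one]; exact ENNReal.ofReal_le_ofReal h)
  -- The asserted bound exceeds `1` for `K = 0` (where stopping is not allowed) and before the end
  -- of the burn-in, since `5B/2 ≥ 1`.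
  rcases Nat.eq_zero_or_pos K with rfl | hK
  · exact hone (by simp; linarith)
  by_cases hK2 : (1 - D.θ) ^ (K + 1) ≤ 1 / 2
  swap
  · refine hone ?_
    rw [not_le] at hK2
    nlinarith
  obtain ⟨z, hz⟩ := (quadBounds_G hA y).exists_isMin hb.mu_pos
  have hGz := Gmin_eq_of_isMin hz
  have hF := finiteSumBounds_subLoss hn hm hA hκ y
  have hglob := globalAvg_subLoss (D := D) hn hm y
  have hmain := lintegral_weightedAvg_gap_le (z := z) ν ν₁ hF hMc (by rw [hglob]; exact hz)
    hQ hs hQ₁ hs₁ hb hζ hlaw hind (D.initState x y) rfl (fun _ => rfl)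
    (fun τ => (gradient_nodeAvg_subLoss hn hm hA hκ y τ x).symm) K hK2
  rw [hglob, ← hGz] at hmain
  have hE : ∫⁻ ω, ENNReal.ofReal (D.G y (D.innerAvg x y (fun j => ζ j ω) K) - D.Gmin y) ∂P
      ≤ ENNReal.ofReal (5 * B * (1 - D.θ) ^ K) * ENNReal.ofReal (D.ε k) := by
    refine hmain.trans ?_
    rw [← ENNReal.ofReal_mul (by positivity)]
    refine ENNReal.ofReal_le_ofReal ?_
    have h1 := mul_le_mul_of_nonneg_left hgap (pow_nonneg hq (K + 1))
    have h2 := mul_le_mul_of_nonneg_right hpow (mul_nonneg (by linarith : 0 ≤ B) hε)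
    change 5 * (1 - D.θ) ^ (K + 1) * (D.G y x - D.Gmin y) ≤ _
    linarith
  have hmeas : Measurable fun ω =>
      ENNReal.ofReal (D.G y (D.innerAvg x y (fun j => ζ j ω) K) - D.Gmin y) :=
    (((measurable_G hA).comp (measurable_const.prodMk (measurable_innerAvg hn hm hA hκ
      hQ.measurable hQ₁.measurable measurable_const measurable_const
      (measurable_pi_lambda _ hζ) K))).sub_const _).ennreal_ofReal
  have hsub : {ω | (K : ℕ∞) < D.innerTime k x y (fun j => ζ j ω)}
      ⊆ {ω | ENNReal.ofReal (D.ε k)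
        < ENNReal.ofReal (D.G y (D.innerAvg x y (fun j => ζ j ω) K) - D.Gmin y)} := by
    intro ω hω
    have h := lt_gap_of_lt_innerTime hK hω
    exact (ENNReal.ofReal_lt_ofReal_iff (hε.trans_lt h)).2 h
  refine (measure_mono hsub).trans ?_
  -- If the start is already optimal, `ε k = 0` and Markov's inequality is void; then the expected
  -- gap vanishes, so a positive gap is a null event.
  rcases hε.eq_or_lt with h0 | hpos
  · rw [← h0, ENNReal.ofReal_zero, mul_zero] at hE
    have h1 := (lintegral_eq_zero_iff hmeas).1 (le_antisymm hE zero_le)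
    rw [← h0, ENNReal.ofReal_zero]
    refine le_trans (le_of_eq ?_) zero_le
    refine measure_mono_null (fun ω hω => ?_) (ae_iff.1 h1)
    exact (show (0 : ℝ≥0∞) < _ from hω).ne'
  · have hne : ENNReal.ofReal (D.ε k) ≠ 0 := by simpa using hpos
    have h1 := mul_meas_ge_le_lintegral (μ := P) hmeas (ENNReal.ofReal (D.ε k))
    have h2 : ENNReal.ofReal (D.ε k) * P {ω | ENNReal.ofReal (D.ε k)
        < ENNReal.ofReal (D.G y (D.innerAvg x y (fun j => ζ j ω) K) - D.Gmin y)}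
        ≤ ENNReal.ofReal (D.ε k) * ENNReal.ofReal (5 * B * (1 - D.θ) ^ K) := by
      refine le_trans ?_ ((h1.trans hE).trans (le_of_eq (mul_comm _ _)))
      have hss : {ω | ENNReal.ofReal (D.ε k)
          < ENNReal.ofReal (D.G y (D.innerAvg x y (fun j => ζ j ω) K) - D.Gmin y)} ⊆
          {ω | ENNReal.ofReal (D.ε k)
            ≤ ENNReal.ofReal (D.G y (D.innerAvg x y (fun j => ζ j ω) K) - D.Gmin y)} :=
        fun ω hω => le_of_lt (show ENNReal.ofReal (D.ε k) < _ from hω)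
      exact mul_le_mul_right (measure_mono hss) _
    exact (ENNReal.mul_le_mul_iff_right hne ENNReal.ofReal_ne_top).1 h2

/-- The expected number of inner iterations from a fixed start. -/
theorem lintegral_innerTime_le (hn : 0 < n) (hm : 0 < m)
    (hA : ProblemAssumptions D.f D.ψ Lf Lbar L Lψ D.lam) (hκ : 0 ≤ D.kap)
    (hMc : 0 < L + Lψ + D.kap)
    (hQ : IsContractionCompressor ν D.Q D.δ) (hs : MeanScaled ν D.Q D.δ)
    (hQ₁ : IsContractionCompressor ν₁ D.Q₁ D.δ₁) (hs₁ : MeanScaled ν₁ D.Q₁ D.δ₁)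
    (hb : StepBounds (D.lam + D.kap) (Lf + Lψ + D.kap) ((L + Lψ + D.kap) / n) D.η a c₂
      D.δ D.δ₁ D.p D.θ)
    (hζ : ∀ K, Measurable (ζ K)) (hlaw : ∀ K, P.map (ζ K) = noiseLaw n m ν ν₁ D.p)
    (hind : iIndepFun ζ P) (k : ℕ) (x y : Vec d) (hε : 0 ≤ D.ε k) (hB : 1 ≤ B)
    (hgap : D.G y x - D.Gmin y ≤ B * D.ε k) :
    ∫⁻ ω, (D.innerTime k x y (fun j => ζ j ω) : ℝ≥0∞) ∂P
      ≤ ENNReal.ofReal ((Real.log (5 * B) + 2) / D.θ) :=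
  lintegral_le_of_tail (measurable_innerTime hn hm hA hκ hQ.measurable hQ₁.measurable k
    measurable_const measurable_const (measurable_pi_lambda _ hζ)) (by linarith) hb.theta_pos
    (by linarith [hb.theta_le_p, hb.p_le_one])
    (measure_lt_innerTime_le ν ν₁ hn hm hA hκ hMc hQ hs hQ₁ hs₁ hb hζ hlaw hind k x y hε hB hgap)

end FixedStart

/-! ### Accelerated proximal point steps with inexact proximal maps -/

section Accelerated

variable {d : ℕ} {P : Vec d → ℝ} {lam kap s M : ℝ}

lemma QuadBounds.combination_le {μ : ℝ} (hP : QuadBounds μ M P) (hs0 : 0 ≤ s) (hs1 : s ≤ 1)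
    (x z : Vec d) : P (s • x + (1 - s) • z)
      ≤ s * P x + (1 - s) * P z - μ * s * (1 - s) / 2 * ‖x - z‖ ^ 2 := by
  set c := s • x + (1 - s) • z with hc
  have h1 := (hP.2 x c).1
  have h2 := (hP.2 z c).1
  have e1 : x - c = (1 - s) • (x - z) := by rw [hc]; module
  have e2 : z - c = (-s) • (x - z) := by rw [hc]; module
  unfold bregman at h1 h2
  rw [e1, inner_smul_right, norm_smul, mul_pow, Real.norm_eq_abs, sq_abs] at h1
  rw [e2, inner_smul_right, norm_smul, mul_pow, Real.norm_eq_abs, sq_abs] at h2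
  have h3 := mul_le_mul_of_nonneg_left h1 hs0
  have h4 := mul_le_mul_of_nonneg_left h2 (by linarith : 0 ≤ 1 - s)
  linarith

/-- Expanding, the left side is `‖a‖² - 2⟨a, b⟩ + ‖b‖²/(1 + s)`. Its `-s ‖a‖²` is what strong
convexity provides between the minimizer and the current point. -/
lemma accelerated_norm_le (hs0 : 0 < s) (a b : Vec d) :
    (1 + s) * ‖a - (1 + s)⁻¹ • b‖ ^ 2 - s * ‖a‖ ^ 2 ≤ ‖a - b‖ ^ 2 := by
  have h1 : (1 + s)⁻¹ ≤ 1 := inv_le_one_of_one_le₀ (by linarith)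
  have h2 : (1 + s) * (1 + s)⁻¹ = 1 := mul_inv_cancel₀ (by linarith)
  rw [norm_sub_sq_real, norm_sub_sq_real, inner_smul_right, norm_smul, mul_pow, Real.norm_eq_abs,
    sq_abs]
  have h3 := mul_le_mul_of_nonneg_right h1 (sq_nonneg ‖b‖)
  calc _ = ‖a‖ ^ 2 - 2 * ((1 + s) * (1 + s)⁻¹) * inner ℝ a b
        + ((1 + s) * (1 + s)⁻¹) * (1 + s)⁻¹ * ‖b‖ ^ 2 := by ring
    _ ≤ _ := by rw [h2]; linarith

/-- One step of the accelerated proximal point method, with the prox-center `y` between `z` and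
`v`, and the proximal point computed up to the accuracy `ε`. -/
lemma accelerated_step_le (hlam : 0 < lam) (hs0 : 0 < s) (hs1 : s ≤ 1)
    (hs : s ^ 2 * (lam + kap) = lam) (hκ : 0 ≤ kap) (hP : QuadBounds lam M P)
    {xs z v y p x : Vec d} {t ε : ℝ} (ht : 0 < t) (hxs : ∀ u, P xs ≤ P u)
    (hy : y = z + (s / (1 + s)) • (v - z))
    (hp : ∀ u, P p + kap / 2 * ‖p - y‖ ^ 2 ≤ P u + kap / 2 * ‖u - y‖ ^ 2)
    (hx : P x + kap / 2 * ‖x - y‖ ^ 2 - (P p + kap / 2 * ‖p - y‖ ^ 2) ≤ ε) :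
    (1 - t) * (P x - P xs + lam / 2 * ‖z + s⁻¹ • (x - z) - xs‖ ^ 2)
      ≤ (1 - s) * (P z - P xs + lam / 2 * ‖v - xs‖ ^ 2) + ε * (1 + 1 / t) := by
  have hG : QuadBounds (lam + kap) (M + kap) (fun u => P u + kap / 2 * ‖u - y‖ ^ 2) :=
    hP.add (quadBounds_prox kap y)
  have hμ : 0 < lam + kap := by linarith
  set w := z + s⁻¹ • (x - z) with hw
  -- This comparison point satisfies `c - x = s (x* - w)` with `w` the new extrapolated point, and
  -- convexity bounds `P c` with the factor `1 - s` on the old gap.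
  set c := s • xs + (1 - s) • z with hc
  have e1 : c - x = s • (xs - w) := by
    have : s • (s⁻¹ • (x - z)) = x - z := by rw [smul_smul, mul_inv_cancel₀ hs0.ne', one_smul]
    rw [hw, hc, smul_sub, smul_add, this]
    module
  have e2 : c - y = s • ((xs - z) - (1 + s)⁻¹ • (v - z)) := by
    rw [hc, hy, div_eq_mul_inv]
    module
  have h1 := hG.le_of_isMin hp c
  have h2 := hG.le_of_isMin hp x
  have e3 : ‖c - p‖ ^ 2 = s ^ 2 * ‖xs - w‖ ^ 2 + 2 * s * inner ℝ (xs - w) (x - p)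
      + ‖x - p‖ ^ 2 := by
    have : c - p = s • (xs - w) + (x - p) := by rw [← e1]; abel
    rw [this, norm_add_sq_real, inner_smul_left, norm_smul, mul_pow, Real.norm_eq_abs, sq_abs]
    simp
    ring
  have h3 := hP.combination_le hs0.le hs1 xs z
  have h4 := accelerated_norm_le hs0 (xs - z) (v - z)
  rw [sub_sub_sub_cancel_right] at h4
  have e4 : ‖c - y‖ ^ 2 = s ^ 2 * ‖(xs - z) - (1 + s)⁻¹ • (v - z)‖ ^ 2 := by
    rw [e2, norm_smul, mul_pow, Real.norm_eq_abs, sq_abs]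
  have e5 : kap * s ^ 2 = lam * (1 - s) * (1 + s) := by linear_combination hs
  -- The inexact point `x` is not the minimizer `p`. The cross term costs a fraction `t` of the new
  -- distance term and `1/t` times `ε`, by strong convexity around `p`.
  have hyoung : -(2 * s * inner ℝ (xs - w) (x - p))
      ≤ t * s ^ 2 * ‖xs - w‖ ^ 2 + 1 / t * ‖x - p‖ ^ 2 := by
    have h5 : 0 ≤ ‖(t * s) • (xs - w) + (x - p)‖ ^ 2 := sq_nonneg _
    rw [norm_add_sq_real, inner_smul_left, norm_smul, mul_pow, Real.norm_eq_abs, sq_abs] at h5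
    have h6 := mul_nonneg (one_div_pos.2 ht).le h5
    have e6 : 1 / t * ((t * s) ^ 2 * ‖xs - w‖ ^ 2 + 2 * (t * s * inner ℝ (xs - w) (x - p))
        + ‖x - p‖ ^ 2) = t * s ^ 2 * ‖xs - w‖ ^ 2 + 2 * s * inner ℝ (xs - w) (x - p)
          + 1 / t * ‖x - p‖ ^ 2 := by field_simp
    simp only [conj_trivial] at h6
    rw [e6] at h6
    linarith
  have hxp : (lam + kap) / 2 * ‖x - p‖ ^ 2 ≤ ε := by linarith
  have h7 := mul_le_mul_of_nonneg_left hyoung (half_pos hμ).le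
  have h8 := mul_le_mul_of_nonneg_left hxp (one_div_pos.2 ht).le
  have h9 := mul_le_mul_of_nonneg_left h4
    (mul_nonneg (half_pos hlam).le (by linarith : 0 ≤ 1 - s))
  have h10 : 0 ≤ kap / 2 * ‖x - y‖ ^ 2 := by positivity
  have h11 : 0 ≤ (lam + kap) / 2 * ‖x - p‖ ^ 2 := by positivity
  -- Only the distance term pays `t`; this inequality lets the factor `1 - t` stand in front of the
  -- whole potential.
  have h12 : 0 ≤ t * (P x - P xs) := mul_nonneg ht.le (by linarith [hxs x])
  rw [norm_sub_rev w xs, norm_sub_rev v xs]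
  simp only [e3, e4] at h1
  have e7 : (lam + kap) / 2 * (s ^ 2 * ‖xs - w‖ ^ 2) = lam / 2 * ‖xs - w‖ ^ 2 := by
    linear_combination ‖xs - w‖ ^ 2 / 2 * hs
  have e8 : kap / 2 * (s ^ 2 * ‖(xs - z) - (1 + s)⁻¹ • (v - z)‖ ^ 2)
      = lam / 2 * (1 - s) * ((1 + s) * ‖(xs - z) - (1 + s)⁻¹ • (v - z)‖ ^ 2) := by
    linear_combination ‖(xs - z) - (1 + s)⁻¹ • (v - z)‖ ^ 2 / 2 * e5
  have e9 : (lam + kap) / 2 * (t * s ^ 2 * ‖xs - w‖ ^ 2 + 1 / t * ‖x - p‖ ^ 2)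
      = t * (lam / 2 * ‖xs - w‖ ^ 2) + 1 / t * ((lam + kap) / 2 * ‖x - p‖ ^ 2) := by
    rw [← e7]; ring
  linarith

end Accelerated

/-! ### Outer potential and quality of the warm start. -/

section Catalyst

variable {d n m : ℕ} {S S₁ : Type*} {D : Setup d n m S S₁} {Lf Lbar L Lψ : ℝ}

lemma q_pos (hlam : 0 < D.lam) (hκ : 0 ≤ D.kap) : 0 < D.q := by unfold Setup.q; positivity

lemma q_le_one (hlam : 0 < D.lam) (hκ : 0 ≤ D.kap) : D.q ≤ 1 :=
  (div_le_one (by linarith)).2 (by linarith)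

lemma nextAlpha_sqrt (hq : 0 ≤ D.q) : D.nextAlpha (Real.sqrt D.q) = Real.sqrt D.q := by
  unfold Setup.nextAlpha
  rw [Real.sq_sqrt hq, sub_self, zero_pow two_ne_zero, zero_add, zero_add,
    show 4 * D.q = (2 * Real.sqrt D.q) ^ 2 by rw [mul_pow, Real.sq_sqrt hq]; norm_num,
    Real.sqrt_sq (by positivity), mul_div_cancel_left₀ _ two_ne_zero]

lemma catalyst_alpha (hq : 0 ≤ D.q) (ξ : ℕ → ℕ → Noise n m S S₁) (k : ℕ) :
    (D.catalyst ξ k).α = Real.sqrt D.q := by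
  induction k with
  | zero => rfl
  | succ k ih =>
    change D.nextAlpha (D.catalyst ξ k).α = _
    rw [ih, nextAlpha_sqrt hq]

/-- The extrapolated points of Catalyst. -/
def lookahead (D : Setup d n m S S₁) (ξ : ℕ → ℕ → Noise n m S S₁) : ℕ → Vec d
  | 0 => D.x₀
  | k + 1 => (D.catalyst ξ k).x
      + (Real.sqrt D.q)⁻¹ • ((D.catalyst ξ (k + 1)).x - (D.catalyst ξ k).x)

/-- With `α = s` the momentum coefficient `s(1 - s)/(s² + s)` equals `(s/(1 + s))(1/s - 1)`. So the
prox-center lies between the iterate and the extrapolated point, as the accelerated step requires.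
-/
lemma catalyst_y (hq : 0 < D.q) (ξ : ℕ → ℕ → Noise n m S S₁) (k : ℕ) :
    (D.catalyst ξ k).y = (D.catalyst ξ k).x
      + (Real.sqrt D.q / (1 + Real.sqrt D.q)) • (lookahead D ξ k - (D.catalyst ξ k).x) := by
  cases k with
  | zero => simp [lookahead, Setup.catalyst]
  | succ k =>
    have hy : (D.catalyst ξ (k + 1)).y = (D.catalyst ξ (k + 1)).x
        + ((D.catalyst ξ k).α * (1 - (D.catalyst ξ k).α)
          / ((D.catalyst ξ k).α ^ 2 + (D.catalyst ξ (k + 1)).α))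
        • ((D.catalyst ξ (k + 1)).x - (D.catalyst ξ k).x) := rfl
    rw [hy, catalyst_alpha hq.le, catalyst_alpha hq.le, lookahead]
    have hs : 0 < Real.sqrt D.q := Real.sqrt_pos.2 hq
    generalize Real.sqrt D.q = s at hs
    generalize (D.catalyst ξ (k + 1)).x = x'
    generalize (D.catalyst ξ k).x = x
    have h1 : s * (1 - s) / (s ^ 2 + s) = (s / (1 + s)) * (s⁻¹ - 1) := by
      field_simp
      ring
    rw [h1]
    module

/-- The Lyapunov function of Catalyst. -/
def potential (D : Setup d n m S S₁) (ξ : ℕ → ℕ → Noise n m S S₁) (xs : Vec d) (k : ℕ) : ℝ :=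
  D.P (D.catalyst ξ k).x - D.P xs + D.lam / 2 * ‖lookahead D ξ k - xs‖ ^ 2

lemma eps_succ (k : ℕ) : D.ε (k + 1) = (1 - D.rho) * D.ε k := by
  unfold Setup.ε
  ring

lemma eps_nonneg (hA : ProblemAssumptions D.f D.ψ Lf Lbar L Lψ D.lam) (hρ : D.rho ≤ 1) (k : ℕ) :
    0 ≤ D.ε k := by
  obtain ⟨xs, hxs⟩ := (quadBounds_P hA).exists_isMin hA.lam_pos
  have h1 : D.Pmin = D.P xs := iInf_eq_of_isMin hxs
  unfold Setup.ε
  rw [h1]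
  exact mul_nonneg (by linarith [hxs D.x₀]) (pow_nonneg (by linarith) k)

lemma sqrt_q_sq_mul (hlam : 0 < D.lam) (hκ : 0 ≤ D.kap) :
    Real.sqrt D.q ^ 2 * (D.lam + D.kap) = D.lam := by
  rw [Real.sq_sqrt (q_pos hlam hκ).le, Setup.q, div_mul_cancel₀ _ (by linarith)]

/-- The outer iterations of Catalyst converge linearly as long as the subproblems are solved with
the prescribed accuracies. -/
lemma potential_le (hA : ProblemAssumptions D.f D.ψ Lf Lbar L Lψ D.lam) (hκ : 0 ≤ D.kap)
    (hρ0 : 0 ≤ D.rho) (hρ : D.rho < Real.sqrt D.q) {xs : Vec d} (hxs : ∀ u, D.P xs ≤ D.P u)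
    (ξ : ℕ → ℕ → Noise n m S S₁) (k : ℕ)
    (hacc : ∀ l < k, D.G (D.catalyst ξ l).y (D.catalyst ξ (l + 1)).x - D.Gmin (D.catalyst ξ l).y
      ≤ D.ε (l + 1)) :
    potential D ξ xs k ≤ 9 / (Real.sqrt D.q - D.rho) ^ 2 * D.ε k := by
  have hlam := hA.lam_pos
  have hq := q_pos hlam hκ
  have hs0 := Real.sqrt_pos.2 hq
  have hs1 : Real.sqrt D.q ≤ 1 := Real.sqrt_le_one.2 (q_le_one hlam hκ)
  have hs := sqrt_q_sq_mul hlam hκ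
  set s := Real.sqrt D.q with hsdef
  set g := s - D.rho with hg
  have hg0 : 0 < g := by linarith
  have hg1 : g ≤ 1 := by linarith
  have hPmin : D.Pmin = D.P xs := iInf_eq_of_isMin hxs
  induction k with
  | zero =>
    have h1 := (quadBounds_P hA).le_of_isMin hxs D.x₀
    have h2 : potential D ξ xs 0 = D.P D.x₀ - D.P xs + D.lam / 2 * ‖D.x₀ - xs‖ ^ 2 := rfl
    have h3 : D.ε 0 = 2 / 9 * (D.P D.x₀ - D.P xs) := by unfold Setup.ε; rw [hPmin]; ring
    -- The factor `2/9` in `ε` is matched here: the initial potential is at most twice the initial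
    -- gap, which is `9 ε 0`.
    have h4 : 9 ≤ 9 / g ^ 2 := by
      rw [le_div_iff₀ (by positivity)]
      nlinarith
    have h5 := mul_le_mul_of_nonneg_right h4 (eps_nonneg hA (by linarith : D.rho ≤ 1) 0)
    linarith
  | succ k ih =>
    have ih' := ih fun l hl => hacc l (by omega)
    obtain ⟨p, hp⟩ := (quadBounds_G hA (D.catalyst ξ k).y).exists_isMin (by linarith)
    have hx := hacc k (by omega)
    rw [Gmin_eq_of_isMin hp] at hx
    have hstep := accelerated_step_le hlam hs0 hs1 hs hκ (quadBounds_P hA) (half_pos hg0) hxs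
      (catalyst_y hq ξ k) hp hx
    have hstep' : (1 - g / 2) * potential D ξ xs (k + 1)
        ≤ (1 - s) * potential D ξ xs k + D.ε (k + 1) * (1 + 1 / (g / 2)) := hstep
    have hε := eps_nonneg hA (by linarith : D.rho ≤ 1) k
    rw [eps_succ] at hstep' ⊢
    have h1 := mul_le_mul_of_nonneg_left ih' (by linarith : 0 ≤ 1 - s)
    -- The Young parameter is `t = g/2`. After multiplication by `g²` the gain is `9g`, from `1 - s
    -- = (1 - ρ₀) - g`, and the cost is at most `g² + 2g + (9/2) g ≤ 9g`.
    have h2 : (1 - s) * (9 / g ^ 2) + (1 - D.rho) * (1 + 1 / (g / 2))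
        ≤ (1 - g / 2) * (9 / g ^ 2 * (1 - D.rho)) := by
      have e1 : (1 - s) * (9 / g ^ 2) + (1 - D.rho) * (1 + 1 / (g / 2))
          = ((1 - s) * 9 + (1 - D.rho) * (g ^ 2 + 2 * g)) / g ^ 2 := by field_simp
      have e2 : (1 - g / 2) * (9 / g ^ 2 * (1 - D.rho)) = ((1 - g / 2) * 9 * (1 - D.rho)) / g ^ 2 := by
        ring
      rw [e1, e2]
      refine div_le_div_of_nonneg_right ?_ (by positivity)
      have hr : D.rho = s - g := by rw [hg]; ring
      have h3 : (1 - D.rho) * (g ^ 2 + 2 * g + 9 / 2 * g) ≤ 1 * (9 * g) :=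
        mul_le_mul (by linarith) (by nlinarith) (by positivity) zero_le_one
      nlinarith
    have h3 := mul_le_mul_of_nonneg_right h2 hε
    refine le_of_mul_le_mul_left ?_ (by linarith : 0 < 1 - g / 2)
    linarith

/-- The initial gap of the next subproblem of Catalyst. -/
theorem catalyst_gap_le (hA : ProblemAssumptions D.f D.ψ Lf Lbar L Lψ D.lam) (hκ : 0 ≤ D.kap)
    (hρ0 : 0 ≤ D.rho) (hρ : D.rho < Real.sqrt D.q) (ξ : ℕ → ℕ → Noise n m S S₁) (k : ℕ)
    (hacc : ∀ l < k, D.G (D.catalyst ξ l).y (D.catalyst ξ (l + 1)).x - D.Gmin (D.catalyst ξ l).y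
      ≤ D.ε (l + 1)) :
    D.G (D.catalyst ξ k).y (D.catalyst ξ k).x - D.Gmin (D.catalyst ξ k).y
      ≤ 45 / (Real.sqrt D.q - D.rho) ^ 3 * D.ε (k + 1) := by
  obtain ⟨xs, hxs⟩ := (quadBounds_P hA).exists_isMin hA.lam_pos
  have hΦ := potential_le hA hκ hρ0 hρ hxs ξ k hacc
  have hlam := hA.lam_pos
  have hq := q_pos hlam hκ
  have hs0 := Real.sqrt_pos.2 hq
  have hs1 : Real.sqrt D.q ≤ 1 := Real.sqrt_le_one.2 (q_le_one hlam hκ)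
  have hs := sqrt_q_sq_mul hlam hκ
  have hε := eps_nonneg hA (by linarith : D.rho ≤ 1) k
  obtain ⟨p, hp⟩ := (quadBounds_G hA (D.catalyst ξ k).y).exists_isMin (by linarith)
  rw [Gmin_eq_of_isMin hp, eps_succ]
  have hy := catalyst_y hq ξ k
  have hmin := (quadBounds_P hA).le_of_isMin hxs (D.catalyst ξ k).x
  unfold potential at hΦ
  unfold Setup.G
  set s := Real.sqrt D.q with hsdef
  set x := (D.catalyst ξ k).x
  set y := (D.catalyst ξ k).y
  set v := lookahead D ξ k
  set g := s - D.rho with hg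
  have hg0 : 0 < g := by linarith
  -- From `x - y = -(s/(1 + s))(v - x)` and `κ s² ≤ λ`. The proximal term at the warm start is thus
  -- controlled by the potential, and five potentials cover the whole gap.
  have h1 : D.kap / 2 * ‖x - y‖ ^ 2 ≤ D.lam / 2 * ‖v - x‖ ^ 2 := by
    have e1 : x - y = -((s / (1 + s)) • (v - x)) := by rw [hy]; abel
    rw [e1, norm_neg, norm_smul, mul_pow, Real.norm_eq_abs, sq_abs, ← mul_assoc]
    refine mul_le_mul_of_nonneg_right ?_ (sq_nonneg _)
    have h2 : (s / (1 + s)) ^ 2 ≤ s ^ 2 :=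
      pow_le_pow_left₀ (by positivity) (div_le_self hs0.le (by linarith)) 2
    nlinarith
  have h2 : ‖v - x‖ ^ 2 ≤ 2 * ‖v - xs‖ ^ 2 + 2 * ‖x - xs‖ ^ 2 := by
    have e1 : v - x = (v - xs) - (x - xs) := by abel
    rw [e1]
    have := parallelogram_law_with_norm ℝ (v - xs) (x - xs)
    nlinarith [sq_nonneg ‖v - xs + (x - xs)‖]
  have h3 := mul_le_mul_of_nonneg_left h2 (half_pos hlam).le
  have h4 : 0 ≤ D.kap / 2 * ‖p - y‖ ^ 2 := by positivity
  -- The third power of `g` pays for passing from `ε k` to `ε (k + 1)`, because `g ≤ 1 - ρ₀`.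
  have h5 : 45 / g ^ 2 * D.ε k ≤ 45 / g ^ 3 * ((1 - D.rho) * D.ε k) := by
    rw [← mul_assoc]
    refine mul_le_mul_of_nonneg_right ?_ hε
    rw [div_mul_eq_mul_div, div_le_div_iff₀ (by positivity) (by positivity)]
    have : g ≤ 1 - D.rho := by linarith
    calc 45 * g ^ 3 = 45 * g ^ 2 * g := by ring
      _ ≤ 45 * g ^ 2 * (1 - D.rho) := mul_le_mul_of_nonneg_left this (by positivity)
      _ = _ := by ring
  have h6 : 45 / g ^ 2 * D.ε k = 5 * (9 / g ^ 2 * D.ε k) := by ring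
  have h7 : 0 ≤ D.lam / 2 * ‖v - xs‖ ^ 2 := by positivity
  linarith [hxs p, hxs x]

end Catalyst

/-! ### The expected number of inner iterations of Catalyst -/

section Constants

variable {d n m : ℕ} {S S₁ : Type*} {D : Setup d n m S S₁} {Lf Lbar L Lψ a c₁ g W : ℝ}

/-- Only the logarithm of the warm-start ratio enters, so the power of `g` becomes a factor `3`. -/
lemma log_accuracy_le (hg0 : 0 < g) (hg1 : g ≤ 1) :
    Real.log (5 * (45 / g ^ 3)) + 2 ≤ (Real.log 225 + 5) * (1 + Real.log (1 / g)) := by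
  have h1 : 5 * (45 / g ^ 3) = 225 * (1 / g) ^ 3 := by ring
  have h2 : 0 ≤ Real.log (1 / g) := Real.log_nonneg (by rw [le_div_iff₀ hg0]; linarith)
  have h3 : 0 ≤ Real.log 225 := Real.log_nonneg (by norm_num)
  rw [h1, Real.log_mul (by norm_num) (by positivity), Real.log_pow]
  push_cast
  nlinarith [mul_nonneg h3 h2]

lemma one_div_theta_le (hη : 0 < D.η) (hμ : 0 < D.lam + D.kap) (hδ : 0 < D.δ) (hδ₁ : 0 < D.δ₁)
    (hp : 0 < D.p) (h1 : 2 / ((D.lam + D.kap) * D.η) ≤ W) (h2 : 4 / D.δ ≤ W)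
    (h3 : 4 / D.δ₁ ≤ W) (h4 : 4 / D.p ≤ W) : 1 / D.θ ≤ W := by
  have hW : 0 < W := lt_of_lt_of_le (by positivity) h2
  have key : ∀ {x c : ℝ}, 0 < x → 0 < c → c / x ≤ W → 1 / W ≤ x / c := by
    intro x c hx hc h
    rw [div_le_iff₀ hx] at h
    rw [div_le_div_iff₀ hW hc]
    linarith
  have h5 : 1 / W ≤ D.θ :=
    le_min (le_min (key (by positivity) two_pos h1) (key hδ four_pos h2))
      (le_min (key hδ₁ four_pos h3) (key hp four_pos h4))
  rw [div_le_iff₀ (lt_of_lt_of_le (by positivity) h5)]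
  rw [div_le_iff₀ hW] at h5
  linarith

/-- The complexity factor in the bound on the number of inner iterations. -/
def complexity (D : Setup d n m S S₁) (Lf L Lψ : ℝ) : ℝ :=
  1 / D.δ + 1 / D.δ₁ + (Lf + Lψ) / (D.lam + D.kap) + L / (n * (D.lam + D.kap))
    + Real.sqrt (1 - D.δ) * (Lf + Lψ + D.kap) / (D.δ * (D.lam + D.kap))

lemma le_complexity (hLf : 0 ≤ Lf) (hLψ : 0 ≤ Lψ) (hL : 0 ≤ L) (hlam : 0 < D.lam)
    (hκ : 0 ≤ D.kap) (hδ : 0 < D.δ) (hδ₁ : 0 < D.δ₁) :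
    1 / D.δ ≤ complexity D Lf L Lψ ∧ 1 / D.δ₁ ≤ complexity D Lf L Lψ := by
  have h1 : 0 ≤ (Lf + Lψ) / (D.lam + D.kap) := by positivity
  have h2 : 0 ≤ L / (n * (D.lam + D.kap)) := by positivity
  have h3 : 0 ≤ Real.sqrt (1 - D.δ) * (Lf + Lψ + D.kap) / (D.δ * (D.lam + D.kap)) := by
    positivity
  have h4 : 0 < 1 / D.δ := by positivity
  have h5 : 0 < 1 / D.δ₁ := by positivity
  unfold complexity
  constructor <;> linarith

lemma one_div_theta_le_complexity (ha : 0 < a) (hc₁ : 0 < c₁)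
    (hLf : 0 ≤ Lf) (hLψ : 0 ≤ Lψ) (hL : 0 ≤ L)
    (hlam : 0 < D.lam) (hκ : 0 ≤ D.kap) (hδ : 0 < D.δ) (hδ1 : D.δ ≤ 1) (hδ₁ : 0 < D.δ₁)
    (hp : 0 < D.p) (hpc : c₁ * D.δ₁ ≤ D.p) (hη0 : 0 < D.η)
    (hη : D.η = a / (Lf + Lψ + D.kap + L / n
      + Real.sqrt (1 - D.δ) * (Lf + Lψ + D.kap) / D.δ)) :
    1 / D.θ ≤ (2 / a + 4 + 4 / c₁) * complexity D Lf L Lψ := by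
  obtain ⟨hR, hR₁⟩ := le_complexity (n := n) (m := m) (D := D) hLf hLψ hL hlam hκ hδ hδ₁
  have hμ : 0 < D.lam + D.kap := by linarith
  have hR0 : 0 < complexity D Lf L Lψ := lt_of_lt_of_le (by positivity) hR
  have t1 : 0 ≤ 2 / a * complexity D Lf L Lψ := by positivity
  have t2 : 0 ≤ 4 / c₁ * complexity D Lf L Lψ := by positivity
  have e4 : ∀ x : ℝ, 4 / x = 4 * (1 / x) := fun x => by ring
  refine one_div_theta_le hη0 hμ hδ hδ₁ hp ?_ ?_ ?_ ?_
  · have h1 : 2 / ((D.lam + D.kap) * D.η) = 2 / a * ((Lf + Lψ + D.kap + L / n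
        + Real.sqrt (1 - D.δ) * (Lf + Lψ + D.kap) / D.δ) / (D.lam + D.kap)) := by
      rw [hη]
      simp only [div_eq_mul_inv, mul_inv, inv_inv]
      ring
    have h2 : (Lf + Lψ + D.kap + L / n
        + Real.sqrt (1 - D.δ) * (Lf + Lψ + D.kap) / D.δ) / (D.lam + D.kap)
        ≤ complexity D Lf L Lψ := by
      have h3 : D.kap / (D.lam + D.kap) ≤ 1 := (div_le_one hμ).2 (by linarith)
      have h4 : 1 ≤ 1 / D.δ := by rw [le_div_iff₀ hδ]; linarith
      have h5 : 0 < 1 / D.δ₁ := by positivity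
      unfold complexity
      rw [add_div, add_div, add_div, div_div, div_div]
      linarith
    rw [h1]
    have := mul_le_mul_of_nonneg_left h2 (by positivity : 0 ≤ 2 / a)
    linarith
  · rw [e4]; linarith
  · rw [e4]; linarith
  · have h1 : 4 / D.p ≤ 4 / (c₁ * D.δ₁) :=
      div_le_div_of_nonneg_left (by norm_num) (by positivity) hpc
    have h2 : 4 / (c₁ * D.δ₁) = 4 / c₁ * (1 / D.δ₁) := by
      simp only [div_eq_mul_inv, mul_inv, one_mul, mul_assoc]
    have h3 := mul_le_mul_of_nonneg_left hR₁ (by positivity : 0 ≤ 4 / c₁)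
    linarith

end Constants

/-! ### Freezing the random outer state by independence. -/

section Trajectory

variable {d n m : ℕ} {S S₁ : Type*} {D : Setup d n m S S₁} {Lf Lbar L Lψ a c₂ : ℝ}

/-- In dimension zero every point is optimal, so the method stops at the first admissible time. -/
lemma innerTime_le_one_of_subsingleton [Subsingleton (Vec d)]
    (hA : ProblemAssumptions D.f D.ψ Lf Lbar L Lψ D.lam) (hκ : 0 ≤ D.kap) {k : ℕ}
    (hε : 0 ≤ D.ε k) (x y : Vec d) (ξ : ℕ → Noise n m S S₁) : D.innerTime k x y ξ ≤ 1 := by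
  obtain ⟨p, hp⟩ := (quadBounds_G hA y).exists_isMin (by linarith [hA.lam_pos])
  refine sInf_le ⟨1, rfl, le_rfl, ?_⟩
  rw [Gmin_eq_of_isMin hp, Subsingleton.elim p (D.innerAvg x y ξ 1), sub_self]
  exact hε

lemma catalyst_accuracy {ξ : ℕ → ℕ → Noise n m S S₁} {k : ℕ} (h : D.T ξ (k + 1) ≠ ⊤) :
    D.G (D.catalyst ξ k).y (D.catalyst ξ (k + 1)).x - D.Gmin (D.catalyst ξ k).y ≤ D.ε (k + 1) :=
  innerTime_spec h

variable [MeasurableSpace S] [MeasurableSpace S₁]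

lemma measurable_catalyst {A : Type*} [MeasurableSpace A] (hn : 0 < n) (hm : 0 < m)
    (hA : ProblemAssumptions D.f D.ψ Lf Lbar L Lψ D.lam) (hκ : 0 ≤ D.kap)
    (hQ : Measurable (Function.uncurry D.Q)) (hQ₁ : Measurable (Function.uncurry D.Q₁))
    {ξ : A → ℕ → ℕ → Noise n m S S₁} (k : ℕ) (hξ : ∀ l ≤ k, ∀ K, Measurable fun a => ξ a l K) :
    Measurable fun a => D.catalyst (ξ a) k := by
  induction k with
  | zero => exact measurable_const
  | succ k ih =>
    exact measurable_outerStep hn hm hA hκ hQ hQ₁ (k + 1) (ih fun l hl => hξ l (by omega))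
      (measurable_pi_lambda _ (hξ (k + 1) le_rfl))

lemma measurable_T {A : Type*} [MeasurableSpace A] (hn : 0 < n) (hm : 0 < m)
    (hA : ProblemAssumptions D.f D.ψ Lf Lbar L Lψ D.lam) (hκ : 0 ≤ D.kap)
    (hQ : Measurable (Function.uncurry D.Q)) (hQ₁ : Measurable (Function.uncurry D.Q₁))
    {ξ : A → ℕ → ℕ → Noise n m S S₁} (hξ : ∀ l K, Measurable fun a => ξ a l K) (k : ℕ) :
    Measurable fun a => D.T (ξ a) k := by
  have ho := measurable_outer_iff.1
    (measurable_catalyst hn hm hA hκ hQ hQ₁ (k - 1) fun l _ => hξ l)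
  exact measurable_innerTime hn hm hA hκ hQ hQ₁ k ho.1 ho.2.1 (measurable_pi_lambda _ (hξ k))

variable {Ω : Type*} [MeasurableSpace Ω] {μ : Measure Ω}
  {ξ : ℕ → ℕ → Ω → Noise n m S S₁}

/-- The state of Catalyst is independent of the noise of the next outer iteration. -/
lemma indepFun_catalyst (hn : 0 < n) (hm : 0 < m)
    (hA : ProblemAssumptions D.f D.ψ Lf Lbar L Lψ D.lam) (hκ : 0 ≤ D.kap)
    (hQ : Measurable (Function.uncurry D.Q)) (hQ₁ : Measurable (Function.uncurry D.Q₁))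
    (hξ : ∀ k K, Measurable (ξ k K)) (hind : iIndepFun (fun j : ℕ × ℕ => ξ j.1 j.2) μ) (k : ℕ) :
    IndepFun (fun ω => D.catalyst (fun l K => ξ l K ω) k) (fun ω K => ξ (k + 1) K ω) μ := by
  have hIJ : Disjoint {j : ℕ × ℕ | j.1 ≤ k} {j : ℕ × ℕ | j.1 = k + 1} := by
    rw [Set.disjoint_left]
    intro j h1 h2
    have h1' : j.1 ≤ k := h1
    have h2' : j.1 = k + 1 := h2
    omega
  refine indepFun_of_disjoint (ξ := fun j : ℕ × ℕ => ξ j.1 j.2) (fun j => hξ j.1 j.2) hind hIJ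
    ?_ ?_
  · exact @measurable_catalyst d n m S S₁ D Lf Lbar L Lψ _ _ Ω
      (⨆ i ∈ {j : ℕ × ℕ | j.1 ≤ k}, MeasurableSpace.comap (ξ i.1 i.2) inferInstance)
      hn hm hA hκ hQ hQ₁ (fun ω l K => ξ l K ω) k fun l hl K =>
        measurable_biSup_comap (ξ := fun j : ℕ × ℕ => ξ j.1 j.2) (i := (l, K)) hl
  · exact @measurable_pi_lambda _ _ _
      (⨆ i ∈ {j : ℕ × ℕ | j.1 = k + 1}, MeasurableSpace.comap (ξ i.1 i.2) inferInstance) _ _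
      fun K => measurable_biSup_comap (ξ := fun j : ℕ × ℕ => ξ j.1 j.2) (i := (k + 1, K)) rfl

variable [IsProbabilityMeasure μ]

lemma lintegral_T_eq (hn : 0 < n) (hm : 0 < m)
    (hA : ProblemAssumptions D.f D.ψ Lf Lbar L Lψ D.lam) (hκ : 0 ≤ D.kap)
    (hQ : Measurable (Function.uncurry D.Q)) (hQ₁ : Measurable (Function.uncurry D.Q₁))
    (hξ : ∀ k K, Measurable (ξ k K)) (hind : iIndepFun (fun j : ℕ × ℕ => ξ j.1 j.2) μ) (k : ℕ) :
    ∫⁻ ω, (D.T (fun l K => ξ l K ω) (k + 1) : ℝ≥0∞) ∂μ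
      = ∫⁻ ω, ∫⁻ ω', (D.innerTime (k + 1) (D.catalyst (fun l K => ξ l K ω) k).x
          (D.catalyst (fun l K => ξ l K ω) k).y (fun K => ξ (k + 1) K ω') : ℝ≥0∞) ∂μ ∂μ := by
  have ho : Measurable fun r : Outer d × (ℕ → Noise n m S S₁) => r.1 := measurable_fst
  have ho' := measurable_outer_iff.1 ho
  have hΦ : Measurable fun r : Outer d × (ℕ → Noise n m S S₁) =>
      (D.innerTime (k + 1) r.1.x r.1.y r.2 : ℝ≥0∞) :=
    (measurable_of_countable (fun t : ℕ∞ => (t : ℝ≥0∞))).comp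
      (measurable_innerTime hn hm hA hκ hQ hQ₁ (k + 1) ho'.1 ho'.2.1 measurable_snd)
  exact lintegral_indepFun
    (measurable_catalyst hn hm hA hκ hQ hQ₁ (ξ := fun ω l K => ξ l K ω) k fun l _ K => hξ l K)
    (measurable_pi_lambda _ (hξ (k + 1)))
    (indepFun_catalyst hn hm hA hκ hQ hQ₁ hξ hind k) hΦ

variable (ν : Measure S) [IsProbabilityMeasure ν] (ν₁ : Measure S₁) [IsProbabilityMeasure ν₁]

/-- The expected number of inner iterations in every outer iteration of Catalyst. -/
theorem lintegral_T_le (hn : 0 < n) (hm : 0 < m)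
    (hA : ProblemAssumptions D.f D.ψ Lf Lbar L Lψ D.lam) (hκ : 0 ≤ D.kap)
    (hρ0 : 0 ≤ D.rho) (hρ : D.rho < Real.sqrt D.q) (hMc : 0 < L + Lψ + D.kap)
    (hQ : IsContractionCompressor ν D.Q D.δ) (hs : MeanScaled ν D.Q D.δ)
    (hQ₁ : IsContractionCompressor ν₁ D.Q₁ D.δ₁) (hs₁ : MeanScaled ν₁ D.Q₁ D.δ₁)
    (hb : StepBounds (D.lam + D.kap) (Lf + Lψ + D.kap) ((L + Lψ + D.kap) / n) D.η a c₂
      D.δ D.δ₁ D.p D.θ)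
    (hξ : ∀ k K, Measurable (ξ k K)) (hlaw : ∀ k K, μ.map (ξ k K) = noiseLaw n m ν ν₁ D.p)
    (hind : iIndepFun (fun j : ℕ × ℕ => ξ j.1 j.2) μ) (k : ℕ) :
    (∀ᵐ ω ∂μ, ∀ l < k, D.T (fun l K => ξ l K ω) (l + 1) ≠ ⊤) ∧
    ∫⁻ ω, (D.T (fun l K => ξ l K ω) (k + 1) : ℝ≥0∞) ∂μ
      ≤ ENNReal.ofReal ((Real.log (5 * (45 / (Real.sqrt D.q - D.rho) ^ 3)) + 2) / D.θ) := by
  have hs1 : Real.sqrt D.q ≤ 1 := Real.sqrt_le_one.2 (q_le_one hA.lam_pos hκ)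
  have hB : 1 ≤ 45 / (Real.sqrt D.q - D.rho) ^ 3 := by
    have h1 : (Real.sqrt D.q - D.rho) ^ 3 ≤ 1 := pow_le_one₀ (by linarith) (by linarith)
    have h2 : 0 < (Real.sqrt D.q - D.rho) ^ 3 := pow_pos (by linarith) 3
    rw [le_div_iff₀ h2]
    linarith
  have hexp : ∀ k, (∀ᵐ ω ∂μ, ∀ l < k, D.T (fun l K => ξ l K ω) (l + 1) ≠ ⊤) →
      ∫⁻ ω, (D.T (fun l K => ξ l K ω) (k + 1) : ℝ≥0∞) ∂μ
        ≤ ENNReal.ofReal ((Real.log (5 * (45 / (Real.sqrt D.q - D.rho) ^ 3)) + 2) / D.θ) := by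
    intro k hfin
    rw [lintegral_T_eq hn hm hA hκ hQ.measurable hQ₁.measurable hξ hind k]
    refine (lintegral_mono_ae ?_).trans_eq
      (show ∫⁻ _, ENNReal.ofReal _ ∂μ = _ by rw [lintegral_const, measure_univ, mul_one])
    filter_upwards [hfin] with ω hω
    have hinj : Function.Injective fun K : ℕ => (k + 1, K) := fun K K' h => (Prod.mk.inj h).2
    have hind' : iIndepFun (fun K => ξ (k + 1) K) μ :=
      iIndepFun.precomp (f := fun j : ℕ × ℕ => ξ j.1 j.2) hinj hind
    exact lintegral_innerTime_le ν ν₁ hn hm hA hκ hMc hQ hs hQ₁ hs₁ hb (hξ (k + 1))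
      (hlaw (k + 1)) hind' (k + 1) _ _ (eps_nonneg hA (by linarith) _) hB
      (catalyst_gap_le hA hκ hρ0 hρ _ k fun l hl => catalyst_accuracy (hω l hl))
  -- Induction over the outer iterations: finite expectation makes the current stopping time almost
  -- surely finite, hence its accuracy is reached, which is the hypothesis for the next expectation
  -- bound. The default value of `outerStep` at infinite time therefore never matters.
  suffices hfin : ∀ᵐ ω ∂μ, ∀ l < k, D.T (fun l K => ξ l K ω) (l + 1) ≠ ⊤ from ⟨hfin, hexp k hfin⟩
  induction k with
  | zero => exact ae_of_all _ fun ω l hl => absurd hl (Nat.not_lt_zero l)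
  | succ k ih =>
    have hmeas : Measurable fun ω => (D.T (fun l K => ξ l K ω) (k + 1) : ℝ≥0∞) :=
      (measurable_of_countable (fun t : ℕ∞ => (t : ℝ≥0∞))).comp
        (measurable_T hn hm hA hκ hQ.measurable hQ₁.measurable (ξ := fun ω l K => ξ l K ω) hξ _)
    have hlt := ae_lt_top hmeas ((hexp k ih).trans_lt ENNReal.ofReal_lt_top).ne
    filter_upwards [ih, hlt] with ω h1 h2 l hl
    rcases Nat.lt_succ_iff_lt_or_eq.1 hl with h | rfl
    · exact h1 l h
    · intro h
      rw [h] at h2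
      simp at h2

end Trajectory

end ECLSVRG

end

theorem mainTheorem4 (c₁ c₂ : ℝ) (hc₁ : 0 < c₁) (hc₂ : c₁ ≤ c₂) :
    ∃ a : ℝ, 0 < a ∧ ∃ C : ℝ, 0 < C ∧
      ∀ (d n m : ℕ), 0 < n → 0 < m →
      ∀ (S S₁ Ω : Type*) [MeasurableSpace S] [MeasurableSpace S₁] [MeasurableSpace Ω]
        (ν : Measure S) [IsProbabilityMeasure ν] (ν₁ : Measure S₁) [IsProbabilityMeasure ν₁]
        (μ : Measure Ω) [IsProbabilityMeasure μ]
        (D : ECLSVRG.Setup d n m S S₁) (Lf Lbar L Lψ : ℝ),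
        ECLSVRG.ProblemAssumptions D.f D.ψ Lf Lbar L Lψ D.lam →
        ECLSVRG.IsContractionCompressor ν D.Q D.δ →
        ECLSVRG.IsContractionCompressor ν₁ D.Q₁ D.δ₁ →
        ECLSVRG.MeanScaled ν D.Q D.δ →
        ECLSVRG.MeanScaled ν₁ D.Q₁ D.δ₁ →
        0 ≤ D.kap →
        0 ≤ D.rho → D.rho < Real.sqrt D.q →
        0 < D.p → D.p ≤ 1 → c₁ * D.δ₁ ≤ D.p → D.p ≤ c₂ * D.δ₁ →
        D.η = a / (Lf + Lψ + D.kap + L / n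
          + Real.sqrt (1 - D.δ) * (Lf + Lψ + D.kap) / D.δ) →
        ∀ (ξ : ℕ → ℕ → Ω → ECLSVRG.Noise n m S S₁),
          (∀ k K, Measurable (ξ k K)) →
          (∀ k K, μ.map (ξ k K) = ECLSVRG.noiseLaw n m ν ν₁ D.p) →
          iIndepFun (fun j : ℕ × ℕ => ξ j.1 j.2) μ →
          ∀ k : ℕ, 1 ≤ k →
            Measurable (fun ω => D.T (fun l K => ξ l K ω) k) ∧
            ∫⁻ ω, ((D.T (fun l K => ξ l K ω) k : ℕ∞) : ℝ≥0∞) ∂μ ≤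
              ENNReal.ofReal (C * (1 + Real.log (1 / (Real.sqrt D.q - D.rho))) *
                (1 / D.δ + 1 / D.δ₁ + (Lf + Lψ) / (D.lam + D.kap)
                  + L / (n * (D.lam + D.kap))
                  + Real.sqrt (1 - D.δ) * (Lf + Lψ + D.kap) / (D.δ * (D.lam + D.kap)))) := by
  have hc2 : 0 < c₂ := hc₁.trans_le hc₂
  have ha := ECLSVRG.stepConst_pos hc2
  have hlog : 0 ≤ Real.log 225 := Real.log_nonneg (by norm_num)
  have hC1 : 4 ≤ 2 / ECLSVRG.stepConst c₂ + 4 + 4 / c₁ := by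
    have h1 : 0 < 2 / ECLSVRG.stepConst c₂ := by positivity
    have h2 : 0 < 4 / c₁ := by positivity
    linarith
  -- The first factor of `C` bounds `1/θ` by the complexity, with `4/c₁` coming from `p ≥ c₁ δ₁`.
  -- The second comes from the logarithm, with `225 = 5 · 45`.
  refine ⟨ECLSVRG.stepConst c₂, ha,
    (2 / ECLSVRG.stepConst c₂ + 4 + 4 / c₁) * (Real.log 225 + 5), by positivity, ?_⟩
  intro d n m hn hm S S₁ Ω _ _ _ ν _ ν₁ _ μ _ D Lf Lbar L Lψ hA hQ hQ₁ hs hs₁ hκ hρ0 hρ hp0 hp1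
    hpc₁ hpc₂ hη ξ hξ hlaw hind k hk
  have hlam := hA.lam_pos
  have hLf : 0 ≤ Lf := hA.smooth_global.1
  have hLψ : 0 ≤ Lψ := hA.smooth_reg.1
  have hL : 0 ≤ L := (hA.smooth_component ⟨0, hn⟩ ⟨0, hm⟩).1
  have hs1 : Real.sqrt D.q ≤ 1 := Real.sqrt_le_one.2 (ECLSVRG.q_le_one hlam hκ)
  have hg0 : 0 < Real.sqrt D.q - D.rho := by linarith
  have hg1 : Real.sqrt D.q - D.rho ≤ 1 := by linarith
  have hlg : 0 ≤ Real.log (1 / (Real.sqrt D.q - D.rho)) :=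
    Real.log_nonneg (by rw [le_div_iff₀ hg0]; linarith)
  have hR := ECLSVRG.le_complexity (D := D) hLf hLψ hL hlam hκ hQ.pos hQ₁.pos
  have hδ1 : 1 ≤ 1 / D.δ := by rw [le_div_iff₀ hQ.pos]; linarith [hQ.le_one]
  refine ⟨ECLSVRG.measurable_T hn hm hA hκ hQ.measurable hQ₁.measurable hξ k, ?_⟩
  change _ ≤ ENNReal.ofReal (_ * ECLSVRG.complexity D Lf L Lψ)
  -- Dimension zero is separate: there `λ ≤ Lψ` may fail and the denominator of the step size may
  -- vanish.
  rcases Nat.eq_zero_or_pos d with rfl | hd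
  · have h1 : ∀ ω, ((D.T (fun l K => ξ l K ω) k : ℕ∞) : ℝ≥0∞) ≤ 1 := fun ω => by
      exact_mod_cast ECLSVRG.innerTime_le_one_of_subsingleton hA hκ
        (ECLSVRG.eps_nonneg hA (by linarith) k) _ _ _
    refine (lintegral_mono h1).trans ?_
    rw [lintegral_const, measure_univ, mul_one, ENNReal.one_le_ofReal]
    refine one_le_mul_of_one_le_of_one_le ?_ (hδ1.trans hR.1)
    refine one_le_mul_of_one_le_of_one_le ?_ (by linarith)
    exact one_le_mul_of_one_le_of_one_le (by linarith) (by linarith)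
  · obtain ⟨k, rfl⟩ : ∃ l, k = l + 1 := ⟨k - 1, by omega⟩
    have hMc : 0 < L + Lψ + D.kap := by linarith [ECLSVRG.lam_le_of_pos hd hA]
    have hb := ECLSVRG.stepBounds_of_stepsize hd hn hm hc2 hA hκ hQ.pos hQ₁.pos hp0 hp1 hpc₂ hη
    refine (ECLSVRG.lintegral_T_le ν ν₁ hn hm hA hκ hρ0 hρ hMc hQ hs hQ₁ hs₁ hb hξ hlaw hind
      k).2.trans (ENNReal.ofReal_le_ofReal ?_)
    have hθ := ECLSVRG.one_div_theta_le_complexity ha hc₁ hLf hLψ hL hlam hκ hQ.pos hQ.le_one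
      hQ₁.pos hp0 hpc₁ hb.eta_pos hη
    rw [div_eq_mul_one_div]
    refine (mul_le_mul (ECLSVRG.log_accuracy_le hg0 hg1) hθ
      (one_div_pos.2 hb.theta_pos).le (by positivity)).trans (le_of_eq ?_)
    ring
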